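/- Let $Z=\{Z(x,t): x\in\mathbb S^2,\ t\in\mathbb R\}$ be a jointly measurable, real-valued, centered Gaussian random field on $\mathbb S^2\times\mathbb R$ with $\mathbb E[Z(x,t)^2]=1$ and $\mathbb E[Z(x,t)Z(y,s)]=\Gamma(\langle x,y\rangle,t-s)$, where $\Gamma:[-1,1]\times\mathbb R\to\mathbb R$ is continuous. Let $P_\ell$ be the $\ell$-th Legendre polynomial, with $P_\ell(1)=1$, and for $\ell\ge0$ let $$C_\ell(\tau)=2\pi\int_{-1}^1\Gamma(\theta,\tau)P_\ell(\theta)\,d\theta,$$ that is, the coefficients in the expansion $\Gamma(\theta,\tau)=\sum_{\ell\ge0}\frac{2\ell+1}{4\pi}C_\ell(\tau)P_\ell(\theta)$. Let $\widetilde{\mathbb N}=\{\ell\ge0: C_\ell(0)\neq0\}$. Assume that there are $\alpha\in[2,\infty)$ and $\beta_\ell\in(0,1]$, $\ell\in\widetilde{\mathbb N}$, such that, for all $\ell\in\widetilde{\mathbb N}$, $C_\ell(\tau)=G_\ell(\tau)\,g_{\beta_\ell}(\tau)$, where $g_\beta(\tau)=(1+|\tau|)^{-\beta}$ for $\beta\in(0,1)$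 and $g_1(\tau)=(1+|\tau|)^{-\alpha}$, and $$\sup_{\ell\in\widetilde{\mathbb N}}\left|\frac{G_\ell(\tau)}{C_\ell(0)}-1\right|\to0\quad\text{as }\tau\to+\infty .$$ Assume moreover that $0\in\widetilde{\mathbb N}$, that $\int_{\mathbb R}C_0(\tau)\,d\tau>0$ if $\beta_0=1$, and that the minimum $\beta_{\ell^\star}:=\min\{\beta_\ell:\ell\in\widetilde{\mathbb N},\ \ell\ge1\}$ exists. For $u\in\mathbb R$ and $T>0$, let $\mathcal A_u(t)$ be the area of $\{x\in\mathbb S^2: Z(x,t)\ge u\}$ (the whole sphere having area $4\pi$), and let $$\mathcal M_T(u)=\int_0^T\big(\mathcal A_u(t)-\mathbb E[\mathcal A_u(t)]\big)\,dt,\qquad \widetilde{\mathcal M}_T(u)=\frac{\mathcal M_T(u)}{\sqrt{\mathrm{Var}(\mathcal M_T(u))}},\qquad \phi(u)=\frac{1}{\sqrt{2\pi}}e^{-u^2/2}.$$ If either $u\neq0$ and $\beta_0<\min(2\beta_{\ell^\star},1)$, or $u=0$ and $\beta_0<\min(3\beta_{\ell^\star},1)$, then $$\lim_{T\to\infty}\frac{\mathrm{Var}(\mathcal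 M_T(u))}{T^{2-\beta_0}}=4\pi\cdot\frac{2\phi(u)^2C_0(0)}{(1-\beta_0)(2-\beta_0)},$$ and $\widetilde{\mathcal M}_T(u)$ converges in distribution, as $T\to\infty$, to a standard Gaussian random variable. -/

import Mathlib

open MeasureTheory ProbabilityTheory Filter Topology

/-- The two-dimensional unit sphere in three-dimensional Euclidean space. -/
abbrev S2 : Type := Metric.sphere (0 : EuclideanSpace ℝ (Fin 3)) 1

/-- The area measure of the round metric on the unit sphere (total mass `4 * π`). -/
noncomputable def sphereArea : Measure S2 :=
  (volume : Measure (EuclideanSpace ℝ (Fin 3))).toSphere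

/-- The Legendre polynomial of degree `l`, by Rodrigues' formula
`P_l = (2 ^ l * l!)⁻¹ * (d/dx) ^ l (x ^ 2 - 1) ^ l`; it takes the value `1` at `1`. -/
noncomputable def legendrePoly (l : ℕ) : Polynomial ℝ :=
  Polynomial.C ((2 ^ l * (l.factorial : ℝ))⁻¹) *
    (Polynomial.derivative^[l]) ((Polynomial.X ^ 2 - 1) ^ l)

/-- `Z` is a jointly measurable, zero-mean, unit-variance, mean square continuous, isotropic and
stationary Gaussian random field on `S2 × ℝ`, with covariance function `Γ`, only the values of
which on `[-1, 1] × ℝ` matter. (That `Γ` is positive semidefinite follows from `covariance`.) -/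
structure IsSphereTimeGaussianField {Ω : Type*} [MeasurableSpace Ω] (P : Measure Ω)
    (Z : S2 → ℝ → Ω → ℝ) (Γ : ℝ → ℝ → ℝ) : Prop where
  measurable : Measurable fun p : Ω × S2 × ℝ => Z p.2.1 p.2.2 p.1
  gaussian : IsGaussianProcess (fun (p : S2 × ℝ) (ω : Ω) => Z p.1 p.2 ω) P
  centered : ∀ (x : S2) (t : ℝ), ∫ ω, Z x t ω ∂P = 0
  covariance : ∀ (x y : S2) (t s : ℝ),
    ∫ ω, Z x t ω * Z y s ω ∂P =
      Γ (inner ℝ (x : EuclideanSpace ℝ (Fin 3)) (y : EuclideanSpace ℝ (Fin 3))) (t - s)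
  continuousOn : ContinuousOn (Function.uncurry Γ) (Set.Icc (-1) 1 ×ˢ Set.univ)
  unit_variance : ∀ (x : S2) (t : ℝ), ∫ ω, Z x t ω ^ 2 ∂P = 1

/-- The time covariance `C_l` of the multipole `l`, that is, the coefficient in the expansion
`Γ(θ, τ) = ∑ l, (2 * l + 1) / (4 * π) * C_l(τ) * P_l(θ)`. As
`∫ P_l ^ 2 = 2 / (2 * l + 1)` on `[-1, 1]` and the `P_l` are orthogonal there, this is
`C_l(τ) = 2 * π * ∫ Γ(θ, τ) * P_l(θ) dθ`. -/
noncomputable def multipoleCov (Γ : ℝ → ℝ → ℝ) (l : ℕ) (τ : ℝ) : ℝ :=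
  2 * Real.pi * ∫ θ in (-1 : ℝ)..1, Γ θ τ * (legendrePoly l).eval θ

/-- The set of the multipoles `l` that are present in the field: `C_l(0) ≠ 0`. -/
def activeMultipoles (Γ : ℝ → ℝ → ℝ) : Set ℕ :=
  {l | multipoleCov Γ l 0 ≠ 0}

open Classical in
/-- The memory function: `(1 + |τ|) ^ (-β)` for `β < 1` (long memory), and `(1 + |τ|) ^ (-α)` for
`β = 1` (short memory). -/
noncomputable def memoryFun (α β τ : ℝ) : ℝ :=
  if β = 1 then (1 + |τ|) ^ (-α) else (1 + |τ|) ^ (-β)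

/-- The memory condition with exponents `β l ∈ (0, 1]`, `l` ranging over the multipoles that are
present, and with `α ∈ [2, ∞)` as the decay rate of the short-memory multipoles:
`C_l = G_l * g_{β l}`, where `G_l(τ) / C_l(0) → 1` as `τ → +∞`, uniformly in `l`; moreover the
multipole `0` is present, and `∫ C_0 > 0` if `β 0 = 1`. -/
structure HasMemoryExponents (Γ : ℝ → ℝ → ℝ) (α : ℝ) (β : ℕ → ℝ) : Prop where
  two_le : 2 ≤ α
  mem_Ioc : ∀ l ∈ activeMultipoles Γ, β l ∈ Set.Ioc (0 : ℝ) 1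
  asymptotics : ∃ G : ℕ → ℝ → ℝ,
    (∀ l ∈ activeMultipoles Γ, ∀ τ : ℝ, multipoleCov Γ l τ = G l τ * memoryFun α (β l) τ) ∧
    (∀ ε > 0, ∃ M : ℝ, ∀ τ ≥ M, ∀ l ∈ activeMultipoles Γ,
      |G l τ / multipoleCov Γ l 0 - 1| ≤ ε)
  zero_mem : 0 ∈ activeMultipoles Γ
  integral_pos : β 0 = 1 → 0 < ∫ τ : ℝ, multipoleCov Γ 0 τ

/-- The excursion area at level `u` and time `t`: the area of `{x | Z(x, t) ≥ u}`. -/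
noncomputable def excursionArea {Ω : Type*} (Z : S2 → ℝ → Ω → ℝ) (u t : ℝ) (ω : Ω) : ℝ :=
  sphereArea.real {x : S2 | u ≤ Z x t ω}

/-- The centered excursion area at level `u`, integrated over the time interval `[0, T]`. -/
noncomputable def areaFunctional {Ω : Type*} [MeasurableSpace Ω] (P : Measure Ω)
    (Z : S2 → ℝ → Ω → ℝ) (u T : ℝ) (ω : Ω) : ℝ :=
  ∫ t in Set.Icc 0 T, (excursionArea Z u t ω - ∫ ω', excursionArea Z u t ω' ∂P)

/-- The area functional, divided by its standard deviation. -/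
noncomputable def normalizedAreaFunctional {Ω : Type*} [MeasurableSpace Ω] (P : Measure Ω)
    (Z : S2 → ℝ → Ω → ℝ) (u T : ℝ) (ω : Ω) : ℝ :=
  areaFunctional P Z u T ω / √(variance (areaFunctional P Z u T) P)

/-! Subtract from the indicator of the exceedance `Z ≥ u` its mean and its linear Hermite component
`φ(u) Z`. What is left, `exceedanceResidual`, is uncorrelated with every value of the field.
Integrating over the sphere and `[0, T]` gives `M_T = φ(u) L_T + R_T` almost surely, where `L_T` is
the integral of `Z` itself and `E[R_T L_T] = 0` (`areaFunctional_ae_eq`,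
`integral_residualPart_mul_linearPart`). It remains to understand `L_T` and to show that `R_T` is
negligible in `L²`.

The linear part is exactly Gaussian for every `T`, as it lies in the closed linear span of the field
(`map_linearPart`). Integration over the sphere annihilates all multipoles but `l = 0`, so its
variance is `4π ∬ C_0(t - s)`. Since `C_0(τ) ~ C_0(0) τ^(-β_0)` with `β_0 < 1`, two applications of
Karamata's theorem give the order `T^(2 - β_0)` and the constant
(`tendsto_double_integral_div_rpow`).

For the residual, Plackett's formula (`hasDerivAt_jointTail`) identifies the derivative of the joint
exceedance probability in the correlation `ρ`; comparing it with `φ(u)²` bounds the covariance of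
two residuals by `16 |ρ|³ + 2 u² ρ²` (`abs_integral_exceedanceResidual_mul_le`). The quadratic term
disappears at `u = 0`, which is why the threshold there is `3β` rather than `2β`.

To use this bound one needs `|Γ(θ, τ)| ≤ K (1 + |τ|)^(-b)` uniformly in `θ`, with `b` a lower bound
for all exponents, whereas the hypotheses speak of single multipoles (`exists_abs_cov_le`). Each
`C_l` is the autocovariance of a projection of the field, up to averaging over a pole, so `|C_l(τ)|
≤ C_l(0)` (`abs_multipoleCov_le`). Hence `Γ(·, 0)` has nonnegative Legendre coefficients, and
testing against the kernels `(1 + x)^n`, which concentrate at `1`, shows that its Legendre series at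
`1` converges and is at most `Γ(1, 0) = 1`. As `|P_l| ≤ 1`, the bounds on the coefficients of `Γ(·,
τ)` then sum to a bound on `Γ(·, τ)` (`abs_le_of_legendre_coeff_le`). The facts on Legendre
polynomials come from Rodrigues' formula and from the product formula, itself a consequence of the
symmetry of circle averages on the sphere.

Orthogonality makes the variances add, and `E[R_T²] / E[L_T²] → 0` transfers the Gaussian law of
`L_T` to the normalized functional by a Slutsky argument
(`tendstoInDistribution_of_orthogonal_remainder`). -/

/-! ### Surface area of the sphere in height and longitude coordinates. -/

/-- Integration over Euclidean 3-space in the coordinates of an orthonormal frame. -/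
theorem lintegral_orthonormal_frame
    (b : OrthonormalBasis (Fin 3) ℝ (EuclideanSpace ℝ (Fin 3)))
    (G : EuclideanSpace ℝ (Fin 3) → ENNReal) (hG : Measurable G) :
    ∫⁻ x, G x = ∫⁻ a : ℝ, ∫⁻ p : ℝ × ℝ, G (a • b 0 + p.1 • b 1 + p.2 • b 2) := by
  have e1 := (b.measurePreserving_repr.symm b.repr.toHomeomorph.toMeasurableEquiv)
  have e2 := (EuclideanSpace.volume_preserving_symm_measurableEquiv_toLp (Fin 3)).symm
    (MeasurableEquiv.toLp 2 (Fin 3 → ℝ)).symm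
  have e3 := (volume_preserving_piFinSuccAbove (fun _ : Fin 3 => ℝ) 0).symm
    (MeasurableEquiv.piFinSuccAbove (fun _ : Fin 3 => ℝ) 0)
  have e4 := (volume_preserving_finTwoArrow ℝ).symm MeasurableEquiv.finTwoArrow
  have e5 := (MeasurePreserving.id (volume : Measure ℝ)).prod e4
  have e := ((e1.comp e2).comp e3).comp e5
  rw [← e.lintegral_comp hG, lintegral_prod]
  · refine lintegral_congr fun a => lintegral_congr fun p => ?_
    congr 1
    simp only [Function.comp]
    change b.repr.symm _ = _
    rw [← b.sum_repr_symm]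
    simp [Fin.sum_univ_three]
  · exact (hG.comp e.measurable).aemeasurable

theorem lintegral_polar (F : ℝ × ℝ → ENNReal) (hF : Measurable F) :
    ∫⁻ p, F p = ∫⁻ r in Set.Ioi (0 : ℝ), ∫⁻ φ in Set.Ioo (-Real.pi) Real.pi,
      ENNReal.ofReal r * F (r * Real.cos φ, r * Real.sin φ) := by
  rw [← lintegral_comp_polarCoord_symm]
  simp only [polarCoord_target, polarCoord_symm_apply, smul_eq_mul]
  rw [Measure.volume_eq_prod, ← Measure.prod_restrict, lintegral_prod]
  fun_prop

/-- Planar polar coordinates are used twice: in the plane orthogonal to the axis, with radius `ρ`,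
and then in the `(a, ρ)`-plane. The half-plane `ρ > 0` enters as an indicator, which cuts the second
angle down to `(0, π)`; the two Jacobians `ρ = r sin ψ` and `r` multiply. -/
theorem lintegral_spherical (F : ℝ → ℝ × ℝ → ENNReal) (hF : Measurable (Function.uncurry F)) :
    ∫⁻ a : ℝ, ∫⁻ p : ℝ × ℝ, F a p =
      ∫⁻ φ in Set.Ioo (-Real.pi) Real.pi, ∫⁻ r in Set.Ioi (0 : ℝ), ∫⁻ ψ in Set.Ioo 0 Real.pi,
        ENNReal.ofReal (r ^ 2 * Real.sin ψ) *
          F (r * Real.cos ψ)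
            (r * Real.sin ψ * Real.cos φ, r * Real.sin ψ * Real.sin φ) := by
  have h1 : ∀ a : ℝ, ∫⁻ p : ℝ × ℝ, F a p = ∫⁻ φ in Set.Ioo (-Real.pi) Real.pi,
      ∫⁻ ρ in Set.Ioi (0 : ℝ), ENNReal.ofReal ρ * F a (ρ * Real.cos φ, ρ * Real.sin φ) := by
    intro a
    rw [lintegral_polar (F a) (by fun_prop), lintegral_lintegral_swap]
    exact Measurable.aemeasurable (by fun_prop)
  simp_rw [h1]
  rw [lintegral_lintegral_swap]
  swap
  · refine (Measurable.lintegral_prod_right' (ν := volume.restrict (Set.Ioi (0 : ℝ)))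
      (f := fun q : (ℝ × ℝ) × ℝ => ENNReal.ofReal q.2 *
        Function.uncurry F (q.1.1, (q.2 * Real.cos q.1.2, q.2 * Real.sin q.1.2))) ?_).aemeasurable
    fun_prop
  refine lintegral_congr fun φ => ?_
  have h2 : ∀ a : ℝ, ∫⁻ ρ in Set.Ioi (0 : ℝ),
      ENNReal.ofReal ρ * F a (ρ * Real.cos φ, ρ * Real.sin φ) =
      ∫⁻ ρ : ℝ, (Set.Ioi (0 : ℝ)).indicator (fun _ => 1) ρ *
        (ENNReal.ofReal ρ * Function.uncurry F (a, (ρ * Real.cos φ, ρ * Real.sin φ))) := by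
    intro a
    rw [← lintegral_indicator measurableSet_Ioi]
    refine lintegral_congr fun ρ => ?_
    by_cases h : ρ ∈ Set.Ioi (0 : ℝ) <;> simp [h, Function.uncurry]
  simp_rw [h2]
  have hind : Measurable ((Set.Ioi (0 : ℝ)).indicator (fun _ => (1 : ENNReal))) :=
    measurable_const.indicator measurableSet_Ioi
  have hm : Measurable fun p : ℝ × ℝ => (Set.Ioi (0 : ℝ)).indicator (fun _ => (1 : ENNReal)) p.2 *
        (ENNReal.ofReal p.2 *
          Function.uncurry F (p.1, (p.2 * Real.cos φ, p.2 * Real.sin φ))) := by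
    refine (hind.comp measurable_snd).mul ?_
    fun_prop
  rw [← lintegral_prod _ hm.aemeasurable, ← Measure.volume_eq_prod, lintegral_polar _ hm]
  refine setLIntegral_congr_fun measurableSet_Ioi fun r hr => ?_
  have hr' : 0 < r := hr
  have hs : Set.Ioo 0 Real.pi ⊆ Set.Ioo (-Real.pi) Real.pi := fun x hx =>
    ⟨by linarith [hx.1, Real.pi_pos], hx.2⟩
  rw [← lintegral_indicator measurableSet_Ioo, ← lintegral_indicator measurableSet_Ioo]
  refine lintegral_congr fun ψ => ?_
  by_cases h : ψ ∈ Set.Ioo 0 Real.pi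
  · have hsin : 0 < Real.sin ψ := Real.sin_pos_of_mem_Ioo h
    have : r * Real.sin ψ ∈ Set.Ioi (0 : ℝ) := mul_pos hr' hsin
    rw [Set.indicator_of_mem (hs h), Set.indicator_of_mem h, Set.indicator_of_mem this, one_mul,
      ← mul_assoc, ← ENNReal.ofReal_mul hr'.le]
    simp only [Function.uncurry]
    congr 2
    ring
  · rw [Set.indicator_of_notMem h]
    by_cases h' : ψ ∈ Set.Ioo (-Real.pi) Real.pi
    · rw [Set.indicator_of_mem h', Set.indicator_of_notMem]
      · simp
      · have : Real.sin ψ ≤ 0 := Real.sin_nonpos_of_nonpos_of_neg_pi_le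
          (by by_contra hh; exact h ⟨not_le.mp hh, h'.2⟩) h'.1.le
        simpa using mul_nonpos_of_nonneg_of_nonpos hr'.le this
    · rw [Set.indicator_of_notMem h']

theorem lintegral_cos_substitution (h : ℝ → ENNReal) :
    ∫⁻ ψ in Set.Ioo 0 Real.pi, ENNReal.ofReal (Real.sin ψ) * h (Real.cos ψ) =
      ∫⁻ s in Set.Ioo (-1 : ℝ) 1, h s := by
  have himg : Real.cos '' Set.Ioo 0 Real.pi = Set.Ioo (-1) 1 := by
    apply Set.Subset.antisymm
    · rintro _ ⟨x, hx, rfl⟩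
      constructor
      · rw [← Real.cos_pi]
        exact Real.strictAntiOn_cos ⟨hx.1.le, hx.2.le⟩ ⟨Real.pi_pos.le, le_rfl⟩ hx.2
      · rw [← Real.cos_zero]
        exact Real.strictAntiOn_cos ⟨le_rfl, Real.pi_pos.le⟩ ⟨hx.1.le, hx.2.le⟩ hx.1
    · intro y hy
      refine ⟨Real.arccos y, ⟨?_, ?_⟩, Real.cos_arccos hy.1.le hy.2.le⟩
      · exact Real.arccos_pos.mpr hy.2
      · exact Real.arccos_lt_pi.mpr hy.1
  rw [← himg, lintegral_image_eq_lintegral_abs_deriv_mul measurableSet_Ioo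
    (fun x _ => (Real.hasDerivAt_cos x).hasDerivWithinAt)
    (Real.injOn_cos.mono Set.Ioo_subset_Icc_self)]
  refine setLIntegral_congr_fun measurableSet_Ioo fun x hx => ?_
  simp only [abs_neg, abs_of_pos (Real.sin_pos_of_mem_Ioo hx)]

/-- The point with height `s` and longitude `φ` in the given orthonormal frame. -/
noncomputable def spherePoint (b : OrthonormalBasis (Fin 3) ℝ (EuclideanSpace ℝ (Fin 3)))
    (s φ : ℝ) : EuclideanSpace ℝ (Fin 3) :=
  s • b 0 + (√(1 - s ^ 2) * Real.cos φ) • b 1 + (√(1 - s ^ 2) * Real.sin φ) • b 2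

theorem continuous_spherePoint (b : OrthonormalBasis (Fin 3) ℝ (EuclideanSpace ℝ (Fin 3))) :
    Continuous fun p : ℝ × ℝ => spherePoint b p.1 p.2 := by
  unfold spherePoint
  fun_prop

theorem measurable_sin_mul_comp_spherePoint
    (b : OrthonormalBasis (Fin 3) ℝ (EuclideanSpace ℝ (Fin 3)))
    (f : EuclideanSpace ℝ (Fin 3) → ENNReal) (hf : Measurable f) (φ : ℝ) :
    Measurable fun ψ : ℝ =>
      ENNReal.ofReal (Real.sin ψ) * f (spherePoint b (Real.cos ψ) φ) := by
  have h1 : Measurable fun ψ : ℝ => spherePoint b (Real.cos ψ) φ :=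
    ((continuous_spherePoint b).comp (g := fun p : ℝ × ℝ => spherePoint b p.1 p.2)
      (Real.continuous_cos.prodMk continuous_const)).measurable
  have h2 : Measurable fun ψ : ℝ => ENNReal.ofReal (Real.sin ψ) := by fun_prop
  exact h2.mul (hf.comp h1)

theorem inner_spherePoint (b : OrthonormalBasis (Fin 3) ℝ (EuclideanSpace ℝ (Fin 3)))
    (s φ x y : ℝ) : inner ℝ (spherePoint b s φ) (x • b 0 + y • b 1) =
      s * x + √(1 - s ^ 2) * y * Real.cos φ := by
  simp only [spherePoint, inner_add_left, inner_add_right, inner_smul_left, inner_smul_right,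
    b.inner_eq_ite]
  simp
  ring

theorem norm_spherePoint (b : OrthonormalBasis (Fin 3) ℝ (EuclideanSpace ℝ (Fin 3)))
    {s : ℝ} (φ : ℝ) (hs : s ∈ Set.Icc (-1 : ℝ) 1) : ‖spherePoint b s φ‖ = 1 := by
  have h : inner ℝ (spherePoint b s φ) (spherePoint b s φ) = (1 : ℝ) := by
    simp only [spherePoint, inner_add_left, inner_add_right, inner_smul_left, inner_smul_right,
      b.inner_eq_ite]
    have h1 : √(1 - s ^ 2) ^ 2 = 1 - s ^ 2 := Real.sq_sqrt (by nlinarith [hs.1, hs.2])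
    have h2 := Real.sin_sq_add_cos_sq φ
    simp
    linear_combination h1 * (Real.sin φ ^ 2 + Real.cos φ ^ 2) + (1 - s ^ 2) * h2
  rw [real_inner_self_eq_norm_sq] at h
  nlinarith [norm_nonneg (spherePoint b s φ)]

/-- Under the homeomorphism of the punctured space with `S2 × (0, ∞)`, Lebesgue measure becomes the
product of `sphereArea` and `r² dr`, so a degree-zero homogeneous factor and a radial one separate.
-/
theorem lintegral_toSphere_mul_radial (f : EuclideanSpace ℝ (Fin 3) → ENNReal)
    (hf : Measurable f) (w : ℝ → ENNReal) (hw : Measurable w) :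
    ∫⁻ x : EuclideanSpace ℝ (Fin 3), f (‖x‖⁻¹ • x) * w ‖x‖ =
      (∫⁻ z : S2, f z ∂sphereArea) * ∫⁻ r in Set.Ioi (0 : ℝ), ENNReal.ofReal (r ^ 2) * w r := by
  have hmp := (volume : Measure (EuclideanSpace ℝ (Fin 3))).measurePreserving_homeomorphUnitSphereProd
  rw [← restrict_compl_singleton (μ := (volume : Measure (EuclideanSpace ℝ (Fin 3)))) 0,
    ← lintegral_subtype_comap (measurableSet_singleton _).compl]
  have h1 := hmp.lintegral_comp (f := fun p => f p.1 * w p.2) (by fun_prop)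
  simp only [homeomorphUnitSphereProd_apply_fst_coe, homeomorphUnitSphereProd_apply_snd_coe] at h1
  have h2 := lintegral_prod_mul (μ := (volume : Measure (EuclideanSpace ℝ (Fin 3))).toSphere)
    (ν := Measure.volumeIoiPow (Module.finrank ℝ (EuclideanSpace ℝ (Fin 3)) - 1))
    (f := fun z : S2 => f z) (g := fun r : Set.Ioi (0 : ℝ) => w r) (by fun_prop) (by fun_prop)
  rw [h1, h2]
  congr 1
  rw [Measure.volumeIoiPow, lintegral_withDensity_eq_lintegral_mul _ (by fun_prop) (by fun_prop)]
  simp only [Pi.mul_apply, finrank_euclideanSpace, Fintype.card_fin, Nat.add_one_sub_one]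
  rw [lintegral_subtype_comap measurableSet_Ioi
    (fun r => ENNReal.ofReal (r ^ 2) * w r)]

/-- The integral of `f(x / ‖x‖)` over the unit ball is computed in two ways, through the product
structure and through spherical coordinates; the common radial factor cancels. The substitution `s =
cos ψ` absorbs `sin ψ`, leaving the flat measure `ds dφ`. -/
theorem lintegral_sphereArea (b : OrthonormalBasis (Fin 3) ℝ (EuclideanSpace ℝ (Fin 3)))
    (f : EuclideanSpace ℝ (Fin 3) → ENNReal) (hf : Measurable f) :
    ∫⁻ z : S2, f z ∂sphereArea =
      ∫⁻ φ in Set.Ioo (-Real.pi) Real.pi, ∫⁻ s in Set.Ioo (-1 : ℝ) 1, f (spherePoint b s φ) := by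
  -- Any weight would do whose radial integral `K` is neither `0` nor `⊤`; the cutoff at radius `1`
  -- gives `1 / 3`.
  set w : ℝ → ENNReal := (Set.Iio (1 : ℝ)).indicator (fun _ => 1) with hw_def
  have hw : Measurable w := measurable_const.indicator measurableSet_Iio
  set K : ENNReal := ∫⁻ r in Set.Ioi (0 : ℝ), ENNReal.ofReal (r ^ 2) * w r with hK
  have hK' : K = ENNReal.ofReal (1 / 3) := by
    have : K = ∫⁻ r in Set.Ioo (0 : ℝ) 1, ENNReal.ofReal (r ^ 2) := by
      rw [hK, ← lintegral_indicator measurableSet_Ioi, ← lintegral_indicator measurableSet_Ioo]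
      refine lintegral_congr fun r => ?_
      by_cases h0 : 0 < r <;> by_cases h1 : r < 1 <;> simp [hw_def, Set.indicator, h0, h1]
    rw [this, ← ofReal_integral_eq_lintegral_ofReal, ← integral_Ioc_eq_integral_Ioo,
      ← intervalIntegral.integral_of_le zero_le_one]
    · norm_num
    · exact ((continuous_pow 2).integrableOn_Icc (a := (0 : ℝ)) (b := 1)).mono_set
        Set.Ioo_subset_Icc_self
    · exact Eventually.of_forall fun r => sq_nonneg r
  have hK0 : K ≠ 0 := by rw [hK']; norm_num
  have hKt : K ≠ ⊤ := by rw [hK']; exact ENNReal.ofReal_ne_top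
  have key := lintegral_toSphere_mul_radial f hf w hw
  rw [lintegral_orthonormal_frame b _ (by fun_prop), lintegral_spherical
    (fun a p => f (‖a • b 0 + p.1 • b 1 + p.2 • b 2‖⁻¹ • (a • b 0 + p.1 • b 1 + p.2 • b 2)) *
      w ‖a • b 0 + p.1 • b 1 + p.2 • b 2‖) (by unfold Function.uncurry; fun_prop), ← hK] at key
  refine (ENNReal.mul_left_inj hK0 hKt).mp (key.symm.trans ?_)
  rw [← lintegral_mul_const']
  swap
  · exact hKt
  refine lintegral_congr fun φ => ?_
  rw [← lintegral_cos_substitution (fun s => f (spherePoint b s φ)), mul_comm, hK,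
    ← lintegral_mul_const _ (by fun_prop)]
  refine setLIntegral_congr_fun measurableSet_Ioi fun r hr => ?_
  have hr' : 0 < r := hr
  simp only
  rw [← lintegral_const_mul _ (measurable_sin_mul_comp_spherePoint b f hf φ)]
  refine setLIntegral_congr_fun measurableSet_Ioo fun ψ hψ => ?_
  have hsin : 0 < Real.sin ψ := Real.sin_pos_of_mem_Ioo hψ
  have hpt : (r * Real.cos ψ) • b 0 + (r * Real.sin ψ * Real.cos φ) • b 1 +
      (r * Real.sin ψ * Real.sin φ) • b 2 = r • spherePoint b (Real.cos ψ) φ := by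
    have : √(1 - Real.cos ψ ^ 2) = Real.sin ψ := by
      rw [← Real.sin_sq, Real.sqrt_sq hsin.le]
    simp only [spherePoint, this, smul_add, smul_smul, mul_assoc]
  have hnorm : ‖spherePoint b (Real.cos ψ) φ‖ = 1 :=
    norm_spherePoint b φ ⟨Real.neg_one_le_cos ψ, Real.cos_le_one ψ⟩
  simp only [hpt, norm_smul, hnorm, Real.norm_eq_abs, abs_of_pos hr', mul_one, smul_smul,
    inv_mul_cancel₀ hr'.ne', one_smul]
  rw [ENNReal.ofReal_mul (by positivity)]
  ring

theorem map_sphereArea (b : OrthonormalBasis (Fin 3) ℝ (EuclideanSpace ℝ (Fin 3))) :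
    sphereArea.map (fun z : S2 => (z : EuclideanSpace ℝ (Fin 3))) =
      ((volume.restrict (Set.Ioo (-1 : ℝ) 1)).prod
        (volume.restrict (Set.Ioo (-Real.pi) Real.pi))).map
        (fun p : ℝ × ℝ => spherePoint b p.1 p.2) := by
  have hc := (continuous_spherePoint b).measurable
  ext A hA
  rw [← lintegral_indicator_one hA, ← lintegral_indicator_one hA,
    lintegral_map (measurable_one.indicator hA) measurable_subtype_coe,
    lintegral_map (measurable_one.indicator hA) hc,
    lintegral_sphereArea b _ (measurable_one.indicator hA), lintegral_prod_symm]
  exact ((measurable_one.indicator hA).comp hc).aemeasurable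

theorem integral_sphereArea (b : OrthonormalBasis (Fin 3) ℝ (EuclideanSpace ℝ (Fin 3)))
    (f : EuclideanSpace ℝ (Fin 3) → ℝ) (hf : Continuous f) :
    ∫ z : S2, f z ∂sphereArea =
      ∫ s in (-1 : ℝ)..1, ∫ φ in -Real.pi..Real.pi, f (spherePoint b s φ) := by
  have hc := continuous_spherePoint b
  have h := integral_map (μ := sphereArea) (φ := fun z : S2 => (z : EuclideanSpace ℝ (Fin 3)))
    measurable_subtype_coe.aemeasurable (f := f) hf.aestronglyMeasurable
  rw [← h, map_sphereArea b, integral_map hc.measurable.aemeasurable hf.aestronglyMeasurable,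
    integral_prod]
  · rw [intervalIntegral.integral_of_le (by norm_num), integral_Ioc_eq_integral_Ioo]
    refine integral_congr_ae (Eventually.of_forall fun s => ?_)
    simp only
    rw [intervalIntegral.integral_of_le (by linarith [Real.pi_pos]), integral_Ioc_eq_integral_Ioo]
  · rw [Measure.prod_restrict]
    refine ((hf.comp hc).continuousOn.integrableOn_compact
      (isCompact_Icc.prod isCompact_Icc)).mono_set
      (Set.prod_mono Set.Ioo_subset_Icc_self Set.Ioo_subset_Icc_self)

/-- Gram–Schmidt applied to `e` and `y`. If `y = ±e` the coefficient of the second vector vanishes,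
so any completion of `e` to a frame is suitable. -/
theorem exists_frame_adapted (e y : S2) :
    ∃ b : OrthonormalBasis (Fin 3) ℝ (EuclideanSpace ℝ (Fin 3)),
      b 0 = e ∧ (y : EuclideanSpace ℝ (Fin 3)) =
        (inner ℝ (e : EuclideanSpace ℝ (Fin 3)) y : ℝ) • b 0 +
          √(1 - (inner ℝ (e : EuclideanSpace ℝ (Fin 3)) y : ℝ) ^ 2) • b 1 := by
  set t : ℝ := inner ℝ (e : EuclideanSpace ℝ (Fin 3)) y with ht
  have he : ‖(e : EuclideanSpace ℝ (Fin 3))‖ = 1 := by simp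
  have hy : ‖(y : EuclideanSpace ℝ (Fin 3))‖ = 1 := by simp
  set w : EuclideanSpace ℝ (Fin 3) := y - t • (e : EuclideanSpace ℝ (Fin 3)) with hw
  have hew : inner ℝ (e : EuclideanSpace ℝ (Fin 3)) w = (0 : ℝ) := by
    rw [hw, inner_sub_right, inner_smul_right, real_inner_self_eq_norm_sq, he, ← ht]
    ring
  have hnw : ‖w‖ ^ 2 = 1 - t ^ 2 := by
    rw [hw, norm_sub_sq_real, norm_smul, inner_smul_right, real_inner_comm, ← ht, he, hy]
    simp
    ring
  have hsqrt : √(1 - t ^ 2) = ‖w‖ := by rw [← hnw, Real.sqrt_sq (norm_nonneg _)]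
  by_cases hw0 : w = 0
  · obtain ⟨b, hb⟩ := Orthonormal.exists_orthonormalBasis_extension_of_card_eq
      (𝕜 := ℝ) (E := EuclideanSpace ℝ (Fin 3)) (ι := Fin 3) (by simp)
      (v := fun _ => (e : EuclideanSpace ℝ (Fin 3))) (s := {0})
      (by
        constructor
        · intro i; simp
        · intro i j hij; exact absurd (Subsingleton.elim i j) hij)
    have hb0 := hb 0 rfl
    refine ⟨b, hb0, ?_⟩
    rw [hsqrt, hw0, hb0, norm_zero, zero_smul, add_zero]
    exact sub_eq_zero.mp hw0
  · obtain ⟨b, hb⟩ := Orthonormal.exists_orthonormalBasis_extension_of_card_eq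
      (𝕜 := ℝ) (E := EuclideanSpace ℝ (Fin 3)) (ι := Fin 3) (by simp)
      (v := ![(e : EuclideanSpace ℝ (Fin 3)), ‖w‖⁻¹ • w, 0]) (s := {0, 1})
      (by
        have hwn : ‖w‖ ≠ 0 := norm_ne_zero_iff.mpr hw0
        constructor
        · rintro ⟨i, hi⟩
          rcases hi with rfl | hi
          · simp
          · rw [Set.mem_singleton_iff] at hi
            subst hi
            simp [norm_smul, hwn]
        · rintro ⟨i, hi⟩ ⟨j, hj⟩ hij
          rcases hi with rfl | hi <;> rcases hj with rfl | hj
          · exact absurd rfl hij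
          · rw [Set.mem_singleton_iff] at hj
            subst hj
            simp [inner_smul_right, hew]
          · rw [Set.mem_singleton_iff] at hi
            subst hi
            simp [inner_smul_left, real_inner_comm, hew]
          · rw [Set.mem_singleton_iff] at hi hj
            subst hi; subst hj
            exact absurd rfl hij)
    have hb0 : b 0 = e := hb 0 (by simp)
    have hb1 : b 1 = ‖w‖⁻¹ • w := hb 1 (by simp)
    refine ⟨b, hb0, ?_⟩
    rw [hsqrt, hb1, hb0, smul_smul, mul_inv_cancel₀ (norm_ne_zero_iff.mpr hw0), one_smul, hw]
    simp

/-- The integral of a function of two heights, in the spherical coordinates of the first pole. -/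
theorem integral_sphereArea_two_inner (e y : S2) (F : ℝ → ℝ → ℝ)
    (hF : Continuous (Function.uncurry F)) :
    ∫ z : S2, F (inner ℝ (z : EuclideanSpace ℝ (Fin 3)) e)
        (inner ℝ (z : EuclideanSpace ℝ (Fin 3)) y) ∂sphereArea =
      ∫ s in (-1 : ℝ)..1, ∫ φ in -Real.pi..Real.pi,
        F s (s * inner ℝ (e : EuclideanSpace ℝ (Fin 3)) y +
          √(1 - s ^ 2) * √(1 - (inner ℝ (e : EuclideanSpace ℝ (Fin 3)) y : ℝ) ^ 2) *
            Real.cos φ) := by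
  obtain ⟨b, hb0, hy⟩ := exists_frame_adapted e y
  rw [integral_sphereArea b (fun z => F (inner ℝ z (e : EuclideanSpace ℝ (Fin 3)))
    (inner ℝ z (y : EuclideanSpace ℝ (Fin 3))))]
  · refine intervalIntegral.integral_congr fun s _ => ?_
    refine intervalIntegral.integral_congr fun φ _ => ?_
    have h1 : inner ℝ (spherePoint b s φ) (e : EuclideanSpace ℝ (Fin 3)) = s := by
      have := inner_spherePoint b s φ 1 0
      simpa [hb0] using this
    have h2 := inner_spherePoint b s φ
      (inner ℝ (e : EuclideanSpace ℝ (Fin 3)) (y : EuclideanSpace ℝ (Fin 3)))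
      √(1 - (inner ℝ (e : EuclideanSpace ℝ (Fin 3)) (y : EuclideanSpace ℝ (Fin 3)) : ℝ) ^ 2)
    rw [← hy] at h2
    change F _ _ = F _ _
    rw [h1, h2]
  · exact hF.comp ((continuous_id.inner continuous_const).prodMk
      (continuous_id.inner continuous_const))

/-- Archimedes' theorem: the height over a pole is uniformly distributed. -/
theorem integral_sphereArea_inner (e : S2) (f : ℝ → ℝ) (hf : Continuous f) :
    ∫ z : S2, f (inner ℝ (z : EuclideanSpace ℝ (Fin 3)) e) ∂sphereArea =
      2 * Real.pi * ∫ s in (-1 : ℝ)..1, f s := by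
  rw [integral_sphereArea_two_inner e e (fun s _ => f s) (by unfold Function.uncurry; fun_prop)]
  simp only [intervalIntegral.integral_const, smul_eq_mul, intervalIntegral.integral_const_mul]
  ring

instance : IsFiniteMeasure sphereArea := by
  unfold sphereArea
  infer_instance

theorem sphereArea_real_univ : sphereArea.real Set.univ = 4 * Real.pi := by
  have h := integral_sphereArea_inner
    ⟨EuclideanSpace.single 0 1, by simp⟩ (fun _ => 1) continuous_const
  simp only [integral_const, smul_eq_mul, mul_one, intervalIntegral.integral_const] at h
  rw [h]
  ring

/-! ### Legendre polynomials: Rodrigues' formula, orthogonality and expansion of polynomials. -/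

section Legendre

open Polynomial

theorem integral_mul_derivative_polynomial (q p : ℝ[X]) (h1 : p.eval 1 = 0)
    (h2 : p.eval (-1) = 0) :
    ∫ x in (-1 : ℝ)..1, q.eval x * (derivative p).eval x =
      -∫ x in (-1 : ℝ)..1, (derivative q).eval x * p.eval x := by
  rw [intervalIntegral.integral_mul_deriv_eq_deriv_mul (u := fun x => q.eval x)
    (v := fun x => p.eval x) (u' := fun x => (derivative q).eval x)
    (fun x _ => q.hasDerivAt x) (fun x _ => p.hasDerivAt x)
    (Continuous.intervalIntegrable (by fun_prop) _ _)
    (Continuous.intervalIntegrable (by fun_prop) _ _)]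
  simp [h1, h2]

/-- Both `1` and `-1` are zeros of order `l`. This removes the boundary terms in the repeated
integration by parts. -/
theorem eval_iterate_derivative_rodrigues {l k : ℕ} (hk : k < l) {x : ℝ} (hx : x ^ 2 = 1) :
    ((derivative^[k]) ((X ^ 2 - 1 : ℝ[X]) ^ l)).eval x = 0 := by
  obtain ⟨r, hr⟩ := Polynomial.pow_sub_dvd_iterate_derivative_of_pow_dvd k
    (dvd_refl ((X ^ 2 - 1 : ℝ[X]) ^ l))
  rw [hr]
  have : l - k ≠ 0 := by omega
  simp [hx, this]

theorem integral_mul_iterate_derivative_rodrigues (l k : ℕ) (hk : k ≤ l) (q : ℝ[X]) :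
    ∫ x in (-1 : ℝ)..1, q.eval x * ((derivative^[k]) ((X ^ 2 - 1 : ℝ[X]) ^ l)).eval x =
      (-1) ^ k * ∫ x in (-1 : ℝ)..1, ((derivative^[k]) q).eval x * (x ^ 2 - 1) ^ l := by
  induction k generalizing q with
  | zero => simp
  | succ k ih =>
    rw [Function.iterate_succ_apply', integral_mul_derivative_polynomial _ _
      (eval_iterate_derivative_rodrigues (by omega) (by norm_num))
      (eval_iterate_derivative_rodrigues (by omega) (by norm_num)), ih (by omega),
      ← Function.iterate_succ_apply]
    ring

/-- All `l` derivatives are moved onto `q` by parts, and the signs turn the weight into the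
nonnegative `(1 - x²)^l`. Orthogonality to lower degrees and positivity of the coefficients of `(1 +
x)^n` both follow from this. -/
theorem integral_mul_legendrePoly (l : ℕ) (q : ℝ[X]) :
    ∫ x in (-1 : ℝ)..1, q.eval x * (legendrePoly l).eval x =
      (2 ^ l * (l.factorial : ℝ))⁻¹ *
        ∫ x in (-1 : ℝ)..1, ((derivative^[l]) q).eval x * (1 - x ^ 2) ^ l := by
  have h := integral_mul_iterate_derivative_rodrigues l l le_rfl q
  have h2 : ∫ x in (-1 : ℝ)..1, ((derivative^[l]) q).eval x * (1 - x ^ 2) ^ l =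
      (-1) ^ l * ∫ x in (-1 : ℝ)..1, ((derivative^[l]) q).eval x * (x ^ 2 - 1) ^ l := by
    rw [← intervalIntegral.integral_const_mul]
    refine intervalIntegral.integral_congr fun x _ => ?_
    rw [show (1 - x ^ 2) = (-1) * (x ^ 2 - 1) by ring, mul_pow]
    ring
  rw [h2, ← h, ← intervalIntegral.integral_const_mul]
  refine intervalIntegral.integral_congr fun x _ => ?_
  simp only [legendrePoly, eval_mul, eval_C]
  ring

theorem integral_mul_legendrePoly_of_natDegree_lt {l : ℕ} {q : ℝ[X]} (hq : q.natDegree < l) :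
    ∫ x in (-1 : ℝ)..1, q.eval x * (legendrePoly l).eval x = 0 := by
  rw [integral_mul_legendrePoly, iterate_derivative_eq_zero hq]
  simp

/-- Shifted to the point `1`, the polynomial `(x² - 1)^l` becomes `x^l (x + 2)^l`, whose coefficient
of order `l` is `2^l`. -/
theorem legendrePoly_eval_one (l : ℕ) : (legendrePoly l).eval 1 = 1 := by
  have h1 : (derivative^[l]) ((X ^ 2 - 1 : ℝ[X]) ^ l) =
      (l.factorial : ℝ[X]) * hasseDeriv l ((X ^ 2 - 1 : ℝ[X]) ^ l) := by
    rw [← factorial_smul_hasseDeriv]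
    simp
  have h2 : taylor 1 ((X ^ 2 - 1 : ℝ[X]) ^ l) = X ^ l * (X + C 2) ^ l := by
    rw [← mul_pow]
    simp only [taylor_apply, pow_comp, sub_comp, X_comp, one_comp]
    congr 1
    have : (C 2 : ℝ[X]) = C 1 + C 1 := by rw [← C_add]; norm_num
    rw [this]
    simp only [map_one]
    ring
  have h3 : (hasseDeriv l ((X ^ 2 - 1 : ℝ[X]) ^ l)).eval 1 = 2 ^ l := by
    rw [← taylor_coeff, h2, coeff_X_pow_mul', if_pos le_rfl, Nat.sub_self,
      coeff_zero_eq_eval_zero]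
    simp
  rw [legendrePoly, h1, eval_mul, eval_mul, h3]
  have : (l.factorial : ℝ) ≠ 0 := by exact_mod_cast l.factorial_ne_zero
  simp
  field_simp

theorem natDegree_legendrePoly_le (l : ℕ) : (legendrePoly l).natDegree ≤ l := by
  refine (natDegree_C_mul_le _ _).trans ((natDegree_iterate_derivative _ _).trans ?_)
  have : ((X ^ 2 - 1 : ℝ[X]) ^ l).natDegree ≤ l * 2 := by
    refine natDegree_pow_le_of_le l ?_
    compute_degree
  omega

theorem legendrePoly_coeff_ne_zero (l : ℕ) : (legendrePoly l).coeff l ≠ 0 := by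
  have hm : ((X ^ 2 - 1 : ℝ[X]) ^ l).coeff (l + l) = 1 := by
    have h1 : (X ^ 2 - 1 : ℝ[X]).Monic := monic_X_pow_sub_C (1 : ℝ) (n := 2) (by norm_num)
    have h2 : (X ^ 2 - 1 : ℝ[X]).natDegree = 2 := natDegree_X_pow_sub_C (r := (1 : ℝ)) (n := 2)
    have h3 := (h1.pow l).coeff_natDegree
    rwa [h1.natDegree_pow, h2, mul_two] at h3
  rw [legendrePoly, coeff_C_mul, coeff_iterate_derivative, hm]
  have h1 : (l.factorial : ℝ) ≠ 0 := by exact_mod_cast l.factorial_ne_zero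
  have h2 : ((l + l).descFactorial l : ℝ) ≠ 0 := by
    have := Nat.descFactorial_pos.mpr (show l ≤ l + l by omega)
    exact_mod_cast this.ne'
  simp [h1, h2]

/-- The squared norm of the Legendre polynomial in `L²[-1, 1]`. -/
noncomputable def legendreNormSq (l : ℕ) : ℝ :=
  ∫ x in (-1 : ℝ)..1, (legendrePoly l).eval x ^ 2

theorem legendreNormSq_pos (l : ℕ) : 0 < legendreNormSq l := by
  refine intervalIntegral.integral_pos (by norm_num) (Continuous.continuousOn (by fun_prop))
    (fun x _ => sq_nonneg _) ⟨1, by norm_num, ?_⟩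
  simp [legendrePoly_eval_one]

theorem integral_legendrePoly_mul_legendrePoly_of_ne {i j : ℕ} (h : i ≠ j) :
    ∫ x in (-1 : ℝ)..1, (legendrePoly i).eval x * (legendrePoly j).eval x = 0 := by
  rcases lt_or_gt_of_ne h with h | h
  · exact integral_mul_legendrePoly_of_natDegree_lt ((natDegree_legendrePoly_le i).trans_lt h)
  · rw [show (fun x => (legendrePoly i).eval x * (legendrePoly j).eval x) =
      fun x => (legendrePoly j).eval x * (legendrePoly i).eval x from funext fun x => mul_comm _ _]
    exact integral_mul_legendrePoly_of_natDegree_lt ((natDegree_legendrePoly_le j).trans_lt h)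

theorem exists_legendre_expansion (n : ℕ) : ∀ q : ℝ[X], q.natDegree < n →
    ∃ c : ℕ → ℝ, q = ∑ l ∈ Finset.range n, C (c l) * legendrePoly l := by
  induction n with
  | zero => intro q hq; omega
  | succ n ih =>
    intro q hq
    set a : ℝ := q.coeff n / (legendrePoly n).coeff n with ha
    set r : ℝ[X] := q - C a * legendrePoly n with hr
    have hrn : r.coeff n = 0 := by
      rw [hr, coeff_sub, coeff_C_mul, ha, div_mul_cancel₀ _ (legendrePoly_coeff_ne_zero n),
        sub_self]
    have hrd : r.natDegree ≤ n := by
      refine (natDegree_sub_le _ _).trans (max_le (by omega) ?_)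
      exact (natDegree_C_mul_le _ _).trans (natDegree_legendrePoly_le n)
    by_cases hn : n = 0
    · subst hn
      have : r = 0 := by
        rw [eq_C_of_natDegree_le_zero hrd, hrn, C_0]
      refine ⟨fun _ => a, ?_⟩
      rw [Finset.sum_range_one]
      exact sub_eq_zero.mp this
    · have hrd' : r.natDegree < n := by
        refine lt_of_le_of_ne hrd fun h => ?_
        rw [← h, coeff_natDegree, leadingCoeff_eq_zero] at hrn
        rw [hrn, natDegree_zero] at h
        exact hn h.symm
      obtain ⟨c, hc⟩ := ih r hrd'
      refine ⟨Function.update c n a, ?_⟩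
      rw [Finset.sum_range_succ, Function.update_self]
      have : ∑ l ∈ Finset.range n, C (Function.update c n a l) * legendrePoly l = r := by
        rw [hc]
        refine Finset.sum_congr rfl fun l hl => ?_
        rw [Function.update_of_ne (Finset.mem_range.mp hl).ne]
      rw [this, hr]
      ring

theorem legendre_expansion {n : ℕ} {q : ℝ[X]} (hq : q.natDegree < n) :
    q = ∑ l ∈ Finset.range n,
      C ((∫ x in (-1 : ℝ)..1, q.eval x * (legendrePoly l).eval x) / legendreNormSq l) *
        legendrePoly l := by
  obtain ⟨c, hc⟩ := exists_legendre_expansion n q hq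
  have hcoef : ∀ k ∈ Finset.range n,
      ∫ x in (-1 : ℝ)..1, q.eval x * (legendrePoly k).eval x = c k * legendreNormSq k := by
    intro k hk
    conv_lhs => rw [hc]
    simp only [eval_finsetSum, eval_mul, eval_C, Finset.sum_mul]
    rw [intervalIntegral.integral_finsetSum
      (fun i _ => Continuous.intervalIntegrable (by fun_prop) _ _), Finset.sum_eq_single k]
    · rw [legendreNormSq, ← intervalIntegral.integral_const_mul]
      refine intervalIntegral.integral_congr fun x _ => ?_
      ring
    · intro i _ hik
      simp_rw [mul_assoc]
      rw [intervalIntegral.integral_const_mul,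
        integral_legendrePoly_mul_legendrePoly_of_ne hik, mul_zero]
    · intro h; exact absurd hk h
  conv_lhs => rw [hc]
  refine Finset.sum_congr rfl fun k hk => ?_
  rw [hcoef k hk, mul_div_cancel_right₀ _ (legendreNormSq_pos k).ne']

/-- The derivatives of `(1 + x)^n` are nonnegative on `[-1, 1]`. These powers play the part of Fejér
kernels: positive, concentrating at `1`, with nonnegative coefficients. -/
theorem integral_one_add_pow_mul_legendrePoly_nonneg (n l : ℕ) :
    0 ≤ ∫ x in (-1 : ℝ)..1, (1 + x) ^ n * (legendrePoly l).eval x := by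
  have h := integral_mul_legendrePoly l ((X + C 1) ^ n)
  rw [iterate_derivative_X_add_pow] at h
  have h' : ∫ x in (-1 : ℝ)..1, (1 + x) ^ n * (legendrePoly l).eval x =
      ∫ x in (-1 : ℝ)..1, ((X + C 1 : ℝ[X]) ^ n).eval x * (legendrePoly l).eval x := by
    refine intervalIntegral.integral_congr fun x _ => ?_
    simp [add_comm]
  rw [h', h]
  refine mul_nonneg (by positivity) (intervalIntegral.integral_nonneg (by norm_num) ?_)
  intro x hx
  refine mul_nonneg ?_ (pow_nonneg (by nlinarith [hx.1, hx.2]) _)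
  have : 0 ≤ x + 1 := by linarith [hx.1]
  simp
  positivity

end Legendre

/-! ### The product formula for Legendre polynomials and its consequences. -/

section LegendreProduct

open Polynomial

theorem integral_cos_pow_of_odd {n : ℕ} (hn : Odd n) :
    ∫ φ in -Real.pi..Real.pi, Real.cos φ ^ n = 0 := by
  have hper : Function.Periodic (fun φ => Real.cos φ ^ n) (2 * Real.pi) := fun φ => by
    simp [Real.cos_add_two_pi]
  have h1 := hper.intervalIntegral_add_eq (-Real.pi) 0
  have h2 := intervalIntegral.integral_comp_add_right (a := -Real.pi) (b := Real.pi)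
    (fun φ => Real.cos φ ^ n) Real.pi
  simp only [Real.cos_add_pi, hn.neg_pow, intervalIntegral.integral_neg] at h2
  rw [show -Real.pi + 2 * Real.pi = Real.pi by ring] at h1
  rw [show -Real.pi + Real.pi = 0 by ring, show Real.pi + Real.pi = 0 + 2 * Real.pi by ring,
    ← h1] at h2
  linarith

/-- In the binomial expansion only even powers of the cosine have a nonzero mean, and in these the
square roots occur to even powers, hence are polynomial in `s`. -/
theorem exists_polynomial_circle_average_pow (j : ℕ) {t : ℝ} (ht : t ∈ Set.Icc (-1 : ℝ) 1) :
    ∃ q : ℝ[X], q.natDegree ≤ j ∧ ∀ s ∈ Set.Icc (-1 : ℝ) 1,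
      q.eval s = ∫ φ in -Real.pi..Real.pi,
        (s * t + √(1 - s ^ 2) * √(1 - t ^ 2) * Real.cos φ) ^ j := by
  classical
  refine ⟨∑ m ∈ Finset.range (j + 1), if Even (j - m) then
    C (t ^ m * (j.choose m) * (1 - t ^ 2) ^ ((j - m) / 2) *
      ∫ φ in -Real.pi..Real.pi, Real.cos φ ^ (j - m)) *
      (X ^ m * (1 - X ^ 2) ^ ((j - m) / 2)) else 0, ?_, ?_⟩
  · refine natDegree_sum_le_of_forall_le _ _ fun m hm => ?_
    split_ifs with h
    · refine (natDegree_C_mul_le _ _).trans (natDegree_mul_le.trans ?_)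
      have h1 : ((1 - X ^ 2 : ℝ[X]) ^ ((j - m) / 2)).natDegree ≤ (j - m) / 2 * 2 := by
        refine natDegree_pow_le_of_le _ ?_
        compute_degree
      rw [natDegree_X_pow]
      have := Finset.mem_range.mp hm
      omega
    · simp
  · intro s hs
    have h1s : 0 ≤ 1 - s ^ 2 := by nlinarith [hs.1, hs.2]
    have h1t : 0 ≤ 1 - t ^ 2 := by nlinarith [ht.1, ht.2]
    simp_rw [add_pow, mul_pow]
    rw [intervalIntegral.integral_finsetSum
      (fun i _ => Continuous.intervalIntegrable (by fun_prop) _ _), eval_finsetSum]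
    refine Finset.sum_congr rfl fun m _ => ?_
    have hI : ∫ φ in -Real.pi..Real.pi, s ^ m * t ^ m * (√(1 - s ^ 2) ^ (j - m) *
        √(1 - t ^ 2) ^ (j - m) * Real.cos φ ^ (j - m)) * (j.choose m : ℝ) =
        s ^ m * t ^ m * (√(1 - s ^ 2) ^ (j - m) * √(1 - t ^ 2) ^ (j - m)) * (j.choose m : ℝ) *
          ∫ φ in -Real.pi..Real.pi, Real.cos φ ^ (j - m) := by
      rw [← intervalIntegral.integral_const_mul]
      refine intervalIntegral.integral_congr fun φ _ => ?_
      ring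
    rw [hI]
    split_ifs with h
    · obtain ⟨k, hk⟩ := h
      have hk2 : (j - m) / 2 = k := by omega
      rw [hk2, hk, ← two_mul, pow_mul, pow_mul, Real.sq_sqrt h1s, Real.sq_sqrt h1t]
      simp
      ring
    · rw [integral_cos_pow_of_odd (Nat.not_even_iff_odd.mp h)]
      simp

theorem exists_polynomial_circle_average (p : ℝ[X]) {t : ℝ} (ht : t ∈ Set.Icc (-1 : ℝ) 1) :
    ∃ q : ℝ[X], q.natDegree ≤ p.natDegree ∧ ∀ s ∈ Set.Icc (-1 : ℝ) 1,
      q.eval s = ∫ φ in -Real.pi..Real.pi,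
        p.eval (s * t + √(1 - s ^ 2) * √(1 - t ^ 2) * Real.cos φ) := by
  choose q hq1 hq2 using fun j => exists_polynomial_circle_average_pow j ht
  refine ⟨∑ j ∈ Finset.range (p.natDegree + 1), C (p.coeff j) * q j, ?_, fun s hs => ?_⟩
  · refine natDegree_sum_le_of_forall_le _ _ fun j hj => ?_
    refine (natDegree_C_mul_le _ _).trans ((hq1 j).trans ?_)
    have := Finset.mem_range.mp hj
    omega
  · simp_rw [eval_eq_sum_range (p := p)]
    rw [intervalIntegral.integral_finsetSum
      (fun i _ => Continuous.intervalIntegrable (by fun_prop) _ _), eval_finsetSum]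
    refine Finset.sum_congr rfl fun j _ => ?_
    rw [intervalIntegral.integral_const_mul, eval_mul, eval_C, hq2 j s hs]

theorem exists_inner_eq {t : ℝ} (ht : t ∈ Set.Icc (-1 : ℝ) 1) :
    ∃ e y : S2, inner ℝ (e : EuclideanSpace ℝ (Fin 3)) (y : EuclideanSpace ℝ (Fin 3)) = t := by
  set b := EuclideanSpace.basisFun (Fin 3) ℝ
  refine ⟨⟨b 0, by simp [b]⟩, ⟨spherePoint b t 0, by simpa using norm_spherePoint b 0 ht⟩, ?_⟩
  have := inner_spherePoint b t 0 1 0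
  simp only [one_smul, zero_smul, add_zero] at this
  rw [real_inner_comm]
  simpa using this

/-- Averaging over circles is a self-adjoint operator: for unit vectors `e`, `y` with inner product
`t`, both sides are the integral over the sphere of `r(⟨z, e⟩) p(⟨z, y⟩)`, in coordinates with pole
`e` and with pole `y`. -/
theorem integral_circle_average_swap (p r : ℝ[X]) {t : ℝ} (ht : t ∈ Set.Icc (-1 : ℝ) 1) :
    ∫ s in (-1 : ℝ)..1, r.eval s * ∫ φ in -Real.pi..Real.pi,
        p.eval (s * t + √(1 - s ^ 2) * √(1 - t ^ 2) * Real.cos φ) =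
      ∫ s in (-1 : ℝ)..1, p.eval s * ∫ φ in -Real.pi..Real.pi,
        r.eval (s * t + √(1 - s ^ 2) * √(1 - t ^ 2) * Real.cos φ) := by
  obtain ⟨e, y, hey⟩ := exists_inner_eq ht
  have h1 := integral_sphereArea_two_inner e y (fun a b => r.eval a * p.eval b)
    (by unfold Function.uncurry; fun_prop)
  have h2 := integral_sphereArea_two_inner y e (fun a b => p.eval a * r.eval b)
    (by unfold Function.uncurry; fun_prop)
  rw [hey] at h1
  rw [real_inner_comm, hey] at h2
  simp only [intervalIntegral.integral_const_mul] at h1 h2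
  rw [← h1, ← h2]
  refine integral_congr_ae (Eventually.of_forall fun z => ?_)
  exact mul_comm _ _

/-- The product formula for the Legendre polynomials. -/
theorem integral_legendrePoly_circle (l : ℕ) {s t : ℝ} (hs : s ∈ Set.Icc (-1 : ℝ) 1)
    (ht : t ∈ Set.Icc (-1 : ℝ) 1) :
    ∫ φ in -Real.pi..Real.pi,
        (legendrePoly l).eval (s * t + √(1 - s ^ 2) * √(1 - t ^ 2) * Real.cos φ) =
      2 * Real.pi * (legendrePoly l).eval t * (legendrePoly l).eval s := by
  obtain ⟨q, hq1, hq2⟩ := exists_polynomial_circle_average (legendrePoly l) ht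
  -- The circle average does not raise the degree and is self-adjoint, so it also preserves
  -- orthogonality to lower degrees. Hence `q` is a multiple of `P_l`; its value at `s = 1`, where
  -- the circle shrinks to a point, fixes the factor.
  have horth : ∀ i < l, ∫ x in (-1 : ℝ)..1, q.eval x * (legendrePoly i).eval x = 0 := by
    intro i hi
    obtain ⟨r, hr1, hr2⟩ := exists_polynomial_circle_average (legendrePoly i) ht
    have huI : Set.uIcc (-1 : ℝ) 1 = Set.Icc (-1) 1 := Set.uIcc_of_le (by norm_num)
    calc ∫ x in (-1 : ℝ)..1, q.eval x * (legendrePoly i).eval x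
        = ∫ s in (-1 : ℝ)..1, (legendrePoly i).eval s * ∫ φ in -Real.pi..Real.pi,
          (legendrePoly l).eval (s * t + √(1 - s ^ 2) * √(1 - t ^ 2) * Real.cos φ) := by
          refine intervalIntegral.integral_congr fun x hx => ?_
          rw [huI] at hx
          rw [hq2 x hx, mul_comm]
      _ = ∫ s in (-1 : ℝ)..1, r.eval s * (legendrePoly l).eval s := by
          rw [integral_circle_average_swap _ _ ht]
          refine intervalIntegral.integral_congr fun x hx => ?_
          rw [huI] at hx
          rw [hr2 x hx, mul_comm]
      _ = 0 := integral_mul_legendrePoly_of_natDegree_lt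
          ((hr1.trans (natDegree_legendrePoly_le i)).trans_lt hi)
  have hexp := legendre_expansion (n := l + 1) (q := q)
    (Nat.lt_succ_of_le (hq1.trans (natDegree_legendrePoly_le l)))
  rw [Finset.sum_range_succ, Finset.sum_eq_zero, zero_add] at hexp
  swap
  · intro i hi
    rw [horth i (Finset.mem_range.mp hi)]
    simp
  set a := (∫ x in (-1 : ℝ)..1, q.eval x * (legendrePoly l).eval x) / legendreNormSq l
  have h1 : q.eval 1 = 2 * Real.pi * (legendrePoly l).eval t := by
    rw [hq2 1 (by norm_num)]
    simp only [one_pow, sub_self, Real.sqrt_zero, zero_mul, add_zero, one_mul,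
      intervalIntegral.integral_const, smul_eq_mul]
    ring
  have h2 : q.eval 1 = a := by
    rw [hexp, eval_mul, eval_C, legendrePoly_eval_one, mul_one]
  rw [← hq2 s hs, ← h1, h2, hexp, eval_mul, eval_C]

/-- Let `|P_l|` attain its maximum `M` over `[-1, 1]` at `x`. The product formula with both
arguments equal to `x` exhibits `P_l(x)²` as an average of values of `P_l` on `[-1, 1]`, so `M² ≤
M`. -/
theorem abs_legendrePoly_le_one (l : ℕ) {s : ℝ} (hs : s ∈ Set.Icc (-1 : ℝ) 1) :
    |(legendrePoly l).eval s| ≤ 1 := by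
  obtain ⟨x, hx, hmax⟩ := isCompact_Icc.exists_isMaxOn (s := Set.Icc (-1 : ℝ) 1)
    ⟨1, by norm_num⟩ (f := fun x => |(legendrePoly l).eval x|)
    (Continuous.continuousOn (by fun_prop))
  set M := |(legendrePoly l).eval x| with hM
  have hle : ∀ y ∈ Set.Icc (-1 : ℝ) 1, |(legendrePoly l).eval y| ≤ M := fun y hy => hmax hy
  refine (hle s hs).trans ?_
  have hprod := integral_legendrePoly_circle l hx hx
  have hx2 : 0 ≤ 1 - x ^ 2 := by nlinarith [hx.1, hx.2]
  have hb : ‖∫ φ in -Real.pi..Real.pi,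
      (legendrePoly l).eval (x * x + √(1 - x ^ 2) * √(1 - x ^ 2) * Real.cos φ)‖ ≤
      M * |Real.pi - -Real.pi| := by
    refine intervalIntegral.norm_integral_le_of_norm_le_const fun φ _ => hle _ ?_
    rw [Real.mul_self_sqrt hx2]
    have h1 := Real.neg_one_le_cos φ
    have h2 := Real.cos_le_one φ
    constructor <;> nlinarith [sq_nonneg x]
  rw [hprod, Real.norm_eq_abs, mul_assoc, abs_mul, ← pow_two, abs_pow, ← hM,
    show Real.pi - -Real.pi = 2 * Real.pi by ring,
    abs_of_pos (by positivity : 0 < 2 * Real.pi), mul_comm M] at hb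
  have := le_of_mul_le_mul_left hb (by positivity)
  nlinarith [abs_nonneg ((legendrePoly l).eval x)]

theorem inner_mem_Icc (x y : S2) :
    inner ℝ (x : EuclideanSpace ℝ (Fin 3)) (y : EuclideanSpace ℝ (Fin 3)) ∈
      Set.Icc (-1 : ℝ) 1 := by
  have := abs_real_inner_le_norm (x : EuclideanSpace ℝ (Fin 3)) (y : EuclideanSpace ℝ (Fin 3))
  simp only [norm_eq_of_mem_sphere, mul_one] at this
  exact abs_le.mp this

/-- The product formula integrates out the longitude around `x`, leaving the squared norm of `P_l`.
Averaging a product of two zonal functions over the pole thus reproduces the zonal function. -/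
theorem integral_legendrePoly_mul_legendrePoly_sphere (l : ℕ) (x y : S2) :
    ∫ z : S2, (legendrePoly l).eval (inner ℝ (z : EuclideanSpace ℝ (Fin 3)) x) *
        (legendrePoly l).eval (inner ℝ (z : EuclideanSpace ℝ (Fin 3)) y) ∂sphereArea =
      2 * Real.pi * legendreNormSq l *
        (legendrePoly l).eval
          (inner ℝ (x : EuclideanSpace ℝ (Fin 3)) (y : EuclideanSpace ℝ (Fin 3))) := by
  rw [integral_sphereArea_two_inner x y
    (fun a b => (legendrePoly l).eval a * (legendrePoly l).eval b)
    (by unfold Function.uncurry; fun_prop)]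
  simp only [intervalIntegral.integral_const_mul]
  rw [legendreNormSq, mul_right_comm, ← intervalIntegral.integral_const_mul]
  refine intervalIntegral.integral_congr fun s hs => ?_
  rw [Set.uIcc_of_le (by norm_num)] at hs
  rw [integral_legendrePoly_circle l hs (inner_mem_Icc x y)]
  ring

end LegendreProduct

/-! ### Legendre series of continuous functions with dominated coefficients. -/

section LegendreSeries

open Polynomial

/-- On `[-1, 1]` the function `1 + x` is nonnegative with its unique maximum at `1`, so its
normalized powers form an approximate identity there. -/
theorem tendsto_integral_one_add_pow_mul {g : ℝ → ℝ} (hg : ContinuousOn g (Set.Icc (-1) 1)) :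
    Tendsto (fun n : ℕ => (∫ x in (-1 : ℝ)..1, (1 + x) ^ n)⁻¹ *
      ∫ x in (-1 : ℝ)..1, (1 + x) ^ n * g x) atTop (𝓝 (g 1)) := by
  have h := tendsto_setIntegral_pow_smul_of_unique_maximum_of_isCompact_of_continuousOn
    (μ := (volume : Measure ℝ)) (s := Set.Icc (-1 : ℝ) 1) (x₀ := (1 : ℝ)) (g := g)
    isCompact_Icc (c := fun x => 1 + x) (by fun_prop)
    (fun y hy hne => by have := lt_of_le_of_ne hy.2 hne; linarith)
    (fun x hx => by linarith [hx.1]) (by norm_num)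
    (by rw [interior_Icc, closure_Ioo (by norm_num)]; norm_num) hg
  simpa only [intervalIntegral.integral_of_le (show (-1 : ℝ) ≤ 1 by norm_num),
    ← integral_Icc_eq_integral_Ioc, smul_eq_mul] using h

theorem integral_one_add_pow_mul_eq_sum {g : ℝ → ℝ} (hg : ContinuousOn g (Set.Icc (-1) 1))
    (n : ℕ) :
    ∫ x in (-1 : ℝ)..1, (1 + x) ^ n * g x = ∑ l ∈ Finset.range (n + 1),
      (∫ x in (-1 : ℝ)..1, (1 + x) ^ n * (legendrePoly l).eval x) / legendreNormSq l *
        ∫ x in (-1 : ℝ)..1, g x * (legendrePoly l).eval x := by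
  have hd : ((X + C 1 : ℝ[X]) ^ n).natDegree < n + 1 := by
    rw [natDegree_pow, natDegree_X_add_C]
    omega
  have hev : ∀ x : ℝ, ((X + C 1 : ℝ[X]) ^ n).eval x = (1 + x) ^ n := fun x => by
    simp [add_comm]
  have h := legendre_expansion hd
  have h' : ∀ x : ℝ, (1 + x) ^ n * g x = ∑ l ∈ Finset.range (n + 1),
      (∫ x in (-1 : ℝ)..1, (1 + x) ^ n * (legendrePoly l).eval x) / legendreNormSq l *
        (g x * (legendrePoly l).eval x) := by
    intro x
    rw [← hev, h]
    simp only [eval_finsetSum, eval_mul, eval_C, Finset.sum_mul, hev]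
    exact Finset.sum_congr rfl fun l _ => by ring
  simp_rw [h']
  rw [intervalIntegral.integral_finsetSum]
  · simp only [intervalIntegral.integral_const_mul]
  · intro l _
    refine ContinuousOn.intervalIntegrable_of_Icc (by norm_num) ?_
    fun_prop

/-- If the Legendre coefficients of a continuous function are nonnegative, the partial sums of its
Legendre series at `1` are at most its value there. -/
theorem sum_legendre_coeff_le {g : ℝ → ℝ} (hg : ContinuousOn g (Set.Icc (-1) 1))
    (hpos : ∀ l, 0 ≤ ∫ x in (-1 : ℝ)..1, g x * (legendrePoly l).eval x) (m : ℕ) :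
    ∑ l ∈ Finset.range m,
      (∫ x in (-1 : ℝ)..1, g x * (legendrePoly l).eval x) / legendreNormSq l ≤ g 1 := by
  -- The damping factor of each fixed degree tends to `P_l(1) = 1`. For fixed `n` the damped sum to
  -- `m` is at most the full damped sum, all terms being nonnegative, and the latter is the kernel
  -- average of `g`.
  have hlim : Tendsto (fun n : ℕ => ∑ l ∈ Finset.range m,
      ((∫ x in (-1 : ℝ)..1, (1 + x) ^ n)⁻¹ *
        ∫ x in (-1 : ℝ)..1, (1 + x) ^ n * (legendrePoly l).eval x) *
        ((∫ x in (-1 : ℝ)..1, g x * (legendrePoly l).eval x) / legendreNormSq l)) atTop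
      (𝓝 (∑ l ∈ Finset.range m,
        1 * ((∫ x in (-1 : ℝ)..1, g x * (legendrePoly l).eval x) / legendreNormSq l))) := by
    refine tendsto_finsetSum _ fun l _ => Tendsto.mul_const _ ?_
    have := tendsto_integral_one_add_pow_mul (g := fun x => (legendrePoly l).eval x)
      (Continuous.continuousOn (by fun_prop))
    rwa [legendrePoly_eval_one] at this
  simp only [one_mul] at hlim
  refine le_of_tendsto_of_tendsto hlim (tendsto_integral_one_add_pow_mul hg) ?_
  filter_upwards [eventually_ge_atTop m] with n hn
  rw [integral_one_add_pow_mul_eq_sum hg, Finset.mul_sum]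
  have hw : 0 ≤ (∫ x in (-1 : ℝ)..1, (1 + x) ^ n)⁻¹ :=
    inv_nonneg.mpr (intervalIntegral.integral_nonneg (by norm_num)
      fun x hx => pow_nonneg (by linarith [hx.1]) n)
  calc _ = ∑ l ∈ Finset.range m, (∫ x in (-1 : ℝ)..1, (1 + x) ^ n)⁻¹ *
        ((∫ x in (-1 : ℝ)..1, (1 + x) ^ n * (legendrePoly l).eval x) / legendreNormSq l *
        ∫ x in (-1 : ℝ)..1, g x * (legendrePoly l).eval x) :=
        Finset.sum_congr rfl fun l _ => by ring
    _ ≤ _ := by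
        refine Finset.sum_le_sum_of_subset_of_nonneg
          (Finset.range_mono (by omega)) fun l _ _ => ?_
        exact mul_nonneg hw (mul_nonneg (div_nonneg
          (integral_one_add_pow_mul_legendrePoly_nonneg n l) (legendreNormSq_pos l).le) (hpos l))

/-- A continuous function on `[-1, 1]` without Legendre coefficients vanishes. -/
theorem eq_zero_of_legendre_coeff_eq_zero {D : ℝ → ℝ} (hD : ContinuousOn D (Set.Icc (-1) 1))
    (h0 : ∀ l, ∫ x in (-1 : ℝ)..1, D x * (legendrePoly l).eval x = 0) :
    ∀ x ∈ Set.Icc (-1 : ℝ) 1, D x = 0 := by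
  have hpoly : ∀ q : ℝ[X], ∫ x in (-1 : ℝ)..1, D x * q.eval x = 0 := by
    intro q
    obtain ⟨c, hc⟩ := exists_legendre_expansion (q.natDegree + 1) q (by omega)
    rw [hc]
    simp only [eval_finsetSum, eval_mul, eval_C, Finset.mul_sum]
    rw [intervalIntegral.integral_finsetSum]
    · refine Finset.sum_eq_zero fun l _ => ?_
      rw [show (fun x => D x * (c l * (legendrePoly l).eval x)) =
        fun x => c l * (D x * (legendrePoly l).eval x) from funext fun x => by ring,
        intervalIntegral.integral_const_mul, h0, mul_zero]
    · intro l _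
      refine ContinuousOn.intervalIntegrable_of_Icc (by norm_num) ?_
      fun_prop
  obtain ⟨B, hB⟩ := isCompact_Icc.exists_bound_of_continuousOn hD
  have hB0 : 0 ≤ B := (norm_nonneg _).trans (hB 1 (by norm_num))
  have hsq : ∫ x in (-1 : ℝ)..1, D x ^ 2 ≤ 0 := by
    refine le_of_forall_pos_le_add fun ε hε => ?_
    -- Weierstrass approximation: `D` is orthogonal to all polynomials, so `∫ D² = ∫ D (D - q)`. The
    -- tolerance yields `2 B ε / (2 (B + 1)) ≤ ε` on an interval of length `2`, and `B + 1` avoids a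
    -- division by zero.
    obtain ⟨q, hq⟩ := exists_polynomial_near_of_continuousOn (-1) 1 D hD
      (ε / (2 * (B + 1))) (by positivity)
    have h1 : ∫ x in (-1 : ℝ)..1, D x ^ 2 =
        ∫ x in (-1 : ℝ)..1, D x * (D x - q.eval x) := by
      have h2 : ∫ x in (-1 : ℝ)..1, D x * (D x - q.eval x) =
          (∫ x in (-1 : ℝ)..1, D x ^ 2) - ∫ x in (-1 : ℝ)..1, D x * q.eval x := by
        rw [← intervalIntegral.integral_sub]
        · refine intervalIntegral.integral_congr fun x _ => ?_
          ring
        · refine ContinuousOn.intervalIntegrable_of_Icc (by norm_num) ?_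
          fun_prop
        · refine ContinuousOn.intervalIntegrable_of_Icc (by norm_num) ?_
          fun_prop
      rw [h2, hpoly, sub_zero]
    rw [h1, zero_add]
    have h3 : ‖∫ x in (-1 : ℝ)..1, D x * (D x - q.eval x)‖ ≤
        (B * (ε / (2 * (B + 1)))) * |(1 : ℝ) - -1| := by
      refine intervalIntegral.norm_integral_le_of_norm_le_const fun x hx => ?_
      rw [Set.uIoc_of_le (by norm_num)] at hx
      have hx' : x ∈ Set.Icc (-1 : ℝ) 1 := ⟨hx.1.le, hx.2⟩
      rw [norm_mul]
      refine mul_le_mul (hB x hx') ?_ (norm_nonneg _) hB0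
      rw [Real.norm_eq_abs, abs_sub_comm]
      exact (hq x hx').le
    refine (le_abs_self _).trans (h3.trans ?_)
    rw [show |(1 : ℝ) - -1| = 2 by norm_num]
    have : B * (ε / (2 * (B + 1))) * 2 = ε * (B / (B + 1)) := by
      field_simp
    rw [this]
    have h4 : B / (B + 1) ≤ 1 := (div_le_one (by positivity)).mpr (by linarith)
    nlinarith
  intro x hx
  by_contra hne
  have : 0 < ∫ x in (-1 : ℝ)..1, D x ^ 2 :=
    intervalIntegral.integral_pos (by norm_num) (hD.pow 2) (fun x _ => sq_nonneg _)
      ⟨x, hx, by positivity⟩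
  linarith

/-- Domination of the Legendre coefficients of `h` by the nonnegative ones of `g` dominates `h`. -/
theorem abs_le_of_legendre_coeff_le {g h : ℝ → ℝ} (hg : ContinuousOn g (Set.Icc (-1) 1))
    (hh : ContinuousOn h (Set.Icc (-1) 1))
    (hpos : ∀ l, 0 ≤ ∫ x in (-1 : ℝ)..1, g x * (legendrePoly l).eval x) {c : ℝ} (hc : 0 ≤ c)
    (hle : ∀ l, |∫ x in (-1 : ℝ)..1, h x * (legendrePoly l).eval x| ≤
      c * ∫ x in (-1 : ℝ)..1, g x * (legendrePoly l).eval x) {x : ℝ}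
    (hx : x ∈ Set.Icc (-1 : ℝ) 1) : |h x| ≤ c * g 1 := by
  set a : ℕ → ℝ := fun l =>
    (∫ x in (-1 : ℝ)..1, g x * (legendrePoly l).eval x) / legendreNormSq l with ha
  set b : ℕ → ℝ := fun l =>
    (∫ x in (-1 : ℝ)..1, h x * (legendrePoly l).eval x) / legendreNormSq l with hb
  have ha0 : ∀ l, 0 ≤ a l := fun l => div_nonneg (hpos l) (legendreNormSq_pos l).le
  have hsum : Summable a := summable_of_sum_range_le ha0 (sum_legendre_coeff_le hg hpos)
  have htsum : ∑' l, a l ≤ g 1 := hsum.tsum_le_of_sum_range_le (sum_legendre_coeff_le hg hpos)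
  have hba : ∀ l, |b l| ≤ c * a l := by
    intro l
    simp only [hb, ha]
    rw [abs_div, abs_of_pos (legendreNormSq_pos l), ← mul_div_assoc]
    exact div_le_div_of_nonneg_right (hle l) (legendreNormSq_pos l).le
  have hterm : ∀ l, ∀ y ∈ Set.Icc (-1 : ℝ) 1, ‖b l * (legendrePoly l).eval y‖ ≤ c * a l := by
    intro l y hy
    rw [norm_mul, Real.norm_eq_abs, Real.norm_eq_abs]
    calc _ ≤ |b l| * 1 := by gcongr; exact abs_legendrePoly_le_one l hy
      _ ≤ _ := by rw [mul_one]; exact hba l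
  have hcsum : Summable fun l => c * a l := hsum.mul_left c
  set S : ℝ → ℝ := fun y => ∑' l, b l * (legendrePoly l).eval y with hS
  have hScont : ContinuousOn S (Set.Icc (-1) 1) :=
    continuousOn_tsum (fun l => Continuous.continuousOn (by fun_prop)) hcsum hterm
  have hScoef : ∀ k, ∫ x in (-1 : ℝ)..1, S x * (legendrePoly k).eval x =
      ∫ x in (-1 : ℝ)..1, h x * (legendrePoly k).eval x := by
    intro k
    have hHS := intervalIntegral.hasSum_integral_of_dominated_convergence
      (μ := volume) (a := (-1 : ℝ)) (b := 1)
      (F := fun l y => b l * (legendrePoly l).eval y * (legendrePoly k).eval y)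
      (f := fun y => S y * (legendrePoly k).eval y) (fun l _ => c * a l)
      (fun l => Continuous.aestronglyMeasurable (by fun_prop))
      (fun l => Eventually.of_forall fun y hy => by
        rw [Set.uIoc_of_le (by norm_num)] at hy
        have hy' : y ∈ Set.Icc (-1 : ℝ) 1 := ⟨hy.1.le, hy.2⟩
        rw [norm_mul]
        calc _ ≤ (c * a l) * 1 :=
              mul_le_mul (hterm l y hy') (abs_legendrePoly_le_one k hy') (abs_nonneg _)
                (mul_nonneg hc (ha0 l))
          _ = _ := mul_one _)
      (Eventually.of_forall fun y _ => hcsum)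
      (by simp)
      (Eventually.of_forall fun y hy => by
        rw [Set.uIoc_of_le (by norm_num)] at hy
        have hy' : y ∈ Set.Icc (-1 : ℝ) 1 := ⟨hy.1.le, hy.2⟩
        exact (Summable.of_norm_bounded hcsum fun l => hterm l y hy').hasSum.mul_right _)
    have hsingle : ∀ l, l ≠ k → ∫ y in (-1 : ℝ)..1,
        b l * (legendrePoly l).eval y * (legendrePoly k).eval y = 0 := by
      intro l hl
      simp_rw [mul_assoc]
      rw [intervalIntegral.integral_const_mul,
        integral_legendrePoly_mul_legendrePoly_of_ne hl, mul_zero]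
    rw [hHS.unique (hasSum_single k hsingle)]
    simp_rw [mul_assoc, ← pow_two]
    rw [intervalIntegral.integral_const_mul]
    exact div_mul_cancel₀ _ (legendreNormSq_pos k).ne'
  -- The uniformly convergent series `S` has the coefficients of `h`, so completeness identifies the
  -- two at every point, and the bound may be read off the series.
  have hzero := eq_zero_of_legendre_coeff_eq_zero (hh.sub hScont) (fun l => by
    have : ∫ x in (-1 : ℝ)..1, (h - S) x * (legendrePoly l).eval x =
        (∫ x in (-1 : ℝ)..1, h x * (legendrePoly l).eval x) -
          ∫ x in (-1 : ℝ)..1, S x * (legendrePoly l).eval x := by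
      rw [← intervalIntegral.integral_sub]
      · refine intervalIntegral.integral_congr fun y _ => ?_
        simp only [Pi.sub_apply]
        ring
      · refine ContinuousOn.intervalIntegrable_of_Icc (by norm_num) ?_
        fun_prop
      · refine ContinuousOn.intervalIntegrable_of_Icc (by norm_num) ?_
        fun_prop
    exact this.trans (by rw [hScoef, sub_self])) x hx
  have hhS : h x = S x := sub_eq_zero.mp hzero
  rw [hhS, ← Real.norm_eq_abs]
  calc ‖S x‖ ≤ ∑' l, c * a l := tsum_of_norm_bounded hcsum.hasSum fun l => hterm l x hx
    _ = c * ∑' l, a l := tsum_mul_left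
    _ ≤ c * g 1 := by gcongr

end LegendreSeries

/-! ### Joint exceedance probability of two correlated Gaussians and its expansion in the
correlation. -/

/-- The tail probability of the standard Gaussian law. -/
noncomputable def gaussianTail (a : ℝ) : ℝ := (gaussianReal 0 1).real (Set.Ici a)

theorem gaussianPDFReal_std (x : ℝ) :
    gaussianPDFReal 0 1 x = (√(2 * Real.pi))⁻¹ * Real.exp (-x ^ 2 / 2) := by
  simp [gaussianPDFReal]

theorem continuous_gaussianPDFReal_std : Continuous (gaussianPDFReal 0 1) := by
  simp_rw [funext gaussianPDFReal_std]
  fun_prop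

theorem integral_gaussianReal_std (f : ℝ → ℝ) :
    ∫ x, f x ∂(gaussianReal 0 1) = ∫ x, gaussianPDFReal 0 1 x * f x := by
  rw [integral_gaussianReal_eq_integral_smul one_ne_zero]
  rfl

theorem gaussianTail_eq_integral (a : ℝ) :
    gaussianTail a = ∫ x in Set.Ioi a, gaussianPDFReal 0 1 x := by
  rw [gaussianTail, ← integral_indicator_one measurableSet_Ici, integral_gaussianReal_std,
    ← integral_Ici_eq_integral_Ioi, ← integral_indicator measurableSet_Ici]
  refine integral_congr_ae (Eventually.of_forall fun x => ?_)
  by_cases h : x ∈ Set.Ici a <;> simp [h]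

theorem gaussianTail_nonneg (a : ℝ) : 0 ≤ gaussianTail a := measureReal_nonneg

theorem gaussianTail_le_one (a : ℝ) : gaussianTail a ≤ 1 := measureReal_le_one

theorem hasDerivAt_gaussianTail (a : ℝ) :
    HasDerivAt gaussianTail (-gaussianPDFReal 0 1 a) a := by
  have hint := integrable_gaussianPDFReal 0 1
  have h : gaussianTail = fun b => gaussianTail 0 - ∫ x in (0 : ℝ)..b, gaussianPDFReal 0 1 x := by
    funext b
    rw [gaussianTail_eq_integral, gaussianTail_eq_integral,
      ← intervalIntegral.integral_Ioi_sub_Ioi' hint.integrableOn hint.integrableOn]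
    ring
  rw [h]
  refine HasDerivAt.const_sub _ ?_
  exact intervalIntegral.integral_hasDerivAt_right
    (continuous_gaussianPDFReal_std.intervalIntegrable _ _)
    (continuous_gaussianPDFReal_std.stronglyMeasurableAtFilter _ _)
    continuous_gaussianPDFReal_std.continuousAt

theorem gaussianPDFReal_std_le_one (x : ℝ) : gaussianPDFReal 0 1 x ≤ 1 := by
  rw [gaussianPDFReal_std]
  have h1 : (√(2 * Real.pi))⁻¹ ≤ 1 := by
    refine inv_le_one_of_one_le₀ ?_
    rw [Real.one_le_sqrt]
    linarith [Real.pi_gt_three]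
  have h2 : Real.exp (-x ^ 2 / 2) ≤ 1 := Real.exp_le_one_iff.mpr (by nlinarith [sq_nonneg x])
  calc _ ≤ 1 * 1 := mul_le_mul h1 h2 (Real.exp_nonneg _) zero_le_one
    _ = 1 := one_mul 1

theorem gaussianPDFReal_std_nonneg (x : ℝ) : 0 ≤ gaussianPDFReal 0 1 x :=
  gaussianPDFReal_nonneg 0 1 x

/-- The probability that two standard Gaussian variables with correlation `ρ` exceed `u`. -/
noncomputable def jointTail (u ρ : ℝ) : ℝ :=
  ∫ x in Set.Ioi u, gaussianPDFReal 0 1 x * gaussianTail ((u - ρ * x) / √(1 - ρ ^ 2))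

theorem jointTail_zero (u : ℝ) : jointTail u 0 = gaussianTail u ^ 2 := by
  simp only [jointTail, zero_mul, sub_zero, zero_pow two_ne_zero, Real.sqrt_one, div_one]
  rw [integral_mul_const, ← gaussianTail_eq_integral, pow_two]

/-- The density at `(u, u)` of two standard Gaussian variables with correlation `ρ`. -/
noncomputable def diagDensity (u ρ : ℝ) : ℝ :=
  (2 * Real.pi)⁻¹ * (√(1 - ρ ^ 2))⁻¹ * Real.exp (-u ^ 2 / (1 + ρ))

/-- The bivariate density is symmetric, so it can be disintegrated along either coordinate: `x² + (u
- ρx)² / (1 - ρ²)` is unchanged when `x` and `u` are exchanged. -/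
theorem gaussianPDFReal_mul_rotate (u x : ℝ) {ρ : ℝ} (hρ : 0 < 1 - ρ ^ 2) :
    gaussianPDFReal 0 1 x * gaussianPDFReal 0 1 ((u - ρ * x) / √(1 - ρ ^ 2)) =
      gaussianPDFReal 0 1 u * gaussianPDFReal 0 1 ((x - ρ * u) / √(1 - ρ ^ 2)) := by
  simp only [gaussianPDFReal_std, div_pow, Real.sq_sqrt hρ.le]
  have e : ∀ c a b : ℝ, c * Real.exp a * (c * Real.exp b) = c * c * Real.exp (a + b) :=
    fun c a b => by rw [Real.exp_add]; ring
  rw [e, e]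
  congr 2
  field_simp
  ring

theorem hasDerivAt_rescale (u x : ℝ) {ρ : ℝ} (hρ : 0 < 1 - ρ ^ 2) :
    HasDerivAt (fun r => (u - r * x) / √(1 - r ^ 2))
      (-((x - ρ * u) / ((1 - ρ ^ 2) * √(1 - ρ ^ 2)))) ρ := by
  have h1 : HasDerivAt (fun r : ℝ => u - r * x) (-x) ρ := by
    simpa using ((hasDerivAt_id ρ).mul_const x).const_sub u
  have h2 : HasDerivAt (fun r : ℝ => 1 - r ^ 2) (-(2 * ρ)) ρ := by
    simpa using ((hasDerivAt_id ρ).pow 2).const_sub 1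
  have h3 := h1.div (h2.sqrt hρ.ne') (Real.sqrt_pos.mpr hρ).ne'
  refine h3.congr_deriv ?_
  have hs : √(1 - ρ ^ 2) ^ 2 = 1 - ρ ^ 2 := Real.sq_sqrt hρ.le
  have hs0 : √(1 - ρ ^ 2) ≠ 0 := (Real.sqrt_pos.mpr hρ).ne'
  generalize √(1 - ρ ^ 2) = w at hs hs0
  rw [← hs]
  field_simp
  linear_combination (-x) * hs

theorem hasDerivAt_gaussianPDFReal_std (x : ℝ) :
    HasDerivAt (gaussianPDFReal 0 1) (-x * gaussianPDFReal 0 1 x) x := by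
  have h1 : HasDerivAt (fun y : ℝ => -y ^ 2 / 2) (-x) x := by
    have := (((hasDerivAt_id x).pow 2).neg).div_const 2
    refine this.congr_deriv ?_
    simp
    ring
  have h2 := (h1.exp).const_mul (√(2 * Real.pi))⁻¹
  rw [funext gaussianPDFReal_std]
  refine h2.congr_deriv ?_
  ring

theorem tendsto_gaussianPDFReal_std_atTop : Tendsto (gaussianPDFReal 0 1) atTop (𝓝 0) := by
  rw [funext gaussianPDFReal_std, ← mul_zero (√(2 * Real.pi))⁻¹]
  refine Tendsto.const_mul _ (Real.tendsto_exp_atBot.comp ?_)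
  have : Tendsto (fun x : ℝ => x ^ 2 / 2) atTop atTop :=
    (tendsto_pow_atTop two_ne_zero).atTop_div_const two_pos
  refine (tendsto_neg_atTop_atBot.comp this).congr fun x => ?_
  simp
  ring

theorem tendsto_gaussianPDFReal_std_rescale (c : ℝ) {w : ℝ} (hw : 0 < w) :
    Tendsto (fun x => gaussianPDFReal 0 1 ((x - c) / w)) atTop (𝓝 0) := by
  have h1 : Tendsto (fun x : ℝ => x - c) atTop atTop := by
    simpa only [sub_eq_add_neg, id] using
      tendsto_atTop_add_const_right atTop (-c) (tendsto_id (α := ℝ))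
  exact tendsto_gaussianPDFReal_std_atTop.comp (h1.atTop_div_const hw)

theorem integrable_gaussianPDFReal_mul_id :
    Integrable fun x : ℝ => gaussianPDFReal 0 1 x * x := by
  have h : Integrable (fun x : ℝ => x) (gaussianReal 0 1) :=
    (memLp_id_gaussianReal (μ := 0) (v := 1) 1).integrable le_rfl
  rw [gaussianReal_of_var_ne_zero 0 one_ne_zero,
    integrable_withDensity_iff_integrable_smul' (measurable_gaussianPDF 0 1)
      (Eventually.of_forall fun x => gaussianPDF_lt_top)] at h
  simpa [toReal_gaussianPDF] using h

/-- Plackett's formula on the diagonal. -/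
theorem hasDerivAt_jointTail (u : ℝ) {ρ : ℝ} (hρ : |ρ| < 3 / 4) :
    HasDerivAt (jointTail u) (diagDensity u ρ) ρ := by
  -- Staying away from `|ρ| = 1` gives a dominating function uniform in the correlation; later only
  -- `|ρ| ≤ 1 / 2` is needed.
  have hsq : ∀ r : ℝ, |r| < 3 / 4 → 7 / 16 < 1 - r ^ 2 := fun r hr => by
    have := abs_lt.mp hr
    nlinarith
  have hρ2 : 0 < 1 - ρ ^ 2 := by linarith [hsq ρ hρ]
  set F' : ℝ → ℝ → ℝ := fun r x => gaussianPDFReal 0 1 x *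
    (gaussianPDFReal 0 1 ((u - r * x) / √(1 - r ^ 2)) *
      ((x - r * u) / ((1 - r ^ 2) * √(1 - r ^ 2)))) with hF'
  have hTailCont : Continuous gaussianTail :=
    continuous_iff_continuousAt.mpr fun a => (hasDerivAt_gaussianTail a).continuousAt
  have hcont : ∀ r : ℝ, Continuous fun x =>
      gaussianPDFReal 0 1 x * gaussianTail ((u - r * x) / √(1 - r ^ 2)) := fun r =>
    continuous_gaussianPDFReal_std.mul (hTailCont.comp (by fun_prop))
  have hcont' : Continuous (F' ρ) :=
    continuous_gaussianPDFReal_std.mul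
      ((continuous_gaussianPDFReal_std.comp (by fun_prop)).mul (by fun_prop))
  have hbound_int : Integrable fun x : ℝ => 4 * (gaussianPDFReal 0 1 x * (|x| + |u|)) := by
    refine Integrable.const_mul ?_ 4
    have h1 := integrable_gaussianPDFReal_mul_id.norm
    have h2 := (integrable_gaussianPDFReal 0 1).mul_const |u|
    refine (h1.add h2).congr (Eventually.of_forall fun x => ?_)
    simp only [Pi.add_apply, norm_mul, Real.norm_eq_abs, abs_of_nonneg (gaussianPDFReal_std_nonneg x)]
    ring
  have hmain := hasDerivAt_integral_of_dominated_loc_of_deriv_le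
    (μ := volume.restrict (Set.Ioi u)) (F := fun r x =>
      gaussianPDFReal 0 1 x * gaussianTail ((u - r * x) / √(1 - r ^ 2)))
    (F' := F') (x₀ := ρ) (s := Metric.ball ρ (3 / 4 - |ρ|))
    (bound := fun x => 4 * (gaussianPDFReal 0 1 x * (|x| + |u|)))
    (Metric.ball_mem_nhds ρ (by linarith))
    (Eventually.of_forall fun r => (hcont r).aestronglyMeasurable)
    (by
      refine ((integrable_gaussianPDFReal 0 1).integrableOn).mono' (hcont ρ).aestronglyMeasurable
        (Eventually.of_forall fun x => ?_)
      rw [norm_mul, Real.norm_eq_abs, Real.norm_eq_abs,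
        abs_of_nonneg (gaussianPDFReal_std_nonneg x), abs_of_nonneg (gaussianTail_nonneg _)]
      exact mul_le_of_le_one_right (gaussianPDFReal_std_nonneg x) (gaussianTail_le_one _))
    hcont'.aestronglyMeasurable
    (Eventually.of_forall fun x r hr => by
      have hr' : |r| < 3 / 4 := by
        have h1 : |r - ρ| < 3 / 4 - |ρ| := by simpa [Real.dist_eq] using hr
        have h2 := abs_sub_abs_le_abs_sub r ρ
        linarith
      have h3 := hsq r hr'
      have h4 : (3 / 5 : ℝ) ≤ √(1 - r ^ 2) := Real.le_sqrt_of_sq_le (by linarith)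
      have h5 : (1 / 4 : ℝ) ≤ (1 - r ^ 2) * √(1 - r ^ 2) := by nlinarith
      have h6 : |x - r * u| ≤ |x| + |u| := by
        refine (abs_sub _ _).trans ?_
        rw [abs_mul]
        nlinarith [abs_nonneg u, abs_nonneg r]
      simp only [hF', norm_mul, norm_div, Real.norm_eq_abs,
        abs_of_nonneg (gaussianPDFReal_std_nonneg _)]
      have h7 : |x - r * u| / (|1 - r ^ 2| * |√(1 - r ^ 2)|) ≤ 4 * (|x| + |u|) := by
        rw [← abs_mul, abs_of_pos (by linarith : 0 < (1 - r ^ 2) * √(1 - r ^ 2)), div_le_iff₀ (by linarith)]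
        nlinarith [abs_nonneg x, abs_nonneg u]
      calc _ ≤ gaussianPDFReal 0 1 x * (1 * (4 * (|x| + |u|))) :=
            mul_le_mul_of_nonneg_left (mul_le_mul (gaussianPDFReal_std_le_one _) h7
              (by positivity) zero_le_one) (gaussianPDFReal_std_nonneg x)
        _ = _ := by ring)
    (hbound_int.integrableOn)
    (Eventually.of_forall fun x r hr => by
      have hr' : |r| < 3 / 4 := by
        have h1 : |r - ρ| < 3 / 4 - |ρ| := by simpa [Real.dist_eq] using hr
        have h2 := abs_sub_abs_le_abs_sub r ρ
        linarith
      have h3 : 0 < 1 - r ^ 2 := by linarith [hsq r hr']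
      have h7 := ((hasDerivAt_gaussianTail _).comp r (hasDerivAt_rescale u x h3)).const_mul
        (gaussianPDFReal 0 1 x)
      refine h7.congr_deriv ?_
      simp only [hF']
      ring)
  have hs0 : 0 < √(1 - ρ ^ 2) := Real.sqrt_pos.mpr hρ2
  have hs2 : √(1 - ρ ^ 2) ^ 2 = 1 - ρ ^ 2 := Real.sq_sqrt hρ2.le
  refine hmain.2.congr_deriv ?_
  -- After the exchange of `x` and `u` in the density, the derivative in the correlation is an exact
  -- derivative in `x`, and the integral reduces to its boundary value at `u`.
  have hftc := integral_Ioi_of_hasDerivAt_of_tendsto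
    (f := fun x => -(gaussianPDFReal 0 1 u * (√(1 - ρ ^ 2))⁻¹ *
      gaussianPDFReal 0 1 ((x - ρ * u) / √(1 - ρ ^ 2)))) (f' := F' ρ) (a := u) (m := 0)
    (by
      refine Continuous.continuousWithinAt ?_
      exact (continuous_const.mul (continuous_gaussianPDFReal_std.comp (by fun_prop))).neg)
    (fun x _ => by
      have h1 : HasDerivAt (fun x : ℝ => (x - ρ * u) / √(1 - ρ ^ 2)) (√(1 - ρ ^ 2))⁻¹ x := by
        simpa using ((hasDerivAt_id x).sub_const (ρ * u)).div_const √(1 - ρ ^ 2)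
      have h2 := (((hasDerivAt_gaussianPDFReal_std _).comp x h1).const_mul
        (gaussianPDFReal 0 1 u * (√(1 - ρ ^ 2))⁻¹)).neg
      refine h2.congr_deriv ?_
      simp only [hF']
      rw [← mul_assoc (gaussianPDFReal 0 1 x), gaussianPDFReal_mul_rotate u x hρ2]
      rw [show (1 - ρ ^ 2) * √(1 - ρ ^ 2) = √(1 - ρ ^ 2) ^ 3 by
        rw [pow_succ _ 2, hs2]]
      field_simp)
    hmain.1
    (by
      simpa using ((tendsto_gaussianPDFReal_std_rescale (ρ * u) hs0).const_mul
        (gaussianPDFReal 0 1 u * (√(1 - ρ ^ 2))⁻¹)).neg)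
  rw [hftc, diagDensity, gaussianPDFReal_std, gaussianPDFReal_std]
  have h1 : 1 + ρ ≠ 0 := by
    have := abs_lt.mp hρ
    linarith
  have hpi : (√(2 * Real.pi))⁻¹ * (√(2 * Real.pi))⁻¹ = (2 * Real.pi)⁻¹ := by
    rw [← mul_inv, Real.mul_self_sqrt (by positivity)]
  have hexp : Real.exp (-u ^ 2 / 2) * Real.exp (-((u - ρ * u) / √(1 - ρ ^ 2)) ^ 2 / 2) =
      Real.exp (-u ^ 2 / (1 + ρ)) := by
    rw [← Real.exp_add, div_pow, hs2]
    congr 1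
    have : 1 - ρ ^ 2 ≠ 0 := hρ2.ne'
    field_simp
    ring
  rw [← hpi, ← hexp]
  ring

theorem abs_exp_sub_exp_le {a b : ℝ} (ha : a ≤ 0) (hb : b ≤ 0) :
    |Real.exp a - Real.exp b| ≤ |a - b| := by
  have key : ∀ {a b : ℝ}, a ≤ 0 → Real.exp a - Real.exp b ≤ |a - b| := by
    intro a b ha
    have h1 : Real.exp b = Real.exp a * Real.exp (b - a) := by rw [← Real.exp_add]; ring_nf
    have h2 := Real.add_one_le_exp (b - a)
    have h3 := Real.exp_pos a
    have h4 : Real.exp a ≤ 1 := Real.exp_le_one_iff.mpr ha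
    calc Real.exp a - Real.exp b ≤ Real.exp a * (a - b) := by rw [h1]; nlinarith
      _ ≤ Real.exp a * |a - b| := by gcongr; exact le_abs_self _
      _ ≤ 1 * |a - b| := by gcongr
      _ = |a - b| := one_mul _
  exact abs_le.mpr ⟨by linarith [key (a := b) (b := a) hb, abs_sub_comm a b], key ha⟩

/-- The factor `(1 - ρ²)^(-1/2)` is even in `ρ` and contributes only a quadratic error. The linear
error comes from the exponential and carries `u²`, so it is absent at level `0`. -/
theorem abs_diagDensity_sub_le (u : ℝ) {ρ : ℝ} (hρ : |ρ| ≤ 1 / 2) :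
    |diagDensity u ρ - gaussianPDFReal 0 1 u ^ 2| ≤ 2 * |ρ| ^ 2 + 2 * u ^ 2 * |ρ| := by
  have hρ' := abs_le.mp hρ
  have h1 : 3 / 4 ≤ 1 - ρ ^ 2 := by nlinarith
  have hs1 : √(1 - ρ ^ 2) ≤ 1 := Real.sqrt_le_one.mpr (by nlinarith)
  have hs0 : 0 < √(1 - ρ ^ 2) := Real.sqrt_pos.mpr (by linarith)
  have hs2 : √(1 - ρ ^ 2) ^ 2 = 1 - ρ ^ 2 := Real.sq_sqrt (by linarith)
  set w := (√(1 - ρ ^ 2))⁻¹ with hw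
  have hw1 : 0 ≤ w - 1 := sub_nonneg.mpr ((one_le_inv₀ hs0).mpr hs1)
  have hw2 : w - 1 ≤ 2 * ρ ^ 2 := by
    have : w ≤ 1 + 2 * ρ ^ 2 := by
      rw [hw, inv_le_iff_one_le_mul₀ hs0]
      nlinarith [sq_nonneg ρ]
    linarith
  have hsq : gaussianPDFReal 0 1 u ^ 2 = (2 * Real.pi)⁻¹ * Real.exp (-u ^ 2) := by
    rw [gaussianPDFReal_std, mul_pow, inv_pow, Real.sq_sqrt (by positivity), ← Real.exp_nat_mul]
    congr 2
    push_cast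
    ring
  have hexp : |Real.exp (-u ^ 2 / (1 + ρ)) - Real.exp (-u ^ 2)| ≤ 2 * u ^ 2 * |ρ| := by
    refine (abs_exp_sub_exp_le (div_nonpos_of_nonpos_of_nonneg (by nlinarith [sq_nonneg u])
      (by linarith)) (by nlinarith [sq_nonneg u])).trans ?_
    have h1ρ : (1 / 2 : ℝ) ≤ 1 + ρ := by linarith
    have : -u ^ 2 / (1 + ρ) - -u ^ 2 = u ^ 2 * (ρ / (1 + ρ)) := by
      field_simp
      ring
    rw [this, abs_mul, abs_of_nonneg (sq_nonneg u), abs_div, abs_of_pos (by linarith : 0 < 1 + ρ)]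
    have h2 : |ρ| / (1 + ρ) ≤ 2 * |ρ| := by
      rw [div_le_iff₀ (by linarith)]
      nlinarith [abs_nonneg ρ]
    nlinarith [sq_nonneg u]
  have hpi0 : 0 < (2 * Real.pi)⁻¹ := by positivity
  have hpi1 : (2 * Real.pi)⁻¹ ≤ 1 := inv_le_one_of_one_le₀ (by linarith [Real.pi_gt_three])
  have he1 : Real.exp (-u ^ 2 / (1 + ρ)) ≤ 1 := by
    refine Real.exp_le_one_iff.mpr (div_nonpos_of_nonpos_of_nonneg ?_ ?_)
    · nlinarith [sq_nonneg u]
    · linarith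
  have he0 := Real.exp_nonneg (-u ^ 2 / (1 + ρ))
  have : diagDensity u ρ - gaussianPDFReal 0 1 u ^ 2 = (2 * Real.pi)⁻¹ *
      ((w - 1) * Real.exp (-u ^ 2 / (1 + ρ)) +
        (Real.exp (-u ^ 2 / (1 + ρ)) - Real.exp (-u ^ 2))) := by
    rw [hsq, diagDensity]
    ring
  rw [this, abs_mul, abs_of_pos hpi0]
  calc _ ≤ 1 * |(w - 1) * Real.exp (-u ^ 2 / (1 + ρ)) +
        (Real.exp (-u ^ 2 / (1 + ρ)) - Real.exp (-u ^ 2))| := by gcongr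
    _ ≤ |(w - 1) * Real.exp (-u ^ 2 / (1 + ρ))| +
        |Real.exp (-u ^ 2 / (1 + ρ)) - Real.exp (-u ^ 2)| := by
        rw [one_mul]; exact abs_add_le _ _
    _ ≤ _ := by
        refine add_le_add ?_ hexp
        rw [abs_of_nonneg (mul_nonneg hw1 he0), sq_abs]
        nlinarith

/-- The mean value inequality, by Plackett's formula and the bound on the density, on the interval
between `-|ρ|` and `|ρ|`. -/
theorem abs_jointTail_sub_le (u : ℝ) {ρ : ℝ} (hρ : |ρ| ≤ 1 / 2) :
    |jointTail u ρ - gaussianTail u ^ 2 - gaussianPDFReal 0 1 u ^ 2 * ρ| ≤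
      2 * |ρ| ^ 3 + 2 * u ^ 2 * |ρ| ^ 2 := by
  have h := (convex_Icc (-|ρ|) |ρ|).norm_image_sub_le_of_norm_hasDerivWithin_le
    (f := fun r => jointTail u r - gaussianPDFReal 0 1 u ^ 2 * r)
    (f' := fun r => diagDensity u r - gaussianPDFReal 0 1 u ^ 2)
    (C := 2 * |ρ| ^ 2 + 2 * u ^ 2 * |ρ|) (x := 0) (y := ρ)
    (fun r hr => by
      have hr' : |r| ≤ |ρ| := abs_le.mpr hr
      have h1 := hasDerivAt_jointTail u (ρ := r) (by linarith)
      have h2 := (hasDerivAt_id r).const_mul (gaussianPDFReal 0 1 u ^ 2)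
      rw [mul_one] at h2
      exact (h1.sub h2).hasDerivWithinAt)
    (fun r hr => by
      have hr' : |r| ≤ |ρ| := abs_le.mpr hr
      refine (abs_diagDensity_sub_le u (hr'.trans hρ)).trans ?_
      gcongr)
    ⟨by simp, by simp⟩ ⟨neg_abs_le ρ, le_abs_self ρ⟩
  rw [Real.norm_eq_abs, Real.norm_eq_abs, jointTail_zero] at h
  calc _ = |jointTail u ρ - gaussianPDFReal 0 1 u ^ 2 * ρ -
        (gaussianTail u ^ 2 - gaussianPDFReal 0 1 u ^ 2 * 0)| := by congr 1; ring
    _ ≤ _ := h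
    _ = _ := by rw [sub_zero]; ring

/-! ### Hermite residual of the exceedance indicator for a Gaussian pair. -/

section GaussianPair

variable {Ω : Type*} [MeasurableSpace Ω] {P : Measure Ω}

theorem integral_sub_mul_sub_mul {f g h : Ω → ℝ} (hf : Integrable f P) (hg : Integrable g P)
    (hh : Integrable h P) (a b : ℝ) :
    ∫ ω, (f ω - a * g ω - b * h ω) ∂P = ∫ ω, f ω ∂P - a * ∫ ω, g ω ∂P - b * ∫ ω, h ω ∂P := by
  rw [← integral_const_mul, ← integral_const_mul, ← integral_sub hf (hg.const_mul a),
    ← integral_sub (show Integrable (fun ω => f ω - a * g ω) P from hf.sub (hg.const_mul a))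
      (hh.const_mul b)]

/-- The indicator of the exceedance of `u`. -/
noncomputable def exceedance (u x : ℝ) : ℝ := (Set.Ici u).indicator (fun _ => (1 : ℝ)) x

theorem measurable_exceedance (u : ℝ) : Measurable (exceedance u) :=
  measurable_const.indicator measurableSet_Ici

theorem exceedance_nonneg (u x : ℝ) : 0 ≤ exceedance u x :=
  Set.indicator_nonneg (fun _ _ => zero_le_one) x

theorem exceedance_le_one (u x : ℝ) : exceedance u x ≤ 1 :=
  Set.indicator_le_self' (fun _ _ => zero_le_one) x

theorem abs_exceedance_le_one (u x : ℝ) : |exceedance u x| ≤ 1 :=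
  abs_le.mpr ⟨by linarith [exceedance_nonneg u x], exceedance_le_one u x⟩

theorem integral_exceedance_gaussianReal (u : ℝ) :
    ∫ x, exceedance u x ∂(gaussianReal 0 1) = gaussianTail u := by
  rw [gaussianTail, ← integral_indicator_one measurableSet_Ici]
  rfl

theorem integral_exceedance_mul_id_gaussianReal (u : ℝ) :
    ∫ x, exceedance u x * x ∂(gaussianReal 0 1) = gaussianPDFReal 0 1 u := by
  rw [integral_gaussianReal_std]
  have h : ∫ x, gaussianPDFReal 0 1 x * (exceedance u x * x) =
      ∫ x in Set.Ioi u, x * gaussianPDFReal 0 1 x := by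
    rw [← integral_Ici_eq_integral_Ioi, ← integral_indicator measurableSet_Ici]
    refine integral_congr_ae (Eventually.of_forall fun x => ?_)
    by_cases h : x ∈ Set.Ici u
    · simp [exceedance, h, mul_comm]
    · simp [exceedance, h]
  rw [h]
  have hftc := integral_Ioi_of_hasDerivAt_of_tendsto
    (f := fun x => -gaussianPDFReal 0 1 x) (f' := fun x => x * gaussianPDFReal 0 1 x)
    (a := u) (m := 0) continuous_gaussianPDFReal_std.neg.continuousWithinAt
    (fun x _ => (hasDerivAt_gaussianPDFReal_std x).neg.congr_deriv (by ring))
    ((integrable_gaussianPDFReal_mul_id.congr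
      (Eventually.of_forall fun x => mul_comm _ _)).integrableOn)
    (by simpa using tendsto_gaussianPDFReal_std_atTop.neg)
  rw [hftc]
  ring

theorem ProbabilityTheory.HasGaussianLaw.map_eq_std {X : Ω → ℝ} (hX : HasGaussianLaw X P)
    (h0 : ∫ ω, X ω ∂P = 0) (h1 : ∫ ω, X ω ^ 2 ∂P = 1) : P.map X = gaussianReal 0 1 := by
  rw [hX.map_eq_gaussianReal, h0, variance_of_integral_eq_zero hX.aemeasurable h0, h1]
  simp

/-- The regression residual is uncorrelated with `X`, and for jointly Gaussian variables this means
independence. -/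
theorem indepFun_linear_residual {X Y : Ω → ℝ} (hXY : HasGaussianLaw (fun ω => (X ω, Y ω)) P)
    (hX0 : ∫ ω, X ω ∂P = 0) (hX1 : ∫ ω, X ω ^ 2 ∂P = 1) (c : ℝ) :
    IndepFun X (fun ω => c * (Y ω - (∫ ω', X ω' * Y ω' ∂P) * X ω)) P := by
  have := hXY.isProbabilityMeasure
  set ρ := ∫ ω', X ω' * Y ω' ∂P with hρ
  have hX2 : MemLp X 2 P := hXY.fst.memLp_two
  have hY2 : MemLp Y 2 P := hXY.snd.memLp_two
  have hlaw : HasGaussianLaw (fun ω => (X ω, c * (Y ω - ρ * X ω))) P := by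
    have h := hXY.map_fun ((ContinuousLinearMap.fst ℝ ℝ ℝ).prod
      (c • (ContinuousLinearMap.snd ℝ ℝ ℝ - ρ • ContinuousLinearMap.fst ℝ ℝ ℝ)))
    simpa using h
  refine hlaw.indepFun_of_covariance_eq_zero ?_
  have hW2 : MemLp (fun ω => c * (Y ω - ρ * X ω)) 2 P := (hY2.sub (hX2.const_mul ρ)).const_mul c
  rw [covariance_eq_sub hX2 hW2, hX0, zero_mul, sub_zero]
  have : ∀ ω, (X * fun ω => c * (Y ω - ρ * X ω)) ω = c * (X ω * Y ω) - c * ρ * X ω ^ 2 :=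
    fun ω => by simp only [Pi.mul_apply]; ring
  simp_rw [this]
  have iXY : Integrable (fun ω => X ω * Y ω) P := hX2.integrable_mul hY2
  rw [integral_sub (iXY.const_mul c) (hX2.integrable_sq.const_mul _),
    integral_const_mul, integral_const_mul, hX1, ← hρ]
  ring

/-- In `Y = ρX + (Y - ρX)` the second summand is centered and independent of `X`, so only `ρ E[1{X ≥
u} X] = ρ φ(u)` survives. -/
theorem integral_exceedance_mul {X Y : Ω → ℝ} (hXY : HasGaussianLaw (fun ω => (X ω, Y ω)) P)
    (hX0 : ∫ ω, X ω ∂P = 0) (hX1 : ∫ ω, X ω ^ 2 ∂P = 1) (hY0 : ∫ ω, Y ω ∂P = 0)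
    (u : ℝ) :
    ∫ ω, exceedance u (X ω) * Y ω ∂P =
      (∫ ω, X ω * Y ω ∂P) * gaussianPDFReal 0 1 u := by
  have := hXY.isProbabilityMeasure
  set ρ := ∫ ω, X ω * Y ω ∂P with hρ
  have hX2 : MemLp X 2 P := hXY.fst.memLp_two
  have hY2 : MemLp Y 2 P := hXY.snd.memLp_two
  have hXm := hXY.fst.aemeasurable
  have hind := indepFun_linear_residual hXY hX0 hX1 1
  simp only [one_mul, ← hρ] at hind
  have hXi : Integrable X P := hXY.fst.integrable
  have hYi : Integrable Y P := hXY.snd.integrable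
  have hE : AEStronglyMeasurable (fun ω => exceedance u (X ω)) P :=
    ((measurable_exceedance u).comp_aemeasurable hXm).aestronglyMeasurable
  have hb : ∀ᵐ ω ∂P, ‖exceedance u (X ω)‖ ≤ 1 :=
    Eventually.of_forall fun ω => abs_exceedance_le_one _ _
  have h1 : Integrable (fun ω => exceedance u (X ω) * X ω) P := hXi.bdd_mul hE hb
  have hWi : Integrable (fun ω => Y ω - ρ * X ω) P := hYi.sub (hXi.const_mul ρ)
  have h2 : Integrable (fun ω => exceedance u (X ω) * (Y ω - ρ * X ω)) P := hWi.bdd_mul hE hb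
  have h3 : ∫ ω, exceedance u (X ω) * (Y ω - ρ * X ω) ∂P = 0 := by
    have hind' := hind.comp (measurable_exceedance u) measurable_id
    have := hind'.integral_fun_mul_eq_mul_integral hE hWi.aestronglyMeasurable
    simp only [Function.comp, id] at this
    rw [this, integral_sub hYi (hXi.const_mul ρ), integral_const_mul, hX0, hY0]
    ring
  have h4 : ∫ ω, exceedance u (X ω) * X ω ∂P = gaussianPDFReal 0 1 u := by
    rw [← integral_exceedance_mul_id_gaussianReal, ← hXY.fst.map_eq_std hX0 hX1,
      integral_map hXm]
    exact ((measurable_exceedance u).mul measurable_id).aestronglyMeasurable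
  have h5 : ∀ ω, exceedance u (X ω) * Y ω = exceedance u (X ω) * (Y ω - ρ * X ω) +
      ρ * (exceedance u (X ω) * X ω) := fun ω => by ring
  simp_rw [h5]
  rw [integral_add h2 (h1.const_mul ρ), h3, integral_const_mul, h4, zero_add]

/-- Write `Y = ρX + √(1 - ρ²) W` with `W` standard Gaussian and independent of `X`, and integrate
over `W` first. The strict bound on `ρ` is needed to divide by the root. -/
theorem integral_exceedance_mul_exceedance {X Y : Ω → ℝ} (hXY : HasGaussianLaw (fun ω => (X ω, Y ω)) P)
    (hX0 : ∫ ω, X ω ∂P = 0) (hX1 : ∫ ω, X ω ^ 2 ∂P = 1) (hY0 : ∫ ω, Y ω ∂P = 0)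
    (hY1 : ∫ ω, Y ω ^ 2 ∂P = 1) (u : ℝ)
    (hρ : |∫ ω, X ω * Y ω ∂P| < 1) :
    ∫ ω, exceedance u (X ω) * exceedance u (Y ω) ∂P =
      jointTail u (∫ ω, X ω * Y ω ∂P) := by
  have := hXY.isProbabilityMeasure
  set ρ := ∫ ω, X ω * Y ω ∂P with hρd
  have hsq : 0 < 1 - ρ ^ 2 := by
    have := (sq_lt_one_iff_abs_lt_one ρ).mpr hρ
    linarith
  have hs0 : 0 < √(1 - ρ ^ 2) := Real.sqrt_pos.mpr hsq
  have hs2 : √(1 - ρ ^ 2) ^ 2 = 1 - ρ ^ 2 := Real.sq_sqrt hsq.le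
  set W : Ω → ℝ := fun ω => (√(1 - ρ ^ 2))⁻¹ * (Y ω - ρ * X ω) with hW
  have hX2 : MemLp X 2 P := hXY.fst.memLp_two
  have hY2 : MemLp Y 2 P := hXY.snd.memLp_two
  have hXi : Integrable X P := hXY.fst.integrable
  have hYi : Integrable Y P := hXY.snd.integrable
  have hXm := hXY.fst.aemeasurable
  have hind : IndepFun X W P := indepFun_linear_residual hXY hX0 hX1 _
  have hWlaw : HasGaussianLaw W P := by
    have h := hXY.map_fun ((√(1 - ρ ^ 2))⁻¹ •
      (ContinuousLinearMap.snd ℝ ℝ ℝ - ρ • ContinuousLinearMap.fst ℝ ℝ ℝ))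
    simpa using h
  have hW0 : ∫ ω, W ω ∂P = 0 := by
    rw [hW, integral_const_mul, integral_sub hYi (hXi.const_mul ρ), integral_const_mul, hX0, hY0]
    ring
  have hW1 : ∫ ω, W ω ^ 2 ∂P = 1 := by
    have h5 : ∀ ω, W ω ^ 2 = (1 - ρ ^ 2)⁻¹ *
        (Y ω ^ 2 - 2 * ρ * (X ω * Y ω) - (-ρ ^ 2) * X ω ^ 2) := fun ω => by
      simp only [hW, mul_pow, inv_pow, hs2]
      ring
    simp_rw [h5]
    have iXY : Integrable (fun ω => X ω * Y ω) P := hX2.integrable_mul hY2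
    rw [integral_const_mul, integral_sub_mul_sub_mul hY2.integrable_sq iXY hX2.integrable_sq,
      hX1, hY1, ← hρd]
    field_simp
    ring
  have hmapX := hXY.fst.map_eq_std hX0 hX1
  have hmapW := hWlaw.map_eq_std hW0 hW1
  have hWm := hWlaw.aemeasurable
  have hmap : P.map (fun ω => (X ω, W ω)) = (gaussianReal 0 1).prod (gaussianReal 0 1) := by
    rw [(indepFun_iff_map_prod_eq_prod_map_map hXm hWm).mp hind, hmapX, hmapW]
  set f : ℝ × ℝ → ℝ := fun p =>
    exceedance u p.1 * exceedance u (ρ * p.1 + √(1 - ρ ^ 2) * p.2) with hf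
  have hfm : Measurable f := by
    have h1 := measurable_exceedance u
    fun_prop
  have hYW : ∀ ω, Y ω = ρ * X ω + √(1 - ρ ^ 2) * W ω := fun ω => by
    simp only [hW]
    rw [mul_inv_cancel_left₀ hs0.ne']
    ring
  have h6 : ∫ ω, exceedance u (X ω) * exceedance u (Y ω) ∂P = ∫ ω, f (X ω, W ω) ∂P := by
    refine integral_congr_ae (Eventually.of_forall fun ω => ?_)
    simp only [hf, ← hYW]
  have hbound : ∀ p, ‖f p‖ ≤ 1 := fun p => by
    simp only [hf, norm_mul]
    exact mul_le_one₀ (abs_exceedance_le_one _ _) (norm_nonneg _) (abs_exceedance_le_one _ _)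
  rw [h6, ← integral_map (hXm.prodMk hWm) hfm.aestronglyMeasurable, hmap, integral_prod]
  swap
  · exact Integrable.of_bound hfm.aestronglyMeasurable 1 (Eventually.of_forall hbound)
  have h7 : ∀ x, ∫ w, f (x, w) ∂(gaussianReal 0 1) =
      exceedance u x * gaussianTail ((u - ρ * x) / √(1 - ρ ^ 2)) := by
    intro x
    simp only [hf]
    rw [integral_const_mul, ← integral_exceedance_gaussianReal]
    congr 2
    funext w
    simp only [exceedance, Set.indicator, Set.mem_Ici]
    have : (u ≤ ρ * x + √(1 - ρ ^ 2) * w) ↔ (u - ρ * x) / √(1 - ρ ^ 2) ≤ w := by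
      rw [div_le_iff₀ hs0]
      constructor <;> intro h <;> nlinarith
    simp [this]
  simp_rw [h7]
  rw [integral_gaussianReal_std, jointTail, ← integral_Ici_eq_integral_Ioi,
    ← integral_indicator measurableSet_Ici]
  refine integral_congr_ae (Eventually.of_forall fun x => ?_)
  by_cases h : x ∈ Set.Ici u <;> simp [exceedance, h]

/-- The exceedance indicator without its first two Hermite components. -/
noncomputable def exceedanceResidual (u x : ℝ) : ℝ :=
  exceedance u x - gaussianTail u - gaussianPDFReal 0 1 u * x

theorem measurable_exceedanceResidual (u : ℝ) : Measurable (exceedanceResidual u) :=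
  ((measurable_exceedance u).sub measurable_const).sub (measurable_id.const_mul _)

theorem integral_exceedance_comp {X : Ω → ℝ} (hX : HasGaussianLaw X P)
    (hX0 : ∫ ω, X ω ∂P = 0) (hX1 : ∫ ω, X ω ^ 2 ∂P = 1) (u : ℝ) :
    ∫ ω, exceedance u (X ω) ∂P = gaussianTail u := by
  rw [← integral_exceedance_gaussianReal, ← hX.map_eq_std hX0 hX1, integral_map hX.aemeasurable]
  exact (measurable_exceedance u).aestronglyMeasurable

/-- The subtracted term `φ(u) X` has the same covariance with `Y` as the indicator has. This makes
the linear and residual parts of the area functional orthogonal. -/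
theorem integral_exceedanceResidual_mul {X Y : Ω → ℝ} (hXY : HasGaussianLaw (fun ω => (X ω, Y ω)) P)
    (hX0 : ∫ ω, X ω ∂P = 0) (hX1 : ∫ ω, X ω ^ 2 ∂P = 1) (hY0 : ∫ ω, Y ω ∂P = 0)
    (u : ℝ) :
    ∫ ω, exceedanceResidual u (X ω) * Y ω ∂P = 0 := by
  have := hXY.isProbabilityMeasure
  have hX2 : MemLp X 2 P := hXY.fst.memLp_two
  have hY2 : MemLp Y 2 P := hXY.snd.memLp_two
  have hYi : Integrable Y P := hXY.snd.integrable
  have hE : AEStronglyMeasurable (fun ω => exceedance u (X ω)) P :=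
    ((measurable_exceedance u).comp_aemeasurable hXY.fst.aemeasurable).aestronglyMeasurable
  have h1 : Integrable (fun ω => exceedance u (X ω) * Y ω) P :=
    hYi.bdd_mul hE (Eventually.of_forall fun ω => abs_exceedance_le_one _ _)
  have h2 : ∀ ω, exceedanceResidual u (X ω) * Y ω = exceedance u (X ω) * Y ω -
      gaussianTail u * Y ω - gaussianPDFReal 0 1 u * (X ω * Y ω) := fun ω => by
    rw [exceedanceResidual]
    ring
  simp_rw [h2]
  have iXY : Integrable (fun ω => X ω * Y ω) P := hX2.integrable_mul hY2
  rw [integral_sub_mul_sub_mul h1 hYi iXY, hY0,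
    integral_exceedance_mul hXY hX0 hX1 hY0]
  ring

theorem abs_integral_exceedanceResidual_mul_le {X Y : Ω → ℝ} (hXY : HasGaussianLaw (fun ω => (X ω, Y ω)) P)
    (hX0 : ∫ ω, X ω ∂P = 0) (hX1 : ∫ ω, X ω ^ 2 ∂P = 1) (hY0 : ∫ ω, Y ω ∂P = 0)
    (hY1 : ∫ ω, Y ω ^ 2 ∂P = 1) (u : ℝ)
    (hρ : |∫ ω, X ω * Y ω ∂P| ≤ 1) :
    |∫ ω, exceedanceResidual u (X ω) * exceedanceResidual u (Y ω) ∂P| ≤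
      16 * |∫ ω, X ω * Y ω ∂P| ^ 3 + 2 * u ^ 2 * |∫ ω, X ω * Y ω ∂P| ^ 2 := by
  have := hXY.isProbabilityMeasure
  have hX2 : MemLp X 2 P := hXY.fst.memLp_two
  have hY2 : MemLp Y 2 P := hXY.snd.memLp_two
  have hXi : Integrable X P := hXY.fst.integrable
  have hYi : Integrable Y P := hXY.snd.integrable
  have hEX : AEStronglyMeasurable (fun ω => exceedance u (X ω)) P :=
    ((measurable_exceedance u).comp_aemeasurable hXY.fst.aemeasurable).aestronglyMeasurable
  have hEY : AEStronglyMeasurable (fun ω => exceedance u (Y ω)) P :=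
    ((measurable_exceedance u).comp_aemeasurable hXY.snd.aemeasurable).aestronglyMeasurable
  have hbX : ∀ᵐ ω ∂P, ‖exceedance u (X ω)‖ ≤ 1 :=
    Eventually.of_forall fun ω => abs_exceedance_le_one _ _
  have hbY : ∀ᵐ ω ∂P, ‖exceedance u (Y ω)‖ ≤ 1 :=
    Eventually.of_forall fun ω => abs_exceedance_le_one _ _
  have iX : Integrable (fun ω => exceedance u (X ω)) P := Integrable.of_bound hEX 1 hbX
  have iY : Integrable (fun ω => exceedance u (Y ω)) P := Integrable.of_bound hEY 1 hbY
  have iXY : Integrable (fun ω => exceedance u (X ω) * exceedance u (Y ω)) P :=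
    iY.bdd_mul hEX hbX
  have hRX : Integrable (fun ω => exceedanceResidual u (X ω)) P :=
    (iX.sub (integrable_const _)).sub (hXi.const_mul _)
  have hRXE : Integrable (fun ω => exceedanceResidual u (X ω) * exceedance u (Y ω)) P :=
    (hRX.bdd_mul hEY hbY).congr (Eventually.of_forall fun ω => mul_comm _ _)
  have hRX2 : MemLp (fun ω => exceedanceResidual u (X ω)) 2 P := by
    refine ((MemLp.of_bound (p := 2) hEX 1 hbX).sub (memLp_const _)).sub (hX2.const_mul _)
  have iRXY : Integrable (fun ω => exceedanceResidual u (X ω) * Y ω) P := hRX2.integrable_mul hY2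
  have hRX0 : ∫ ω, exceedanceResidual u (X ω) ∂P = 0 := by
    have h := integral_sub_mul_sub_mul iX (integrable_const (1 : ℝ)) hXi (gaussianTail u)
      (gaussianPDFReal 0 1 u)
    rw [hX0, integral_exceedance_comp hXY.fst hX0 hX1] at h
    simpa [exceedanceResidual] using h
  set ρ := ∫ ω, X ω * Y ω ∂P with hρd
  have hYX : ∫ ω, exceedance u (Y ω) * X ω ∂P = ρ * gaussianPDFReal 0 1 u := by
    have hswap : HasGaussianLaw (fun ω => (Y ω, X ω)) P := by
      simpa using hXY.map_fun ((ContinuousLinearMap.snd ℝ ℝ ℝ).prod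
        (ContinuousLinearMap.fst ℝ ℝ ℝ))
    rw [integral_exceedance_mul hswap hY0 hY1 hX0, hρd]
    simp_rw [mul_comm (Y _)]
  have h1 : ∫ ω, exceedanceResidual u (X ω) * exceedanceResidual u (Y ω) ∂P =
      ∫ ω, exceedanceResidual u (X ω) * exceedance u (Y ω) ∂P := by
    have h2 : ∀ ω, exceedanceResidual u (X ω) * exceedanceResidual u (Y ω) =
        exceedanceResidual u (X ω) * exceedance u (Y ω) -
          gaussianTail u * exceedanceResidual u (X ω) -
          gaussianPDFReal 0 1 u * (exceedanceResidual u (X ω) * Y ω) := fun ω => by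
      conv_lhs => rw [exceedanceResidual.eq_1 u (Y ω)]
      ring
    simp_rw [h2]
    rw [integral_sub_mul_sub_mul hRXE hRX iRXY, hRX0,
      integral_exceedanceResidual_mul hXY hX0 hX1 hY0]
    ring
  have h3 : ∫ ω, exceedanceResidual u (X ω) * exceedance u (Y ω) ∂P =
      (∫ ω, exceedance u (X ω) * exceedance u (Y ω) ∂P) - gaussianTail u ^ 2 -
        gaussianPDFReal 0 1 u ^ 2 * ρ := by
    have h2 : ∀ ω, exceedanceResidual u (X ω) * exceedance u (Y ω) =
        exceedance u (X ω) * exceedance u (Y ω) - gaussianTail u * exceedance u (Y ω) -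
          gaussianPDFReal 0 1 u * (exceedance u (Y ω) * X ω) := fun ω => by
      rw [exceedanceResidual]
      ring
    have iYX : Integrable (fun ω => exceedance u (Y ω) * X ω) P := hXi.bdd_mul hEY hbY
    simp_rw [h2]
    rw [integral_sub_mul_sub_mul iXY iY iYX, hYX,
      integral_exceedance_comp hXY.snd hY0 hY1]
    ring
  rw [h1, h3]
  -- For `|ρ| > 1 / 2` no expansion is needed: the quantity is trivially at most `2 = 16 · (1 / 2)³`
  -- in absolute value, whence the constant `16`.
  rcases le_or_gt |ρ| (1 / 2) with hle | hgt
  · rw [integral_exceedance_mul_exceedance hXY hX0 hX1 hY0 hY1 u (by linarith), ← hρd]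
    refine (abs_jointTail_sub_le u hle).trans ?_
    have := pow_nonneg (abs_nonneg ρ) 3
    linarith
  · have h4 : 0 ≤ ∫ ω, exceedance u (X ω) * exceedance u (Y ω) ∂P :=
      integral_nonneg fun ω => mul_nonneg (exceedance_nonneg _ _) (exceedance_nonneg _ _)
    have h5 : ∫ ω, exceedance u (X ω) * exceedance u (Y ω) ∂P ≤ 1 := by
      calc _ ≤ ∫ ω, (1 : ℝ) ∂P := integral_mono iXY (integrable_const _) fun ω =>
            mul_le_one₀ (exceedance_le_one _ _) (exceedance_nonneg _ _) (exceedance_le_one _ _)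
        _ = 1 := by simp
    have h6 : gaussianTail u ^ 2 ≤ 1 := pow_le_one₀ (gaussianTail_nonneg u) (gaussianTail_le_one u)
    have h7 : |gaussianPDFReal 0 1 u ^ 2 * ρ| ≤ 1 := by
      rw [abs_mul, abs_of_nonneg (sq_nonneg _)]
      exact mul_le_one₀ (pow_le_one₀ (gaussianPDFReal_std_nonneg u) (gaussianPDFReal_std_le_one u))
        (abs_nonneg _) hρ
    have h8 : (1 / 2 : ℝ) ^ 3 ≤ |ρ| ^ 3 := pow_le_pow_left₀ (by norm_num) hgt.le 3
    have h9 : 0 ≤ 2 * u ^ 2 * |ρ| ^ 2 := by positivity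
    have h10 := abs_le.mp h7
    have h11 := sq_nonneg (gaussianTail u)
    rw [abs_le]
    constructor <;> linarith

end GaussianPair

/-! ### Fubini for integrals of random fields with bounded second moments. -/

section RandomFields

variable {Ω A B : Type*} [MeasurableSpace Ω] [MeasurableSpace A] [MeasurableSpace B]
  {P : Measure Ω}

/-- A jointly measurable random field whose second moments are at most `C`. -/
structure IsBoundedSecondMomentField (P : Measure Ω) (f : A → Ω → ℝ) (C : ℝ) : Prop where
  measurable : Measurable fun p : Ω × A => f p.2 p.1
  memLp : ∀ a, MemLp (f a) 2 P
  integral_sq_le : ∀ a, ∫ ω, f a ω ^ 2 ∂P ≤ C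

theorem integrable_prod_of_integral_abs_le [IsProbabilityMeasure P] {ν : Measure B} [IsFiniteMeasure ν] {h : Ω × B → ℝ}
    (hm : Measurable h) (hi : ∀ b, Integrable (fun ω => h (ω, b)) P) {C : ℝ}
    (hC : ∀ b, ∫ ω, |h (ω, b)| ∂P ≤ C) : Integrable h (P.prod ν) := by
  rw [integrable_prod_iff' hm.aestronglyMeasurable]
  refine ⟨Eventually.of_forall hi, ?_⟩
  refine Integrable.of_bound (C := C) ?_ (Eventually.of_forall fun b => ?_)
  · exact (hm.norm.aestronglyMeasurable (μ := P.prod ν)).prod_swap.integral_prod_right'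
  · rw [Real.norm_eq_abs, abs_of_nonneg (integral_nonneg fun ω => norm_nonneg _)]
    exact hC b

theorem integral_abs_mul_le {X Y : Ω → ℝ} (hX : MemLp X 2 P) (hY : MemLp Y 2 P) :
    ∫ ω, |X ω * Y ω| ∂P ≤ (∫ ω, X ω ^ 2 ∂P + ∫ ω, Y ω ^ 2 ∂P) / 2 := by
  have h1 : Integrable (fun ω => X ω * Y ω) P := hX.integrable_mul hY
  rw [← integral_add hX.integrable_sq hY.integrable_sq, ← integral_div]
  refine integral_mono h1.abs ((hX.integrable_sq.add hY.integrable_sq).div_const 2) fun ω => ?_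
  simp only [abs_mul]
  have := two_mul_le_add_sq |X ω| |Y ω|
  rw [sq_abs, sq_abs] at this
  linarith

namespace IsBoundedSecondMomentField

variable {f g : A → Ω → ℝ} {C D : ℝ} (μ : Measure A) [IsFiniteMeasure μ]

theorem measurable_integral (hf : IsBoundedSecondMomentField P f C) :
    Measurable fun ω => ∫ a, f a ω ∂μ :=
  (hf.measurable.stronglyMeasurable.integral_prod_right' (ν := μ)).measurable

variable [IsProbabilityMeasure P]

theorem integrable_mul_const_prod {V : Ω → ℝ} (hf : IsBoundedSecondMomentField P f C)
    (hVm : Measurable V) (hV : MemLp V 2 P) :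
    Integrable (fun p : Ω × A => f p.2 p.1 * V p.1) (P.prod μ) := by
  refine integrable_prod_of_integral_abs_le (hf.measurable.mul (hVm.comp measurable_fst))
    (fun a => (hf.memLp a).integrable_mul hV) (C := (C + ∫ ω, V ω ^ 2 ∂P) / 2) fun a => ?_
  refine (integral_abs_mul_le (hf.memLp a) hV).trans ?_
  have := hf.integral_sq_le a
  linarith

theorem integral_integral_mul {V : Ω → ℝ} (hf : IsBoundedSecondMomentField P f C)
    (hVm : Measurable V) (hV : MemLp V 2 P) :
    ∫ ω, (∫ a, f a ω ∂μ) * V ω ∂P = ∫ a, ∫ ω, f a ω * V ω ∂P ∂μ := by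
  rw [← integral_integral_swap (f := fun ω a => f a ω * V ω)
    (hf.integrable_mul_const_prod μ hVm hV)]
  simp_rw [integral_mul_const]

theorem integrable_mul_prod (hf : IsBoundedSecondMomentField P f C)
    (hg : IsBoundedSecondMomentField P g D) :
    Integrable (fun q : Ω × A × A => f q.2.1 q.1 * g q.2.2 q.1) (P.prod (μ.prod μ)) := by
  have hm1 := hf.measurable.comp
    (measurable_fst.prodMk (measurable_fst.comp measurable_snd) : Measurable
      fun q : Ω × A × A => (q.1, q.2.1))
  have hm2 := hg.measurable.comp
    (measurable_fst.prodMk (measurable_snd.comp measurable_snd) : Measurable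
      fun q : Ω × A × A => (q.1, q.2.2))
  refine integrable_prod_of_integral_abs_le (hm1.mul hm2)
    (fun p => (hf.memLp p.1).integrable_mul (hg.memLp p.2)) (C := (C + D) / 2) fun p => ?_
  refine (integral_abs_mul_le (hf.memLp p.1) (hg.memLp p.2)).trans ?_
  have := hf.integral_sq_le p.1
  have := hg.integral_sq_le p.2
  linarith

/-- The mixed moment of two integrated fields is the double integral of the mixed moments. -/
theorem integral_integral_mul_integral (hf : IsBoundedSecondMomentField P f C)
    (hg : IsBoundedSecondMomentField P g D) :
    ∫ ω, (∫ a, f a ω ∂μ) * (∫ a, g a ω ∂μ) ∂P =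
      ∫ p, ∫ ω, f p.1 ω * g p.2 ω ∂P ∂(μ.prod μ) := by
  rw [← integral_integral_swap (f := fun ω (p : A × A) => f p.1 ω * g p.2 ω)
    (hf.integrable_mul_prod μ hg)]
  refine integral_congr_ae (Eventually.of_forall fun ω => ?_)
  exact (integral_prod_mul (fun a => f a ω) (fun a => g a ω)).symm

theorem memLp_integral (hf : IsBoundedSecondMomentField P f C) :
    MemLp (fun ω => ∫ a, f a ω ∂μ) 2 P := by
  rw [memLp_two_iff_integrable_sq (hf.measurable_integral μ).aestronglyMeasurable]
  have h := (hf.integrable_mul_prod μ hf).integral_prod_left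
  refine h.congr (Eventually.of_forall fun ω => ?_)
  exact (integral_prod_mul (fun a => f a ω) (fun a => f a ω)).trans (pow_two _).symm

theorem integral_integral (hf : IsBoundedSecondMomentField P f C) :
    ∫ ω, ∫ a, f a ω ∂μ ∂P = ∫ a, ∫ ω, f a ω ∂P ∂μ := by
  have := hf.integral_integral_mul μ (V := fun _ => 1) measurable_const (memLp_const 1)
  simpa using this

theorem ae_integrable (hf : IsBoundedSecondMomentField P f C) :
    ∀ᵐ ω ∂P, Integrable (fun a => f a ω) μ := by
  have h := hf.integrable_mul_const_prod μ (V := fun _ => 1) measurable_const (memLp_const 1)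
  filter_upwards [h.prod_right_ae] with ω hω
  simpa using hω

end IsBoundedSecondMomentField

end RandomFields

/-! ### Gaussianity of variables in the closed linear span of a Gaussian process. -/

section GaussianClosure

variable {Ω T : Type*} [MeasurableSpace Ω] {P : Measure Ω} [IsProbabilityMeasure P]

/-- Convergence in `L²` implies convergence in law as well as of the second moments, so the
characteristic functions converge to that of the Gaussian law with the limiting variance. -/
theorem map_eq_gaussianReal_of_tendsto_Lp {v : ℕ → Lp ℝ 2 P} {L : Lp ℝ 2 P}
    (hv : Tendsto v atTop (𝓝 L))
    (hlaw : ∀ n, P.map (v n) = gaussianReal 0 (∫ ω, (v n) ω ^ 2 ∂P).toNNReal) :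
    P.map L = gaussianReal 0 (∫ ω, L ω ^ 2 ∂P).toNNReal := by
  have hm : TendstoInMeasure P (fun n => (v n : Ω → ℝ)) atTop L := tendstoInMeasure_of_tendsto_Lp hv
  have hd := (hm.tendstoInDistribution fun n => (Lp.aestronglyMeasurable (v n)).aemeasurable).tendsto
  have hprob : IsProbabilityMeasure (P.map L) :=
    Measure.isProbabilityMeasure_map (Lp.aestronglyMeasurable L).aemeasurable
  refine Measure.ext_of_charFun (funext fun t => ?_)
  have h1 := ProbabilityMeasure.tendsto_iff_tendsto_charFun.mp hd t
  have hsq : ∀ w : Lp ℝ 2 P, ∫ ω, w ω ^ 2 ∂P = ‖w‖ ^ 2 := fun w => by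
    rw [← real_inner_self_eq_norm_sq, L2.inner_def]
    simp [pow_two]
  have h2 : Tendsto (fun n => charFun (gaussianReal 0 (∫ ω, (v n) ω ^ 2 ∂P).toNNReal) t) atTop
      (𝓝 (charFun (gaussianReal 0 (∫ ω, L ω ^ 2 ∂P).toNNReal) t)) := by
    simp only [charFun_gaussianReal, hsq]
    have h3 : Tendsto (fun n => ((‖v n‖ ^ 2).toNNReal : ℝ)) atTop (𝓝 ((‖L‖ ^ 2).toNNReal : ℝ)) := by
      simp only [Real.coe_toNNReal _ (sq_nonneg _)]
      exact hv.norm.pow 2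
    have h4 : Tendsto (fun n => (((‖v n‖ ^ 2).toNNReal : ℝ) : ℂ)) atTop
        (𝓝 (((‖L‖ ^ 2).toNNReal : ℝ) : ℂ)) := (Complex.continuous_ofReal.tendsto _).comp h3
    exact (Complex.continuous_exp.tendsto _).comp ((h4.mul_const _).div_const _ |>.const_sub _)
  refine tendsto_nhds_unique h1 (h2.congr fun n => ?_)
  rw [← hlaw n]
  rfl

/-- A square integrable variable is Gaussian if it is orthogonal to all that is orthogonal to a
given centered Gaussian process. -/
theorem map_eq_gaussianReal_of_orthogonal {Z : T → Ω → ℝ} (hZ : IsGaussianProcess Z P)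
    (hZ0 : ∀ t, ∫ ω, Z t ω ∂P = 0) {L : Ω → ℝ} (hL : MemLp L 2 P)
    (horth : ∀ V : Ω → ℝ, Measurable V → MemLp V 2 P → (∀ t, ∫ ω, Z t ω * V ω ∂P = 0) →
      ∫ ω, L ω * V ω ∂P = 0) :
    P.map L = gaussianReal 0 (∫ ω, L ω ^ 2 ∂P).toNNReal := by
  have hZ2 : ∀ t, MemLp (Z t) 2 P := fun t => (hZ.hasGaussianLaw_eval t).memLp_two
  set z : T → Lp ℝ 2 P := fun t => (hZ2 t).toLp (Z t) with hz
  set K : Submodule ℝ (Lp ℝ 2 P) := Submodule.span ℝ (Set.range z) with hK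
  have hspan : ∀ w ∈ K, P.map w = gaussianReal 0 (∫ ω, w ω ^ 2 ∂P).toNNReal := by
    intro w hw
    obtain ⟨c, rfl⟩ := Finsupp.mem_span_range_iff_exists_finsupp.mp hw
    have hae : ((c.sum fun i a => a • z i : Lp ℝ 2 P) : Ω → ℝ) =ᵐ[P]
        fun ω => ∑ i ∈ c.support, c i * Z i ω := by
      rw [Finsupp.sum]
      refine (Lp.coeFn_finsetSum _ _).trans ?_
      have h1 : ∀ᵐ ω ∂P, ∀ i ∈ c.support, (c i • z i : Lp ℝ 2 P) ω = c i * Z i ω := by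
        rw [Filter.eventually_all_finset]
        intro i _
        filter_upwards [Lp.coeFn_smul (c i) (z i), (hZ2 i).coeFn_toLp] with ω h2 h3
        rw [h2, Pi.smul_apply, hz, h3, smul_eq_mul]
      filter_upwards [h1] with ω hω
      rw [Finset.sum_apply]
      exact Finset.sum_congr rfl hω
    have hG : HasGaussianLaw (fun ω => ∑ i ∈ c.support, c i * Z i ω) P := by
      have h2 := (hZ.hasGaussianLaw c.support).map_fun
        (∑ i : c.support, c i • ContinuousLinearMap.proj (R := ℝ) (φ := fun _ : c.support => ℝ) i)
      refine h2.congr (Eventually.of_forall fun ω => ?_)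
      simp only [sum_apply, smul_apply,
        ContinuousLinearMap.proj_apply, Finset.restrict, smul_eq_mul]
      exact Finset.sum_coe_sort c.support fun i => c i * Z i ω
    have h0 : ∫ ω, ∑ i ∈ c.support, c i * Z i ω ∂P = 0 := by
      rw [integral_finsetSum _ fun i _ => ((hZ.hasGaussianLaw_eval i).integrable).const_mul _]
      refine Finset.sum_eq_zero fun i _ => ?_
      rw [integral_const_mul, hZ0, mul_zero]
    rw [Measure.map_congr hae, hG.map_eq_gaussianReal, h0,
      variance_of_integral_eq_zero hG.aemeasurable h0]
    congr 2
    exact integral_congr_ae (hae.mono fun ω hω => by simp only [hω])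
  -- The hypothesis says that `L` lies in the double orthogonal complement of the span, which in a
  -- Hilbert space is its closure.
  have hmem : hL.toLp L ∈ K.topologicalClosure := by
    rw [← Submodule.orthogonal_orthogonal_eq_closure, Submodule.mem_orthogonal]
    intro V hV
    rw [Submodule.mem_orthogonal] at hV
    obtain ⟨V', hV'm, hVV'⟩ := Lp.aestronglyMeasurable V
    have hV'2 : MemLp V' 2 P := (Lp.memLp V).ae_eq hVV'
    have h1 := horth V' hV'm.measurable hV'2 fun t => by
      have h2 := hV (z t) (Submodule.subset_span ⟨t, rfl⟩)
      rw [L2.inner_def] at h2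
      rw [← h2]
      refine integral_congr_ae ?_
      filter_upwards [hVV', (hZ2 t).coeFn_toLp] with ω h3 h4
      simp [hz, h4, h3, mul_comm]
    rw [L2.inner_def, ← h1]
    refine integral_congr_ae ?_
    filter_upwards [hVV', hL.coeFn_toLp] with ω h3 h4
    simp [h4, h3]
  obtain ⟨v, hvK, hv⟩ := mem_closure_iff_seq_limit.mp hmem
  have h := map_eq_gaussianReal_of_tendsto_Lp hv fun n => hspan _ (hvK n)
  rw [Measure.map_congr hL.coeFn_toLp] at h
  rw [h]
  congr 2
  exact integral_congr_ae (hL.coeFn_toLp.mono fun ω hω => by simp only [hω])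

end GaussianClosure

/-! ### Karamata's theorem and double integrals of regularly varying covariances. -/

section RegularVariation

/-- Karamata's theorem for the integral of a function equivalent to a power. -/
theorem tendsto_integral_div_rpow {f : ℝ → ℝ} {γ κ : ℝ} (hγ : -1 < γ)
    (hf : ∀ a b, IntervalIntegrable f volume a b)
    (hlim : Tendsto (fun x => f x / x ^ γ) atTop (𝓝 κ)) :
    Tendsto (fun T => (∫ x in (0 : ℝ)..T, f x) / T ^ (γ + 1)) atTop (𝓝 (κ / (γ + 1))) := by
  have hγ1 : 0 < γ + 1 := by linarith
  have hpow : ∀ a b, IntervalIntegrable (fun x : ℝ => x ^ γ) volume a b := fun a b =>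
    intervalIntegral.intervalIntegrable_rpow' hγ
  have hd : ∀ a b, IntervalIntegrable (fun x => f x - κ * x ^ γ) volume a b := fun a b =>
    (hf a b).sub ((hpow a b).const_mul κ)
  have hsmall : ∀ ε > 0, ∀ᶠ x in atTop, |f x - κ * x ^ γ| ≤ ε * x ^ γ := by
    intro ε hε
    filter_upwards [(Metric.tendsto_nhds.mp hlim) ε hε, eventually_gt_atTop 0] with x hx hx0
    have hp : 0 < x ^ γ := Real.rpow_pos_of_pos hx0 γ
    rw [Real.dist_eq] at hx
    have h1 : f x - κ * x ^ γ = (f x / x ^ γ - κ) * x ^ γ := by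
      field_simp
    rw [h1, abs_mul, abs_of_pos hp]
    exact mul_le_mul_of_nonneg_right hx.le hp.le
  have hTinf : Tendsto (fun T : ℝ => T ^ (γ + 1)) atTop atTop := tendsto_rpow_atTop hγ1
  -- The integral is split at a fixed `N` beyond which the difference is a small multiple of the
  -- power. The first piece is a constant against `T^(γ + 1) → ∞`; this is where `γ > -1` enters.
  have hzero : Tendsto (fun T => (∫ x in (0 : ℝ)..T, (f x - κ * x ^ γ)) / T ^ (γ + 1)) atTop
      (𝓝 0) := by
    rw [Metric.tendsto_nhds]
    intro ε hε
    obtain ⟨M, hM⟩ := eventually_atTop.mp (hsmall (ε * (γ + 1) / 2) (by positivity))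
    set N := max M 1 with hN
    have hconst : Tendsto (fun T : ℝ => |∫ x in (0 : ℝ)..N, (f x - κ * x ^ γ)| / T ^ (γ + 1)) atTop
        (𝓝 0) := tendsto_const_nhds.div_atTop hTinf
    filter_upwards [(Metric.tendsto_nhds.mp hconst) (ε / 2) (by positivity),
      eventually_ge_atTop N] with T h1 hT
    have hN0 : 0 < N := lt_of_lt_of_le one_pos (le_max_right _ _)
    have hT0 : 0 < T := hN0.trans_le hT
    have hTp : 0 < T ^ (γ + 1) := Real.rpow_pos_of_pos hT0 _
    rw [Real.dist_eq, sub_zero, abs_of_nonneg (by positivity)] at h1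
    rw [Real.dist_eq, sub_zero, ← intervalIntegral.integral_add_adjacent_intervals (hd 0 N) (hd N T),
      abs_div, abs_of_pos hTp]
    have h2 : |∫ x in N..T, (f x - κ * x ^ γ)| ≤ ε / 2 * T ^ (γ + 1) := by
      calc |∫ x in N..T, (f x - κ * x ^ γ)|
          ≤ ∫ x in N..T, ε * (γ + 1) / 2 * x ^ γ :=
            (Real.norm_eq_abs _).symm.trans_le <| intervalIntegral.norm_integral_le_of_norm_le hT
              (Eventually.of_forall fun x hx => hM x ((le_max_left _ _).trans hx.1.le))
              ((hpow N T).const_mul _)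
        _ = ε * (γ + 1) / 2 * ((T ^ (γ + 1) - N ^ (γ + 1)) / (γ + 1)) := by
            rw [intervalIntegral.integral_const_mul, integral_rpow (Or.inl hγ)]
        _ = ε / 2 * (T ^ (γ + 1) - N ^ (γ + 1)) := by field_simp
        _ ≤ ε / 2 * T ^ (γ + 1) := by
            have := Real.rpow_pos_of_pos hN0 (γ + 1)
            nlinarith
    calc _ ≤ (|∫ x in (0 : ℝ)..N, (f x - κ * x ^ γ)| + |∫ x in N..T, (f x - κ * x ^ γ)|) /
          T ^ (γ + 1) := by gcongr; exact abs_add_le _ _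
      _ = |∫ x in (0 : ℝ)..N, (f x - κ * x ^ γ)| / T ^ (γ + 1) +
          |∫ x in N..T, (f x - κ * x ^ γ)| / T ^ (γ + 1) := add_div _ _ _
      _ ≤ |∫ x in (0 : ℝ)..N, (f x - κ * x ^ γ)| / T ^ (γ + 1) + ε / 2 := by
          exact add_le_add le_rfl ((div_le_iff₀ hTp).mpr h2)
      _ < ε / 2 + ε / 2 := by gcongr
      _ = ε := by ring
  have hsum := hzero.add_const (κ / (γ + 1))
  rw [zero_add] at hsum
  refine hsum.congr' ?_
  filter_upwards [eventually_gt_atTop 0] with T hT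
  have hTp : T ^ (γ + 1) ≠ 0 := (Real.rpow_pos_of_pos hT _).ne'
  rw [intervalIntegral.integral_sub (hf 0 T) ((hpow 0 T).const_mul κ),
    intervalIntegral.integral_const_mul, integral_rpow (Or.inl hγ), Real.zero_rpow hγ1.ne']
  field_simp
  ring

theorem integral_comp_abs_sub {c : ℝ → ℝ} (hc : ∀ a b, IntervalIntegrable c volume a b) {t T : ℝ}
    (ht : t ∈ Set.Icc 0 T) :
    ∫ s in (0 : ℝ)..T, c |t - s| = (∫ x in (0 : ℝ)..t, c x) + ∫ x in (0 : ℝ)..(T - t), c x := by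
  have e1 : Set.EqOn (fun s => c |t - s|) (fun s => c (t - s)) (Set.uIcc 0 t) := fun s hs => by
    rw [Set.uIcc_of_le ht.1] at hs
    simp only [abs_of_nonneg (sub_nonneg.mpr hs.2)]
  have e2 : Set.EqOn (fun s => c |t - s|) (fun s => c (s - t)) (Set.uIcc t T) := fun s hs => by
    rw [Set.uIcc_of_le ht.2] at hs
    simp only [abs_of_nonpos (sub_nonpos.mpr hs.1), neg_sub]
  have i1 : IntervalIntegrable (fun s => c |t - s|) volume 0 t := by
    refine IntervalIntegrable.congr (fun s hs => (e1 (Set.uIoc_subset_uIcc hs)).symm) ?_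
    simpa using (hc t 0).comp_sub_left t
  have i2 : IntervalIntegrable (fun s => c |t - s|) volume t T := by
    refine IntervalIntegrable.congr (fun s hs => (e2 (Set.uIoc_subset_uIcc hs)).symm) ?_
    simpa using (hc 0 (T - t)).comp_sub_right t
  rw [← intervalIntegral.integral_add_adjacent_intervals i1 i2,
    intervalIntegral.integral_congr e1, intervalIntegral.integral_congr e2,
    intervalIntegral.integral_comp_sub_left, intervalIntegral.integral_comp_sub_right]
  simp

/-- The order of the double integral of a covariance function with a regularly varying tail. -/
theorem tendsto_double_integral_div_rpow {c : ℝ → ℝ} {β κ : ℝ} (hβ : β < 1)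
    (hc : ∀ a b, IntervalIntegrable c volume a b)
    (hlim : Tendsto (fun x => c x / x ^ (-β)) atTop (𝓝 κ)) :
    Tendsto (fun T => (∫ t in (0 : ℝ)..T, ∫ s in (0 : ℝ)..T, c |t - s|) / T ^ (2 - β)) atTop
      (𝓝 (2 * κ / ((1 - β) * (2 - β)))) := by
  set F : ℝ → ℝ := fun x => ∫ y in (0 : ℝ)..x, c y with hF
  have hFc : Continuous F := intervalIntegral.continuous_primitive hc 0
  have h1 := tendsto_integral_div_rpow (by linarith : -1 < -β) hc hlim
  -- The inner integral over `s`, split at `s = t`, is `F(t) + F(T - t)`; both summands have the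
  -- same integral over `[0, T]`, so twice the integral of `F` is wanted, a second application of
  -- Karamata.
  have h2 := tendsto_integral_div_rpow (f := F) (by linarith : -1 < -β + 1)
    (fun a b => hFc.intervalIntegrable a b) h1
  have h3 := h2.const_mul 2
  have e1 : -β + 1 + 1 = 2 - β := by ring
  have e2 : 2 * (κ / (-β + 1) / (-β + 1 + 1)) = 2 * κ / ((1 - β) * (2 - β)) := by
    rw [e1, show -β + 1 = 1 - β by ring, div_div]
    ring
  rw [e2] at h3
  refine h3.congr' ?_
  filter_upwards [eventually_gt_atTop 0] with T hT
  have h4 : ∫ t in (0 : ℝ)..T, ∫ s in (0 : ℝ)..T, c |t - s| =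
      ∫ t in (0 : ℝ)..T, (F t + F (T - t)) := by
    refine intervalIntegral.integral_congr fun t ht => ?_
    rw [Set.uIcc_of_le hT.le] at ht
    exact integral_comp_abs_sub hc ht
  have h5 : Continuous fun t => F (T - t) := hFc.comp (continuous_sub_left T)
  rw [h4, intervalIntegral.integral_add (hFc.intervalIntegrable _ _) (h5.intervalIntegrable _ _),
    intervalIntegral.integral_comp_sub_left, e1]
  simp only [sub_self, sub_zero]
  ring

end RegularVariation

/-! ### Multipole covariances as averaged autocovariances of zonal projections. -/

section SphereField

variable {Ω : Type*} [MeasurableSpace Ω] {P : Measure Ω} {Z : S2 → ℝ → Ω → ℝ} {Γ : ℝ → ℝ → ℝ}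

theorem continuous_inner_sphere : Continuous fun p : S2 × S2 =>
    (inner ℝ (p.1 : EuclideanSpace ℝ (Fin 3)) (p.2 : EuclideanSpace ℝ (Fin 3)) : ℝ) :=
  (continuous_subtype_val.comp continuous_fst).inner (continuous_subtype_val.comp continuous_snd)

namespace IsSphereTimeGaussianField

theorem hasGaussianLaw_pair (hZ : IsSphereTimeGaussianField P Z Γ) (x y : S2) (t s : ℝ) :
    HasGaussianLaw (fun ω => (Z x t ω, Z y s ω)) P :=
  hZ.gaussian.hasGaussianLaw_prodMk (s := (x, t)) (t := (y, s))

theorem memLp_two (hZ : IsSphereTimeGaussianField P Z Γ) (x : S2) (t : ℝ) : MemLp (Z x t) 2 P :=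
  (hZ.hasGaussianLaw_pair x x t t).fst.memLp_two

theorem abs_covariance_le_one (hZ : IsSphereTimeGaussianField P Z Γ) (x y : S2) (t s : ℝ) :
    |∫ ω, Z x t ω * Z y s ω ∂P| ≤ 1 := by
  refine (abs_integral_le_integral_abs).trans
    ((integral_abs_mul_le (hZ.memLp_two x t) (hZ.memLp_two y s)).trans ?_)
  rw [hZ.unit_variance, hZ.unit_variance]
  norm_num

theorem abs_cov_le_one (hZ : IsSphereTimeGaussianField P Z Γ) {θ : ℝ}
    (hθ : θ ∈ Set.Icc (-1 : ℝ) 1) (τ : ℝ) : |Γ θ τ| ≤ 1 := by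
  obtain ⟨x, y, hxy⟩ := exists_inner_eq hθ
  have h := hZ.abs_covariance_le_one x y τ 0
  rwa [hZ.covariance, hxy, sub_zero] at h

theorem cov_neg (hZ : IsSphereTimeGaussianField P Z Γ) {θ : ℝ}
    (hθ : θ ∈ Set.Icc (-1 : ℝ) 1) (τ : ℝ) : Γ θ (-τ) = Γ θ τ := by
  obtain ⟨x, y, hxy⟩ := exists_inner_eq hθ
  have h1 := hZ.covariance x y 0 τ
  have h2 := hZ.covariance y x τ 0
  rw [real_inner_comm, hxy, sub_zero] at h2
  rw [hxy, zero_sub] at h1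
  rw [← h1, ← h2]
  exact integral_congr_ae (Eventually.of_forall fun ω => mul_comm _ _)

theorem cov_one_zero (hZ : IsSphereTimeGaussianField P Z Γ) : Γ 1 0 = 1 := by
  obtain ⟨x, y, hxy⟩ := exists_inner_eq (t := 1) (by norm_num)
  have h := hZ.covariance x x 0 0
  have hx : (inner ℝ (x : EuclideanSpace ℝ (Fin 3)) (x : EuclideanSpace ℝ (Fin 3)) : ℝ) = 1 := by
    rw [real_inner_self_eq_norm_sq, norm_eq_of_mem_sphere, one_pow]
  rw [hx, sub_zero] at h
  rw [← h, ← hZ.unit_variance x 0]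
  exact integral_congr_ae (Eventually.of_forall fun ω => (pow_two _).symm)

theorem isBoundedSecondMomentField_zonal (hZ : IsSphereTimeGaussianField P Z Γ) (t : ℝ) (l : ℕ)
    (z : S2) : IsBoundedSecondMomentField P (fun (x : S2) ω => Z x t ω * (legendrePoly l).eval
      (inner ℝ (z : EuclideanSpace ℝ (Fin 3)) (x : EuclideanSpace ℝ (Fin 3)))) 1 where
  measurable := by
    have h1 : Measurable fun p : Ω × S2 => Z p.2 t p.1 :=
      hZ.measurable.comp (measurable_fst.prodMk (measurable_snd.prodMk measurable_const))
    have h2 : Continuous fun x : S2 => (legendrePoly l).eval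
        (inner ℝ (z : EuclideanSpace ℝ (Fin 3)) (x : EuclideanSpace ℝ (Fin 3))) :=
      (legendrePoly l).continuous.comp (continuous_inner_sphere.comp
        (continuous_const.prodMk continuous_id))
    exact h1.mul (h2.measurable.comp measurable_snd)
  memLp x := (hZ.memLp_two x t).mul_const _
  integral_sq_le x := by
    simp_rw [mul_pow]
    rw [integral_mul_const, hZ.unit_variance, one_mul, ← sq_abs]
    exact pow_le_one₀ (abs_nonneg _) (abs_legendrePoly_le_one l (inner_mem_Icc z x))

/-- The variance of the projection of the field on a zonal function dominates its
autocovariances. -/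
theorem abs_integral_zonal_le [IsProbabilityMeasure P] (hZ : IsSphereTimeGaussianField P Z Γ)
    (τ : ℝ) (l : ℕ) (z : S2) :
    |∫ p : S2 × S2, Γ (inner ℝ (p.1 : EuclideanSpace ℝ (Fin 3)) p.2) τ *
        ((legendrePoly l).eval (inner ℝ (z : EuclideanSpace ℝ (Fin 3)) p.1) *
        (legendrePoly l).eval (inner ℝ (z : EuclideanSpace ℝ (Fin 3)) p.2))
          ∂(sphereArea.prod sphereArea)| ≤
      ∫ p : S2 × S2, Γ (inner ℝ (p.1 : EuclideanSpace ℝ (Fin 3)) p.2) 0 *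
        ((legendrePoly l).eval (inner ℝ (z : EuclideanSpace ℝ (Fin 3)) p.1) *
        (legendrePoly l).eval (inner ℝ (z : EuclideanSpace ℝ (Fin 3)) p.2))
          ∂(sphereArea.prod sphereArea) := by
  have hmix : ∀ t s : ℝ, ∫ ω, (∫ x : S2, Z x t ω * (legendrePoly l).eval
      (inner ℝ (z : EuclideanSpace ℝ (Fin 3)) x) ∂sphereArea) *
      (∫ x : S2, Z x s ω * (legendrePoly l).eval
      (inner ℝ (z : EuclideanSpace ℝ (Fin 3)) x) ∂sphereArea) ∂P =
      ∫ p : S2 × S2, Γ (inner ℝ (p.1 : EuclideanSpace ℝ (Fin 3)) p.2) (t - s) *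
        ((legendrePoly l).eval (inner ℝ (z : EuclideanSpace ℝ (Fin 3)) p.1) *
        (legendrePoly l).eval (inner ℝ (z : EuclideanSpace ℝ (Fin 3)) p.2))
          ∂(sphereArea.prod sphereArea) := by
    intro t s
    rw [(hZ.isBoundedSecondMomentField_zonal t l z).integral_integral_mul_integral sphereArea
      (hZ.isBoundedSecondMomentField_zonal s l z)]
    refine integral_congr_ae (Eventually.of_forall fun p => ?_)
    simp only
    rw [← hZ.covariance, ← integral_mul_const]
    refine integral_congr_ae (Eventually.of_forall fun ω => ?_)
    ring
  have h1 := integral_abs_mul_le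
    ((hZ.isBoundedSecondMomentField_zonal τ l z).memLp_integral sphereArea)
    ((hZ.isBoundedSecondMomentField_zonal 0 l z).memLp_integral sphereArea)
  have h2 := (abs_integral_le_integral_abs).trans h1
  simp_rw [pow_two] at h2
  rw [hmix, hmix, hmix] at h2
  simp only [sub_self, sub_zero] at h2
  linarith

theorem integrable_zonal (hc : Continuous (Function.uncurry Γ)) (τ : ℝ) (l : ℕ) :
    Integrable (fun q : S2 × S2 × S2 =>
      Γ (inner ℝ (q.2.1 : EuclideanSpace ℝ (Fin 3)) q.2.2) τ *
        ((legendrePoly l).eval (inner ℝ (q.1 : EuclideanSpace ℝ (Fin 3)) q.2.1) *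
        (legendrePoly l).eval (inner ℝ (q.1 : EuclideanSpace ℝ (Fin 3)) q.2.2)))
      (sphereArea.prod (sphereArea.prod sphereArea)) := by
  have hΓ : Continuous fun θ => Γ θ τ := hc.comp (continuous_id.prodMk continuous_const)
  have hP := (legendrePoly l).continuous
  refine Continuous.integrable_of_hasCompactSupport ?_ (HasCompactSupport.of_compactSpace _)
  exact (hΓ.comp (continuous_inner_sphere.comp continuous_snd)).mul
      ((hP.comp (continuous_inner_sphere.comp
        (continuous_fst.prodMk (continuous_fst.comp continuous_snd)))).mul
      (hP.comp (continuous_inner_sphere.comp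
        (continuous_fst.prodMk (continuous_snd.comp continuous_snd)))))

/-- Averaging over the pole `z` replaces the two zonal factors by a multiple of `P_l(⟨x, y⟩)`, and
the integral over `y` then produces the multipole coefficient. The constant is `4π · 2π` times the
squared norm of `P_l`. -/
theorem integral_integral_zonal (hc : Continuous (Function.uncurry Γ)) (τ : ℝ) (l : ℕ) :
    ∫ z : S2, ∫ p : S2 × S2, Γ (inner ℝ (p.1 : EuclideanSpace ℝ (Fin 3)) p.2) τ *
        ((legendrePoly l).eval (inner ℝ (z : EuclideanSpace ℝ (Fin 3)) p.1) *
        (legendrePoly l).eval (inner ℝ (z : EuclideanSpace ℝ (Fin 3)) p.2))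
          ∂(sphereArea.prod sphereArea) ∂sphereArea =
      8 * Real.pi ^ 2 * legendreNormSq l * multipoleCov Γ l τ := by
  have hΓ : Continuous fun θ => Γ θ τ := hc.comp (continuous_id.prodMk continuous_const)
  have hP := (legendrePoly l).continuous
  rw [integral_integral_swap (f := fun (z : S2) (p : S2 × S2) =>
    Γ (inner ℝ (p.1 : EuclideanSpace ℝ (Fin 3)) p.2) τ *
        ((legendrePoly l).eval (inner ℝ (z : EuclideanSpace ℝ (Fin 3)) p.1) *
        (legendrePoly l).eval (inner ℝ (z : EuclideanSpace ℝ (Fin 3)) p.2)))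
    (integrable_zonal hc τ l)]
  simp_rw [integral_const_mul, integral_legendrePoly_mul_legendrePoly_sphere]
  rw [integral_prod]
  swap
  · refine Continuous.integrable_of_hasCompactSupport ?_ (HasCompactSupport.of_compactSpace _)
    exact (hΓ.comp continuous_inner_sphere).mul
      (continuous_const.mul (hP.comp continuous_inner_sphere))
  have h1 : ∀ x : S2, ∫ y : S2, Γ (inner ℝ (x : EuclideanSpace ℝ (Fin 3)) y) τ *
      (2 * Real.pi * legendreNormSq l *
        (legendrePoly l).eval (inner ℝ (x : EuclideanSpace ℝ (Fin 3)) y)) ∂sphereArea =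
      2 * Real.pi * legendreNormSq l * multipoleCov Γ l τ := by
    intro x
    have h2 := integral_sphereArea_inner x (fun θ => Γ θ τ * (legendrePoly l).eval θ)
      (hΓ.mul hP)
    rw [multipoleCov, ← h2, ← integral_const_mul]
    refine integral_congr_ae (Eventually.of_forall fun y => ?_)
    simp only
    rw [real_inner_comm]
    ring
  simp only [h1, integral_const, sphereArea_real_univ, smul_eq_mul]
  ring

/-- The time covariance of a multipole is largest at lag `0`. -/
theorem abs_multipoleCov_le [IsProbabilityMeasure P] (hZ : IsSphereTimeGaussianField P Z Γ)
    (hc : Continuous (Function.uncurry Γ)) (l : ℕ) (τ : ℝ) :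
    |multipoleCov Γ l τ| ≤ multipoleCov Γ l 0 := by
  have hK : 0 < 8 * Real.pi ^ 2 * legendreNormSq l := by
    have := legendreNormSq_pos l
    positivity
  have hcont : ∀ σ : ℝ, Integrable (fun z : S2 => ∫ p : S2 × S2,
      Γ (inner ℝ (p.1 : EuclideanSpace ℝ (Fin 3)) p.2) σ *
        ((legendrePoly l).eval (inner ℝ (z : EuclideanSpace ℝ (Fin 3)) p.1) *
        (legendrePoly l).eval (inner ℝ (z : EuclideanSpace ℝ (Fin 3)) p.2))
          ∂(sphereArea.prod sphereArea)) sphereArea :=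
    fun σ => (integrable_zonal hc σ l).integral_prod_left
  -- For each pole this is the Cauchy–Schwarz bound for a stationary process; integrated over all
  -- poles, it passes to the coefficients.
  have h1 : |∫ z : S2, ∫ p : S2 × S2, Γ (inner ℝ (p.1 : EuclideanSpace ℝ (Fin 3)) p.2) τ *
        ((legendrePoly l).eval (inner ℝ (z : EuclideanSpace ℝ (Fin 3)) p.1) *
        (legendrePoly l).eval (inner ℝ (z : EuclideanSpace ℝ (Fin 3)) p.2))
          ∂(sphereArea.prod sphereArea) ∂sphereArea| ≤
      ∫ z : S2, ∫ p : S2 × S2, Γ (inner ℝ (p.1 : EuclideanSpace ℝ (Fin 3)) p.2) 0 *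
        ((legendrePoly l).eval (inner ℝ (z : EuclideanSpace ℝ (Fin 3)) p.1) *
        (legendrePoly l).eval (inner ℝ (z : EuclideanSpace ℝ (Fin 3)) p.2))
          ∂(sphereArea.prod sphereArea) ∂sphereArea :=
    (abs_integral_le_integral_abs).trans
      (integral_mono (hcont τ).abs (hcont 0) fun z => hZ.abs_integral_zonal_le τ l z)
  rw [integral_integral_zonal hc, integral_integral_zonal hc, abs_mul, abs_of_pos hK] at h1
  exact le_of_mul_le_mul_left h1 hK

end IsSphereTimeGaussianField

end SphereField

/-! ### Uniform decay of the covariance and asymptotics of the monopole. -/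

section SphereFieldDecay

variable {Ω : Type*} [MeasurableSpace Ω] {P : Measure Ω} {Z : S2 → ℝ → Ω → ℝ} {Γ : ℝ → ℝ → ℝ}

theorem memoryFun_nonneg (α β τ : ℝ) : 0 ≤ memoryFun α β τ := by
  unfold memoryFun
  split_ifs <;> positivity

/-- In the short-memory case the rate is `α ≥ 2`, which exceeds `b ≤ 1`. -/
theorem memoryFun_le {α β b τ : ℝ} (hα : 2 ≤ α) (hb : b ≤ β) (hb1 : b ≤ 1) :
    memoryFun α β τ ≤ (1 + |τ|) ^ (-b) := by
  have h1 : 1 ≤ 1 + |τ| := by linarith [abs_nonneg τ]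
  unfold memoryFun
  split_ifs
  · exact Real.rpow_le_rpow_of_exponent_le h1 (by linarith)
  · exact Real.rpow_le_rpow_of_exponent_le h1 (by linarith)

theorem integral_mul_legendrePoly_eq_multipoleCov (l : ℕ) (τ : ℝ) :
    ∫ θ in (-1 : ℝ)..1, Γ θ τ * (legendrePoly l).eval θ =
      (2 * Real.pi)⁻¹ * multipoleCov Γ l τ := by
  rw [multipoleCov, inv_mul_cancel_left₀ (by positivity)]

/-- The covariance function decays uniformly at the least memory exponent. -/
theorem IsSphereTimeGaussianField.exists_abs_cov_le [IsProbabilityMeasure P]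
    (hZ : IsSphereTimeGaussianField P Z Γ)
    (hc : Continuous (Function.uncurry Γ)) {α : ℝ} {β : ℕ → ℝ} (hβ : HasMemoryExponents Γ α β)
    {b : ℝ} (hb0 : 0 ≤ b) (hb1 : b ≤ 1) (hb : ∀ l ∈ activeMultipoles Γ, b ≤ β l) :
    ∃ K : ℝ, 0 < K ∧ ∀ θ ∈ Set.Icc (-1 : ℝ) 1, ∀ τ : ℝ, |Γ θ τ| ≤ K * (1 + |τ|) ^ (-b) := by
  obtain ⟨G, hG1, hG2⟩ := hβ.asymptotics
  obtain ⟨M, hM⟩ := hG2 1 one_pos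
  have hC0 : ∀ l, 0 ≤ multipoleCov Γ l 0 := fun l =>
    (abs_nonneg _).trans (hZ.abs_multipoleCov_le hc l 0)
  have hlarge : ∀ l, ∀ τ ≥ M, |multipoleCov Γ l τ| ≤
      2 * (1 + |τ|) ^ (-b) * multipoleCov Γ l 0 := by
    intro l τ hτ
    by_cases hl : l ∈ activeMultipoles Γ
    · have hpos : 0 < multipoleCov Γ l 0 := lt_of_le_of_ne (hC0 l) (Ne.symm hl)
      have h1 := abs_le.mp (hM τ hτ l hl)
      have h2 : |G l τ| ≤ 2 * multipoleCov Γ l 0 := by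
        have h3 : |G l τ / multipoleCov Γ l 0| ≤ 2 := abs_le.mpr ⟨by linarith, by linarith⟩
        rwa [abs_div, abs_of_pos hpos, div_le_iff₀ hpos] at h3
      rw [hG1 l hl, abs_mul, abs_of_nonneg (memoryFun_nonneg _ _ _)]
      calc _ ≤ 2 * multipoleCov Γ l 0 * (1 + |τ|) ^ (-b) :=
            mul_le_mul h2 (memoryFun_le hβ.two_le (hb l hl) hb1) (memoryFun_nonneg _ _ _)
              (by linarith)
        _ = _ := by ring
    · have h0 : multipoleCov Γ l 0 = 0 := not_not.mp hl
      have h1 := hZ.abs_multipoleCov_le hc l τ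
      rw [h0] at h1 ⊢
      simpa using h1
  have hΓc : ∀ τ, ContinuousOn (fun θ => Γ θ τ) (Set.Icc (-1) 1) := fun τ =>
    (hc.comp (continuous_id.prodMk continuous_const)).continuousOn
  -- The coefficients of `Γ(·, τ)` are dominated by `2 (1 + |τ|)^(-b)` times those of `Γ(·, 0)`, and
  -- `Γ(1, 0) = 1`.
  have hfar : ∀ θ ∈ Set.Icc (-1 : ℝ) 1, ∀ τ ≥ M, |Γ θ τ| ≤ 2 * (1 + |τ|) ^ (-b) := by
    intro θ hθ τ hτ
    have h := abs_le_of_legendre_coeff_le (hΓc 0) (hΓc τ)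
      (fun l => by
        rw [integral_mul_legendrePoly_eq_multipoleCov]
        exact mul_nonneg (by positivity) (hC0 l))
      (c := 2 * (1 + |τ|) ^ (-b)) (by positivity)
      (fun l => by
        rw [integral_mul_legendrePoly_eq_multipoleCov, integral_mul_legendrePoly_eq_multipoleCov,
          abs_mul, abs_of_pos (by positivity : 0 < (2 * Real.pi)⁻¹), mul_left_comm]
        exact mul_le_mul_of_nonneg_left (hlarge l τ hτ) (by positivity)) hθ
    rwa [hZ.cov_one_zero, mul_one] at h
  -- The second entry covers `|τ| < |M|`, where only `|Γ| ≤ 1` is used. Large negative lags reduce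
  -- to positive ones, since `Γ(θ, ·)` is even.
  set K := max 2 ((1 + |M|) ^ b) with hK
  have hK2 : 2 ≤ K := le_max_left _ _
  refine ⟨K, by linarith, fun θ hθ τ => ?_⟩
  have hp : 0 < (1 + |τ|) ^ (-b) := by positivity
  rcases le_or_gt |M| |τ| with h | h
  · have habs : |Γ θ τ| = abs (Γ θ |τ|) := by
      rcases abs_choice τ with h1 | h1
      · rw [h1]
      · rw [h1, hZ.cov_neg hθ]
    have h2 := hfar θ hθ |τ| ((le_abs_self M).trans h)
    rw [abs_abs] at h2
    rw [habs]
    exact h2.trans (mul_le_mul_of_nonneg_right hK2 hp.le)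
  · refine (hZ.abs_cov_le_one hθ τ).trans ?_
    have h3 : (1 + |τ|) ^ b ≤ K := (Real.rpow_le_rpow (by positivity) (by linarith) hb0).trans
      (le_max_right _ _)
    have h4 : (1 + |τ|) ^ b * (1 + |τ|) ^ (-b) = 1 := by
      rw [← Real.rpow_add (by positivity), add_neg_cancel, Real.rpow_zero]
    exact h4.symm.le.trans (mul_le_mul_of_nonneg_right h3 hp.le)

/-- For `x > 0` the quotient is `(x / (1 + x))^b (1 + x)^(-(a - b))`. The case `a = b` serves the
monopole, the case `b < a` the residual. -/
theorem tendsto_one_add_rpow_div_rpow (a b : ℝ) (hab : b ≤ a) :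
    Tendsto (fun x : ℝ => (1 + |x|) ^ (-a) / x ^ (-b)) atTop (𝓝 (if a = b then 1 else 0)) := by
  have h1 : Tendsto (fun x : ℝ => x / (1 + x)) atTop (𝓝 1) := by
    have h2 : Tendsto (fun x : ℝ => 1 - 1 / (1 + x)) atTop (𝓝 (1 - 0)) :=
      (tendsto_const_nhds.div_atTop (tendsto_atTop_add_const_left _ 1 tendsto_id)).const_sub 1
    rw [sub_zero] at h2
    refine h2.congr' ?_
    filter_upwards [eventually_gt_atTop 0] with x hx
    field_simp
    ring
  have h2 : Tendsto (fun x : ℝ => (x / (1 + x)) ^ b) atTop (𝓝 1) := by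
    have := h1.rpow_const (p := b) (Or.inl one_ne_zero)
    rwa [Real.one_rpow] at this
  have h3 : Tendsto (fun x : ℝ => (1 + x) ^ (-(a - b))) atTop (𝓝 (if a = b then 1 else 0)) := by
    split_ifs with h
    · simp [h]
    · exact (tendsto_rpow_neg_atTop (by
        have := lt_of_le_of_ne hab (Ne.symm h)
        linarith)).comp (tendsto_atTop_add_const_left _ 1 tendsto_id)
  have h4 := h2.mul h3
  rw [one_mul] at h4
  refine h4.congr' ?_
  filter_upwards [eventually_gt_atTop 0] with x hx
  have hx1 : 0 < 1 + x := by linarith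
  rw [abs_of_pos hx, Real.div_rpow hx.le hx1.le, Real.rpow_neg hx.le,
    show -(a - b) = -a + b by ring, Real.rpow_add hx1]
  have h5 : (1 + x) ^ b ≠ 0 := (Real.rpow_pos_of_pos hx1 b).ne'
  have h6 : x ^ b ≠ 0 := (Real.rpow_pos_of_pos hx b).ne'
  field_simp

theorem HasMemoryExponents.tendsto_multipoleCov_zero {α : ℝ} {β : ℕ → ℝ}
    (hβ : HasMemoryExponents Γ α β) (h1 : β 0 < 1) :
    Tendsto (fun τ => multipoleCov Γ 0 τ / τ ^ (-β 0)) atTop (𝓝 (multipoleCov Γ 0 0)) := by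
  obtain ⟨G, hG1, hG2⟩ := hβ.asymptotics
  have hG : Tendsto (fun τ => G 0 τ / multipoleCov Γ 0 0) atTop (𝓝 1) := by
    rw [Metric.tendsto_atTop]
    intro ε hε
    obtain ⟨M, hM⟩ := hG2 (ε / 2) (by positivity)
    exact ⟨M, fun τ hτ => lt_of_le_of_lt (hM τ hτ 0 hβ.zero_mem) (by linarith)⟩
  have h2 := tendsto_one_add_rpow_div_rpow (β 0) (β 0) le_rfl
  rw [if_pos rfl] at h2
  have h3 := (hG.mul h2).const_mul (multipoleCov Γ 0 0)
  rw [mul_one, mul_one] at h3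
  refine h3.congr fun τ => ?_
  have h4 : multipoleCov Γ 0 0 ≠ 0 := hβ.zero_mem
  rw [hG1 0 hβ.zero_mem τ, memoryFun, if_neg h1.ne]
  field_simp

theorem continuous_multipoleCov (hc : Continuous (Function.uncurry Γ)) (l : ℕ) :
    Continuous (multipoleCov Γ l) := by
  unfold multipoleCov
  refine continuous_const.mul (intervalIntegral.continuous_parametric_intervalIntegral_of_continuous'
    ?_ _ _)
  have h1 : Continuous fun p : ℝ × ℝ => Γ p.2 p.1 := hc.comp continuous_swap
  unfold Function.uncurry
  exact h1.mul ((legendrePoly l).continuous.comp continuous_snd)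

theorem integral_cov_sphere (hc : Continuous (Function.uncurry Γ)) (x : S2) (τ : ℝ) :
    ∫ y : S2, Γ (inner ℝ (x : EuclideanSpace ℝ (Fin 3)) y) τ ∂sphereArea =
      multipoleCov Γ 0 τ := by
  have h := integral_sphereArea_inner x (fun θ => Γ θ τ)
    (hc.comp (continuous_id.prodMk continuous_const))
  have hP0 : ∀ θ, (legendrePoly 0).eval θ = 1 := fun θ => by simp [legendrePoly]
  simp only [multipoleCov, hP0, mul_one]
  rw [← h]
  simp_rw [real_inner_comm]

theorem multipoleCov_zero_neg (hZ : IsSphereTimeGaussianField P Z Γ) (l : ℕ) (τ : ℝ) :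
    multipoleCov Γ l (-τ) = multipoleCov Γ l τ := by
  unfold multipoleCov
  congr 1
  refine intervalIntegral.integral_congr fun θ hθ => ?_
  rw [Set.uIcc_of_le (by norm_num)] at hθ
  rw [hZ.cov_neg hθ]

theorem multipoleCov_abs (hZ : IsSphereTimeGaussianField P Z Γ) (l : ℕ) (τ : ℝ) :
    multipoleCov Γ l |τ| = multipoleCov Γ l τ := by
  rcases abs_choice τ with h | h
  · rw [h]
  · rw [h, multipoleCov_zero_neg hZ]

end SphereFieldDecay

/-! ### Orthogonal decomposition of the area functional and second moments of its parts. -/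

section AreaDecomposition

variable {Ω : Type*} [MeasurableSpace Ω] {P : Measure Ω} {Z : S2 → ℝ → Ω → ℝ} {Γ : ℝ → ℝ → ℝ}

/-- The product of the area of the sphere and Lebesgue measure on `[0, T]`. -/
noncomputable def sphereTimeMeasure (T : ℝ) : Measure (S2 × ℝ) :=
  sphereArea.prod (volume.restrict (Set.Icc 0 T))

instance (T : ℝ) : IsFiniteMeasure (sphereTimeMeasure T) := by
  unfold sphereTimeMeasure
  infer_instance

theorem integral_sphereTimeMeasure {T : ℝ} (hT : 0 ≤ T) {f : S2 × ℝ → ℝ}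
    (hf : Integrable f (sphereTimeMeasure T)) :
    ∫ p, f p ∂(sphereTimeMeasure T) = ∫ t in (0 : ℝ)..T, ∫ x : S2, f (x, t) ∂sphereArea := by
  rw [sphereTimeMeasure, integral_prod_symm f hf, integral_Icc_eq_integral_Ioc,
    intervalIntegral.integral_of_le hT]

theorem integral_sphereTimeMeasure_prod {T : ℝ} (hT : 0 ≤ T)
    {F : (S2 × ℝ) × (S2 × ℝ) → ℝ} (hF : Measurable F) {C : ℝ} (hC : ∀ p, |F p| ≤ C) {c : ℝ → ℝ}
    (hc : ∀ x t s, ∫ y : S2, F ((x, t), (y, s)) ∂sphereArea = c |t - s|) :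
    ∫ p, F p ∂((sphereTimeMeasure T).prod (sphereTimeMeasure T)) =
      4 * Real.pi * ∫ t in (0 : ℝ)..T, ∫ s in (0 : ℝ)..T, c |t - s| := by
  have hint : Integrable F ((sphereTimeMeasure T).prod (sphereTimeMeasure T)) :=
    Integrable.of_bound hF.aestronglyMeasurable C (Eventually.of_forall hC)
  rw [integral_prod F hint, integral_sphereTimeMeasure hT hint.integral_prod_left,
    ← intervalIntegral.integral_const_mul]
  refine intervalIntegral.integral_congr fun t _ => ?_
  have h1 : ∀ x : S2, ∫ q, F ((x, t), q) ∂(sphereTimeMeasure T) =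
      ∫ s in (0 : ℝ)..T, c |t - s| := by
    intro x
    rw [integral_sphereTimeMeasure hT]
    · simp_rw [hc]
    · exact Integrable.of_bound (hF.comp measurable_prodMk_left).aestronglyMeasurable C
        (Eventually.of_forall fun q => hC _)
  simp only [h1, integral_const, sphereArea_real_univ, smul_eq_mul]

theorem integral_exceedanceResidual {X : Ω → ℝ} (hX : HasGaussianLaw X P)
    (hX0 : ∫ ω, X ω ∂P = 0) (hX1 : ∫ ω, X ω ^ 2 ∂P = 1) (u : ℝ) :
    ∫ ω, exceedanceResidual u (X ω) ∂P = 0 := by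
  have := hX.isProbabilityMeasure
  have iX : Integrable (fun ω => exceedance u (X ω)) P := Integrable.of_bound
    ((measurable_exceedance u).comp_aemeasurable hX.aemeasurable).aestronglyMeasurable 1
    (Eventually.of_forall fun ω => abs_exceedance_le_one _ _)
  have h := integral_sub_mul_sub_mul iX (integrable_const (1 : ℝ)) hX.integrable (gaussianTail u)
    (gaussianPDFReal 0 1 u)
  rw [hX0, integral_exceedance_comp hX hX0 hX1] at h
  simpa [exceedanceResidual] using h

namespace IsSphereTimeGaussianField

/-- The integral of the field over the sphere and `[0, T]`. -/
noncomputable def linearPart (Z : S2 → ℝ → Ω → ℝ) (T : ℝ) (ω : Ω) : ℝ :=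
  ∫ p, Z p.1 p.2 ω ∂(sphereTimeMeasure T)

/-- The part of the area functional of Hermite rank at least two. -/
noncomputable def residualPart (Z : S2 → ℝ → Ω → ℝ) (u T : ℝ) (ω : Ω) : ℝ :=
  ∫ p, exceedanceResidual u (Z p.1 p.2 ω) ∂(sphereTimeMeasure T)

theorem measurable_uncurry (hZ : IsSphereTimeGaussianField P Z Γ) (ω : Ω) :
    Measurable fun p : S2 × ℝ => Z p.1 p.2 ω :=
  hZ.measurable.comp measurable_prodMk_left

theorem isBoundedSecondMomentField_linear (hZ : IsSphereTimeGaussianField P Z Γ) :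
    IsBoundedSecondMomentField P (fun (p : S2 × ℝ) ω => Z p.1 p.2 ω) 1 where
  measurable := hZ.measurable
  memLp p := hZ.memLp_two p.1 p.2
  integral_sq_le p := (hZ.unit_variance p.1 p.2).le

theorem isBoundedSecondMomentField_residual [IsProbabilityMeasure P]
    (hZ : IsSphereTimeGaussianField P Z Γ) (u : ℝ) :
    IsBoundedSecondMomentField P (fun (p : S2 × ℝ) ω => exceedanceResidual u (Z p.1 p.2 ω))
      (16 + 2 * u ^ 2) where
  measurable := (measurable_exceedanceResidual u).comp hZ.measurable
  memLp p := by
    have h := hZ.memLp_two p.1 p.2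
    have hE : MemLp (fun ω => exceedance u (Z p.1 p.2 ω)) 2 P := MemLp.of_bound
      ((measurable_exceedance u).comp_aemeasurable
        h.aestronglyMeasurable.aemeasurable).aestronglyMeasurable 1
      (Eventually.of_forall fun ω => abs_exceedance_le_one _ _)
    exact (hE.sub (memLp_const _)).sub (h.const_mul _)
  integral_sq_le p := by
    have h := abs_integral_exceedanceResidual_mul_le (hZ.hasGaussianLaw_pair p.1 p.1 p.2 p.2)
      (hZ.centered _ _) (hZ.unit_variance _ _) (hZ.centered _ _) (hZ.unit_variance _ _) u
      (hZ.abs_covariance_le_one _ _ _ _)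
    simp_rw [← pow_two, hZ.unit_variance] at h
    simpa using (le_abs_self _).trans h

theorem excursionArea_eq_integral (hZ : IsSphereTimeGaussianField P Z Γ) (u t : ℝ) (ω : Ω) :
    excursionArea Z u t ω = ∫ x : S2, exceedance u (Z x t ω) ∂sphereArea := by
  have hm : MeasurableSet {x : S2 | u ≤ Z x t ω} :=
    measurableSet_le measurable_const ((hZ.measurable_uncurry ω).comp measurable_prodMk_right)
  rw [excursionArea, ← integral_indicator_one hm]
  rfl

theorem integral_excursionArea [IsProbabilityMeasure P] (hZ : IsSphereTimeGaussianField P Z Γ)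
    (u t : ℝ) : ∫ ω, excursionArea Z u t ω ∂P = 4 * Real.pi * gaussianTail u := by
  have hf : IsBoundedSecondMomentField P (fun (x : S2) ω => exceedance u (Z x t ω)) 1 :=
    { measurable := (measurable_exceedance u).comp (hZ.measurable.comp
        (measurable_fst.prodMk (measurable_snd.prodMk measurable_const)))
      memLp := fun x => MemLp.of_bound ((measurable_exceedance u).comp_aemeasurable
        (hZ.memLp_two x t).aestronglyMeasurable.aemeasurable).aestronglyMeasurable 1
        (Eventually.of_forall fun ω => abs_exceedance_le_one _ _)
      integral_sq_le := fun x => by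
        refine (integral_mono_of_nonneg (Eventually.of_forall fun ω => sq_nonneg _)
          (integrable_const (1 : ℝ)) (Eventually.of_forall fun ω => ?_)).trans_eq (by simp)
        exact pow_le_one₀ (exceedance_nonneg _ _) (exceedance_le_one _ _) }
  simp_rw [hZ.excursionArea_eq_integral]
  rw [hf.integral_integral sphereArea]
  have h : ∀ x : S2, ∫ ω, exceedance u (Z x t ω) ∂P = gaussianTail u := fun x =>
    integral_exceedance_comp (hZ.hasGaussianLaw_pair x x t t).fst (hZ.centered x t)
      (hZ.unit_variance x t) u
  simp [h, sphereArea_real_univ]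

theorem areaFunctional_eq_integral [IsProbabilityMeasure P]
    (hZ : IsSphereTimeGaussianField P Z Γ) (u T : ℝ) (ω : Ω) :
    areaFunctional P Z u T ω =
      ∫ p, (exceedance u (Z p.1 p.2 ω) - gaussianTail u) ∂(sphereTimeMeasure T) := by
  have hm : Measurable fun p : S2 × ℝ => exceedance u (Z p.1 p.2 ω) - gaussianTail u :=
    ((measurable_exceedance u).comp (hZ.measurable_uncurry ω)).sub_const _
  have hb : ∀ p : S2 × ℝ, ‖exceedance u (Z p.1 p.2 ω) - gaussianTail u‖ ≤ 1 := fun p => by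
    have h1 := exceedance_nonneg u (Z p.1 p.2 ω)
    have h2 := exceedance_le_one u (Z p.1 p.2 ω)
    have h3 := gaussianTail_nonneg u
    have h4 := gaussianTail_le_one u
    exact abs_le.mpr ⟨by linarith, by linarith⟩
  rw [sphereTimeMeasure, integral_prod_symm]
  swap
  · exact Integrable.of_bound hm.aestronglyMeasurable 1 (Eventually.of_forall hb)
  rw [areaFunctional]
  refine integral_congr_ae (Eventually.of_forall fun t => ?_)
  simp only
  rw [hZ.integral_excursionArea, hZ.excursionArea_eq_integral, integral_sub]
  · simp [sphereArea_real_univ]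
  · exact Integrable.of_bound ((measurable_exceedance u).comp
      ((hZ.measurable_uncurry ω).comp measurable_prodMk_right)).aestronglyMeasurable 1
      (Eventually.of_forall fun x => abs_exceedance_le_one _ _)
  · exact integrable_const _

theorem measurable_areaFunctional [IsProbabilityMeasure P]
    (hZ : IsSphereTimeGaussianField P Z Γ) (u T : ℝ) : Measurable (areaFunctional P Z u T) := by
  rw [funext (hZ.areaFunctional_eq_integral u T)]
  have hm : Measurable fun q : Ω × (S2 × ℝ) => exceedance u (Z q.2.1 q.2.2 q.1) - gaussianTail u :=
    ((measurable_exceedance u).comp hZ.measurable).sub_const _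
  exact (hm.stronglyMeasurable.integral_prod_right' (ν := sphereTimeMeasure T)).measurable

/-- The decomposition of the area functional in its linear part and the residual. -/
theorem areaFunctional_ae_eq [IsProbabilityMeasure P]
    (hZ : IsSphereTimeGaussianField P Z Γ) (u T : ℝ) :
    areaFunctional P Z u T =ᵐ[P]
      fun ω => gaussianPDFReal 0 1 u * linearPart Z T ω + residualPart Z u T ω := by
  -- The indicator is bounded, but `Z` itself is integrable over the sphere and `[0, T]` only for
  -- almost every `ω`, so the splitting of the integral holds almost surely.
  filter_upwards [hZ.isBoundedSecondMomentField_linear.ae_integrable (sphereTimeMeasure T),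
    (hZ.isBoundedSecondMomentField_residual u).ae_integrable (sphereTimeMeasure T)] with ω h1 h2
  rw [hZ.areaFunctional_eq_integral, linearPart, residualPart, ← integral_const_mul,
    ← integral_add (h1.const_mul _) h2]
  refine integral_congr_ae (Eventually.of_forall fun p => ?_)
  simp only [exceedanceResidual]
  ring

theorem memLp_linearPart [IsProbabilityMeasure P] (hZ : IsSphereTimeGaussianField P Z Γ) (T : ℝ) :
    MemLp (linearPart Z T) 2 P :=
  hZ.isBoundedSecondMomentField_linear.memLp_integral _

theorem memLp_residualPart [IsProbabilityMeasure P] (hZ : IsSphereTimeGaussianField P Z Γ)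
    (u T : ℝ) : MemLp (residualPart Z u T) 2 P :=
  (hZ.isBoundedSecondMomentField_residual u).memLp_integral _

theorem integral_linearPart [IsProbabilityMeasure P] (hZ : IsSphereTimeGaussianField P Z Γ)
    (T : ℝ) : ∫ ω, linearPart Z T ω ∂P = 0 := by
  refine (hZ.isBoundedSecondMomentField_linear.integral_integral (sphereTimeMeasure T)).trans ?_
  simp [hZ.centered]

theorem integral_residualPart [IsProbabilityMeasure P] (hZ : IsSphereTimeGaussianField P Z Γ)
    (u T : ℝ) : ∫ ω, residualPart Z u T ω ∂P = 0 := by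
  refine ((hZ.isBoundedSecondMomentField_residual u).integral_integral
    (sphereTimeMeasure T)).trans ?_
  have h : ∀ p : S2 × ℝ, ∫ ω, exceedanceResidual u (Z p.1 p.2 ω) ∂P = 0 := fun p =>
    integral_exceedanceResidual (hZ.hasGaussianLaw_pair p.1 p.1 p.2 p.2).fst (hZ.centered _ _)
      (hZ.unit_variance _ _) u
  simp [h]

theorem integral_residualPart_mul_linearPart [IsProbabilityMeasure P]
    (hZ : IsSphereTimeGaussianField P Z Γ) (u T : ℝ) :
    ∫ ω, residualPart Z u T ω * linearPart Z T ω ∂P = 0 := by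
  refine ((hZ.isBoundedSecondMomentField_residual u).integral_integral_mul_integral
    (sphereTimeMeasure T) hZ.isBoundedSecondMomentField_linear).trans ?_
  have h : ∀ p : (S2 × ℝ) × (S2 × ℝ),
      ∫ ω, exceedanceResidual u (Z p.1.1 p.1.2 ω) * Z p.2.1 p.2.2 ω ∂P = 0 := fun p =>
    integral_exceedanceResidual_mul (hZ.hasGaussianLaw_pair _ _ _ _) (hZ.centered _ _)
      (hZ.unit_variance _ _) (hZ.centered _ _) u
  simp [h]

theorem variance_areaFunctional [IsProbabilityMeasure P] (hZ : IsSphereTimeGaussianField P Z Γ)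
    (u T : ℝ) : variance (areaFunctional P Z u T) P =
      gaussianPDFReal 0 1 u ^ 2 * ∫ ω, linearPart Z T ω ^ 2 ∂P +
        ∫ ω, residualPart Z u T ω ^ 2 ∂P := by
  have hL := hZ.memLp_linearPart T
  have hR := hZ.memLp_residualPart u T
  have hLi := hL.integrable one_le_two
  have hRi := hR.integrable one_le_two
  have hRL : Integrable (fun ω => residualPart Z u T ω * linearPart Z T ω) P := hR.integrable_mul hL
  rw [variance_congr (hZ.areaFunctional_ae_eq u T), variance_of_integral_eq_zero]
  · have h : ∀ ω, (gaussianPDFReal 0 1 u * linearPart Z T ω + residualPart Z u T ω) ^ 2 =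
        residualPart Z u T ω ^ 2 - (-gaussianPDFReal 0 1 u ^ 2) * linearPart Z T ω ^ 2 -
          (-2 * gaussianPDFReal 0 1 u) * (residualPart Z u T ω * linearPart Z T ω) := fun ω => by
      ring
    simp_rw [h]
    rw [integral_sub_mul_sub_mul hR.integrable_sq hL.integrable_sq hRL,
      hZ.integral_residualPart_mul_linearPart]
    ring
  · exact ((hL.const_mul _).add hR).aestronglyMeasurable.aemeasurable
  · rw [integral_add (hLi.const_mul _) hRi, integral_const_mul, hZ.integral_linearPart,
      hZ.integral_residualPart]
    ring

/-- Integrating the covariance over one point of the sphere leaves the monopole covariance whatever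
the other point is, which contributes the area `4π`. -/
theorem integral_linearPart_sq [IsProbabilityMeasure P] (hZ : IsSphereTimeGaussianField P Z Γ)
    (hc : Continuous (Function.uncurry Γ)) {T : ℝ} (hT : 0 ≤ T) :
    ∫ ω, linearPart Z T ω ^ 2 ∂P =
      4 * Real.pi * ∫ t in (0 : ℝ)..T, ∫ s in (0 : ℝ)..T, multipoleCov Γ 0 |t - s| := by
  have h := hZ.isBoundedSecondMomentField_linear.integral_integral_mul_integral
    (sphereTimeMeasure T) hZ.isBoundedSecondMomentField_linear
  simp_rw [hZ.covariance] at h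
  simp_rw [pow_two]
  refine h.trans ?_
  refine integral_sphereTimeMeasure_prod hT (F := fun p : (S2 × ℝ) × (S2 × ℝ) =>
    Γ (inner ℝ (p.1.1 : EuclideanSpace ℝ (Fin 3)) p.2.1) (p.1.2 - p.2.2)) ?_ (C := 1)
    (fun p => hZ.abs_cov_le_one (inner_mem_Icc _ _) _) fun x t s => ?_
  · have h1 : Continuous fun p : (S2 × ℝ) × (S2 × ℝ) =>
        (inner ℝ (p.1.1 : EuclideanSpace ℝ (Fin 3)) (p.2.1 : EuclideanSpace ℝ (Fin 3)) : ℝ) :=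
      continuous_inner_sphere.comp ((continuous_fst.comp continuous_fst).prodMk
        (continuous_fst.comp continuous_snd))
    exact (hc.comp (h1.prodMk (by fun_prop))).measurable
  · rw [multipoleCov_abs hZ]
    exact integral_cov_sphere hc x (t - s)

theorem integral_residualPart_sq_le [IsProbabilityMeasure P]
    (hZ : IsSphereTimeGaussianField P Z Γ) {b K : ℝ} (hK : 0 < K) (hb : 0 ≤ b)
    (hbound : ∀ θ ∈ Set.Icc (-1 : ℝ) 1, ∀ τ : ℝ, |Γ θ τ| ≤ K * (1 + |τ|) ^ (-b)) (u : ℝ) {T : ℝ}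
    (hT : 0 ≤ T) :
    ∫ ω, residualPart Z u T ω ^ 2 ∂P ≤
      4 * Real.pi * ∫ t in (0 : ℝ)..T, ∫ s in (0 : ℝ)..T,
        4 * Real.pi * (16 * (K * (1 + |(|t - s|)|) ^ (-b)) ^ 3 +
          2 * u ^ 2 * (K * (1 + |(|t - s|)|) ^ (-b)) ^ 2) := by
  have h := (hZ.isBoundedSecondMomentField_residual u).integral_integral_mul_integral
    (sphereTimeMeasure T) (hZ.isBoundedSecondMomentField_residual u)
  simp_rw [pow_two (residualPart Z u T _)]
  refine h.trans_le ?_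
  have hmeas : Measurable fun p : (S2 × ℝ) × (S2 × ℝ) =>
      16 * (K * (1 + |(|p.1.2 - p.2.2|)|) ^ (-b)) ^ 3 +
          2 * u ^ 2 * (K * (1 + |(|p.1.2 - p.2.2|)|) ^ (-b)) ^ 2 := by
    fun_prop
  have hbd : ∀ p : (S2 × ℝ) × (S2 × ℝ), |16 * (K * (1 + |(|p.1.2 - p.2.2|)|) ^ (-b)) ^ 3 +
          2 * u ^ 2 * (K * (1 + |(|p.1.2 - p.2.2|)|) ^ (-b)) ^ 2| ≤
          16 * K ^ 3 + 2 * u ^ 2 * K ^ 2 := by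
    intro p
    have h1 : (1 + |(|p.1.2 - p.2.2|)|) ^ (-b) ≤ 1 :=
      Real.rpow_le_one_of_one_le_of_nonpos (by linarith [abs_nonneg |p.1.2 - p.2.2|])
        (by linarith)
    have h2 : K * (1 + |(|p.1.2 - p.2.2|)|) ^ (-b) ≤ K := mul_le_of_le_one_right hK.le h1
    rw [abs_of_nonneg (by positivity)]
    gcongr
  rw [← integral_sphereTimeMeasure_prod hT (c := fun τ => 4 * Real.pi *
      (16 * (K * (1 + |τ|) ^ (-b)) ^ 3 + 2 * u ^ 2 * (K * (1 + |τ|) ^ (-b)) ^ 2)) hmeas hbd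
    fun x t s => by simp [sphereArea_real_univ]]
  refine (le_abs_self _).trans ((abs_integral_le_integral_abs).trans
    (integral_mono_of_nonneg (Eventually.of_forall fun p => abs_nonneg _)
      (Integrable.of_bound hmeas.aestronglyMeasurable _ (Eventually.of_forall hbd))
      (Eventually.of_forall fun p => ?_)))
  refine (abs_integral_exceedanceResidual_mul_le
    (hZ.hasGaussianLaw_pair p.1.1 p.2.1 p.1.2 p.2.2)
    (hZ.centered _ _) (hZ.unit_variance _ _) (hZ.centered _ _) (hZ.unit_variance _ _) u
    (hZ.abs_covariance_le_one _ _ _ _)).trans ?_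
  have h3 := hbound _ (inner_mem_Icc p.1.1 p.2.1) (p.1.2 - p.2.2)
  rw [hZ.covariance]
  simp only [abs_abs]
  gcongr

/-- By Fubini a variable orthogonal to every `Z(x, t)` is orthogonal to their integral, so the
closure criterion for Gaussian processes applies. -/
theorem map_linearPart [IsProbabilityMeasure P] (hZ : IsSphereTimeGaussianField P Z Γ) (T : ℝ) :
    P.map (linearPart Z T) = gaussianReal 0 (∫ ω, linearPart Z T ω ^ 2 ∂P).toNNReal := by
  refine map_eq_gaussianReal_of_orthogonal hZ.gaussian (fun p => hZ.centered p.1 p.2)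
    (hZ.memLp_linearPart T) fun V hVm hV h => ?_
  refine (hZ.isBoundedSecondMomentField_linear.integral_integral_mul
    (sphereTimeMeasure T) hVm hV).trans ?_
  simp [h]

end IsSphereTimeGaussianField

end AreaDecomposition

/-! ### Slutsky argument for a Gaussian variable with an orthogonal remainder. -/

section CentralLimit

variable {Ω : Type*} [MeasurableSpace Ω] {P : Measure Ω}

theorem tendstoInMeasure_zero_of_integral_sq {f : ℝ → Ω → ℝ} {l : Filter ℝ}
    (hf : ∀ T, MemLp (f T) 2 P) (h : Tendsto (fun T => ∫ ω, f T ω ^ 2 ∂P) l (𝓝 0)) :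
    TendstoInMeasure P f l 0 := by
  refine tendstoInMeasure_of_tendsto_eLpNorm (p := 2) (by norm_num)
    (fun T => (hf T).aestronglyMeasurable) aestronglyMeasurable_const ?_
  have h1 : ∀ T, eLpNorm (f T - 0) 2 P = ENNReal.ofReal (√(∫ ω, f T ω ^ 2 ∂P)) := by
    intro T
    rw [sub_zero, (hf T).eLpNorm_eq_integral_rpow_norm (by norm_num) (by norm_num),
      Real.sqrt_eq_rpow]
    norm_num
  simp_rw [h1]
  have h2 := ENNReal.tendsto_ofReal ((Real.continuous_sqrt.tendsto 0).comp h)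
  simpa [Function.comp_def] using h2

/-- A random variable that is the orthogonal sum of a centered Gaussian variable and a remainder
of relatively vanishing second moment is asymptotically Gaussian after standardization. -/
theorem tendstoInDistribution_of_orthogonal_remainder [IsProbabilityMeasure P]
    {A L R : ℝ → Ω → ℝ} {φ : ℝ} (hφ : 0 < φ) (hA : ∀ T, AEMeasurable (A T) P)
    (hAe : ∀ T, A T =ᵐ[P] fun ω => φ * L T ω + R T ω)
    (hL : ∀ T, MemLp (L T) 2 P) (hR : ∀ T, MemLp (R T) 2 P)
    (hRL : ∀ T, ∫ ω, R T ω * L T ω ∂P = 0)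
    (hmap : ∀ T, P.map (L T) = gaussianReal 0 (∫ ω, L T ω ^ 2 ∂P).toNNReal)
    (hpos : ∀ᶠ T in atTop, 0 < ∫ ω, L T ω ^ 2 ∂P)
    (hratio : Tendsto (fun T => (∫ ω, R T ω ^ 2 ∂P) / ∫ ω, L T ω ^ 2 ∂P) atTop (𝓝 0)) :
    TendstoInDistribution
      (fun T ω => A T ω / √(φ ^ 2 * (∫ ω, L T ω ^ 2 ∂P) + ∫ ω, R T ω ^ 2 ∂P)) atTop
      (id : ℝ → ℝ) (fun _ => P) (gaussianReal 0 1) := by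
  set s : ℝ → ℝ := fun T => ∫ ω, L T ω ^ 2 ∂P with hs
  set r : ℝ → ℝ := fun T => ∫ ω, R T ω ^ 2 ∂P with hr
  have hr0 : ∀ T, 0 ≤ r T := fun T => integral_nonneg fun ω => sq_nonneg _
  have hLm : ∀ T, AEMeasurable (L T) P := fun T => (hL T).aestronglyMeasurable.aemeasurable
  -- Once `s T > 0` this variable is exactly standard Gaussian, so its laws are eventually constant.
  have hX : TendstoInDistribution (fun T ω => L T ω / √(s T)) atTop (id : ℝ → ℝ) (fun _ => P)
      (gaussianReal 0 1) := by
    refine ⟨fun T => (hLm T).div_const _, aemeasurable_id, ?_⟩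
    refine tendsto_const_nhds.congr' ?_
    filter_upwards [hpos] with T hT
    refine Subtype.ext ?_
    change (gaussianReal 0 1).map id = P.map (fun ω => L T ω / √(s T))
    have h1 : P.map (fun ω => L T ω / √(s T)) = (P.map (L T)).map (· / √(s T)) :=
      (AEMeasurable.map_map_of_aemeasurable (g := (· / √(s T))) (by fun_prop) (hLm T)).symm
    rw [h1, hmap, gaussianReal_map_div_const, Measure.map_id, zero_div]
    congr 1
    refine NNReal.coe_injective ?_
    have h2 : ((∫ ω, L T ω ^ 2 ∂P).toNNReal : ℝ) = s T := Real.coe_toNNReal _ hT.le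
    rw [NNReal.coe_div, h2, NNReal.coe_mk, Real.sq_sqrt hT.le, div_self hT.ne', NNReal.coe_one]
  refine tendstoInDistribution_of_tendstoInMeasure_sub _ _ hX ?_ fun T => (hA T).div_const _
  set v : ℝ → ℝ := fun T => φ ^ 2 * s T + r T with hv
  set a : ℝ → ℝ := fun T => φ / √(v T) - 1 / √(s T) with ha
  set D : ℝ → Ω → ℝ := fun T ω => a T * L T ω + 1 / √(v T) * R T ω with hD
  have hDL : ∀ T, MemLp (D T) 2 P := fun T => ((hL T).const_mul _).add ((hR T).const_mul _)
  have hDsq : ∀ T, ∫ ω, D T ω ^ 2 ∂P = a T ^ 2 * s T + (1 / √(v T)) ^ 2 * r T := by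
    intro T
    have h1 : ∀ ω, D T ω ^ 2 = a T ^ 2 * L T ω ^ 2 + (1 / √(v T)) ^ 2 * R T ω ^ 2 +
        2 * a T * (1 / √(v T)) * (R T ω * L T ω) := fun ω => by simp only [hD]; ring
    have i1 : Integrable (fun ω => a T ^ 2 * L T ω ^ 2) P := (hL T).integrable_sq.const_mul _
    have i2 : Integrable (fun ω => (1 / √(v T)) ^ 2 * R T ω ^ 2) P :=
      (hR T).integrable_sq.const_mul _
    have i3 : Integrable (fun ω => 2 * a T * (1 / √(v T)) * (R T ω * L T ω)) P :=
      ((hR T).integrable_mul (hL T)).const_mul _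
    have i12 : Integrable (fun ω => a T ^ 2 * L T ω ^ 2 + (1 / √(v T)) ^ 2 * R T ω ^ 2) P :=
      i1.add i2
    simp_rw [h1]
    rw [integral_add i12 i3, integral_add i1 i2, integral_const_mul, integral_const_mul,
      integral_const_mul, hRL T, mul_zero, add_zero]
  have hlim : Tendsto (fun T => ∫ ω, D T ω ^ 2 ∂P) atTop (𝓝 0) := by
    -- By orthogonality the squared `L²` distance between the two normalizations depends only on the
    -- ratio `ρ = r / s`, through this function, which is continuous at `0` because `φ > 0` and
    -- vanishes there.
    have h1 : Tendsto (fun ρ : ℝ => (φ / √(φ ^ 2 + ρ) - 1) ^ 2 + ρ / (φ ^ 2 + ρ)) (𝓝 0)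
        (𝓝 ((φ / √(φ ^ 2 + 0) - 1) ^ 2 + 0 / (φ ^ 2 + 0))) := by
      have h2 : Tendsto (fun ρ : ℝ => φ ^ 2 + ρ) (𝓝 0) (𝓝 (φ ^ 2 + 0)) :=
        tendsto_const_nhds.add tendsto_id
      refine (((tendsto_const_nhds.div ((Real.continuous_sqrt.tendsto _).comp h2) ?_).sub
        tendsto_const_nhds).pow 2).add (tendsto_id.div h2 (by positivity))
      rw [add_zero, Real.sqrt_sq hφ.le]
      exact hφ.ne'
    have h0 : (φ / √(φ ^ 2 + 0) - 1) ^ 2 + 0 / (φ ^ 2 + 0) = 0 := by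
      rw [add_zero, Real.sqrt_sq hφ.le, div_self hφ.ne']
      simp
    rw [h0] at h1
    refine (h1.comp hratio).congr' ?_
    filter_upwards [hpos] with T hT
    rw [hDsq]
    have hsT : 0 < s T := hT
    have hρ : 0 ≤ r T / s T := div_nonneg (hr0 T) hsT.le
    have hvT : v T = (φ ^ 2 + r T / s T) * s T := by simp only [hv]; field_simp
    have hq : 0 < φ ^ 2 + r T / s T := by positivity
    have hsq : √(v T) = √(φ ^ 2 + r T / s T) * √(s T) := by rw [hvT, Real.sqrt_mul hq.le]
    have e1 : a T ^ 2 * s T = (φ / √(φ ^ 2 + r T / s T) - 1) ^ 2 := by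
      have hs' := Real.sqrt_pos.2 hsT
      have hq' := Real.sqrt_pos.2 hq
      have e : a T = (φ / √(φ ^ 2 + r T / s T) - 1) / √(s T) := by
        simp only [ha, hsq]
        field_simp
      rw [e, div_pow, Real.sq_sqrt hsT.le, div_mul_cancel₀ _ hsT.ne']
    have e2 : (1 / √(v T)) ^ 2 * r T = r T / s T / (φ ^ 2 + r T / s T) := by
      rw [div_pow, Real.sq_sqrt (by rw [hvT]; positivity), hvT]
      generalize φ ^ 2 + r T / s T = q at hq ⊢
      field_simp
    rw [e1, e2]
    rfl
  refine (tendstoInMeasure_zero_of_integral_sq hDL hlim).congr (fun T => ?_) EventuallyEq.rfl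
  filter_upwards [hAe T] with ω hω
  simp only [hD, ha, Pi.sub_apply, hω, hv]
  ring

end CentralLimit

/-! ### Negligibility of the residual and the limit theorem. -/

section MainTheorem

/-- The cubic term decays at rate `3b`, the quadratic one at rate `2b` unless `u = 0` removes it;
both rates must exceed `β₀`. -/
theorem tendsto_residual_bound_div_rpow {b β₀ K u : ℝ} (h3 : β₀ < 3 * b)
    (h2 : u = 0 ∨ β₀ < 2 * b) :
    Tendsto (fun x : ℝ => 4 * Real.pi * (16 * (K * (1 + |x|) ^ (-b)) ^ 3 +
      2 * u ^ 2 * (K * (1 + |x|) ^ (-b)) ^ 2) / x ^ (-β₀)) atTop (𝓝 0) := by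
  have hp : ∀ (k : ℕ) (x : ℝ), (1 + |x|) ^ (-(k * b)) = ((1 + |x|) ^ (-b)) ^ k := by
    intro k x
    rw [← Real.rpow_natCast, ← Real.rpow_mul (by positivity)]
    ring_nf
  have l3 := tendsto_one_add_rpow_div_rpow ((3 : ℕ) * b) β₀ (by push_cast; exact h3.le)
  rw [if_neg (by push_cast; exact h3.ne')] at l3
  have l2 : Tendsto (fun x : ℝ => u ^ 2 * ((1 + |x|) ^ (-((2 : ℕ) * b)) / x ^ (-β₀))) atTop
      (𝓝 0) := by
    rcases h2 with rfl | h2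
    · simp
    · have l2 := tendsto_one_add_rpow_div_rpow ((2 : ℕ) * b) β₀ (by push_cast; exact h2.le)
      rw [if_neg (by push_cast; exact h2.ne')] at l2
      simpa using l2.const_mul (u ^ 2)
  have := (l3.const_mul (64 * Real.pi * K ^ 3)).add (l2.const_mul (8 * Real.pi * K ^ 2))
  simp only [mul_zero, add_zero] at this
  refine this.congr fun x => ?_
  rw [hp, hp]
  ring

variable {Ω : Type*} [MeasurableSpace Ω] {P : Measure Ω} [IsProbabilityMeasure P]
  {Z : S2 → ℝ → Ω → ℝ} {Γ : ℝ → ℝ → ℝ}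

namespace IsSphereTimeGaussianField

theorem tendsto_integral_linearPart_sq_div_rpow (hZ : IsSphereTimeGaussianField P Z Γ)
    (hc : Continuous (Function.uncurry Γ)) {α : ℝ} {β : ℕ → ℝ} (hβ : HasMemoryExponents Γ α β)
    (h1 : β 0 < 1) :
    Tendsto (fun T => (∫ ω, linearPart Z T ω ^ 2 ∂P) / T ^ (2 - β 0)) atTop
      (𝓝 (4 * Real.pi * (2 * multipoleCov Γ 0 0 / ((1 - β 0) * (2 - β 0))))) := by
  have h := (tendsto_double_integral_div_rpow h1
    (fun a b => (continuous_multipoleCov hc 0).intervalIntegrable a b)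
    (hβ.tendsto_multipoleCov_zero h1)).const_mul (4 * Real.pi)
  refine h.congr' ?_
  filter_upwards [eventually_ge_atTop 0] with T hT
  rw [hZ.integral_linearPart_sq hc hT, mul_div_assoc]

theorem tendsto_integral_residualPart_sq_div_rpow (hZ : IsSphereTimeGaussianField P Z Γ)
    (hc : Continuous (Function.uncurry Γ)) {α : ℝ} {β : ℕ → ℝ} (hβ : HasMemoryExponents Γ α β)
    {b u : ℝ} (h1 : β 0 < 1) (hb0 : 0 ≤ b) (hb1 : b ≤ 1)
    (hb : ∀ l ∈ activeMultipoles Γ, b ≤ β l) (h3 : β 0 < 3 * b) (h2 : u = 0 ∨ β 0 < 2 * b) :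
    Tendsto (fun T => (∫ ω, residualPart Z u T ω ^ 2 ∂P) / T ^ (2 - β 0)) atTop (𝓝 0) := by
  obtain ⟨K, hK, hbound⟩ := hZ.exists_abs_cov_le hc hβ hb0 hb1 hb
  have hcont : Continuous fun x : ℝ => 4 * Real.pi * (16 * (K * (1 + |x|) ^ (-b)) ^ 3 +
      2 * u ^ 2 * (K * (1 + |x|) ^ (-b)) ^ 2) := by
    have : Continuous fun x : ℝ => (1 + |x|) ^ (-b) :=
      Continuous.rpow_const (by fun_prop) fun x => Or.inl (by positivity)
    fun_prop
  have h := (tendsto_double_integral_div_rpow h1 (fun a b => hcont.intervalIntegrable a b)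
    (tendsto_residual_bound_div_rpow (K := K) h3 h2)).const_mul (4 * Real.pi)
  simp only [mul_zero, zero_div] at h
  refine squeeze_zero' ?_ ?_ h
  · filter_upwards [eventually_ge_atTop 0] with T hT
    exact div_nonneg (integral_nonneg fun ω => sq_nonneg _) (Real.rpow_nonneg hT _)
  · filter_upwards [eventually_ge_atTop 0] with T hT
    rw [← mul_div_assoc]
    exact div_le_div_of_nonneg_right
      (hZ.integral_residualPart_sq_le hK hb0 hbound u hT) (Real.rpow_nonneg hT _)

/-- The linear part has variance of exact order `T^(2 - β 0)`, the residual one of smaller order. As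
they are orthogonal, the first determines both the limit of the variance and the limit law. -/
theorem limit_areaFunctional_of_continuous (hZ : IsSphereTimeGaussianField P Z Γ)
    (hc : Continuous (Function.uncurry Γ)) {α : ℝ} {β : ℕ → ℝ} (hβ : HasMemoryExponents Γ α β)
    {b u : ℝ} (h1 : β 0 < 1) (hb0 : 0 ≤ b) (hb1 : b ≤ 1)
    (hb : ∀ l ∈ activeMultipoles Γ, b ≤ β l) (h3 : β 0 < 3 * b) (h2 : u = 0 ∨ β 0 < 2 * b) :
    Tendsto (fun T : ℝ => variance (areaFunctional P Z u T) P / T ^ (2 - β 0)) atTop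
      (𝓝 (4 * Real.pi * (2 * gaussianPDFReal 0 1 u ^ 2 * multipoleCov Γ 0 0 /
        ((1 - β 0) * (2 - β 0))))) ∧
    TendstoInDistribution (fun (T : ℝ) (ω : Ω) => normalizedAreaFunctional P Z u T ω) atTop
      (id : ℝ → ℝ) (fun _ => P) (gaussianReal 0 1) := by
  have hL := hZ.tendsto_integral_linearPart_sq_div_rpow hc hβ h1
  have hR := hZ.tendsto_integral_residualPart_sq_div_rpow hc hβ h1 hb0 hb1 hb h3 h2
  have hC : 0 < multipoleCov Γ 0 0 :=
    lt_of_le_of_ne ((abs_nonneg _).trans (hZ.abs_multipoleCov_le hc 0 0)) (Ne.symm hβ.zero_mem)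
  have hlimpos : 0 < 4 * Real.pi * (2 * multipoleCov Γ 0 0 / ((1 - β 0) * (2 - β 0))) := by
    have : 0 < 1 - β 0 := by linarith
    have : 0 < 2 - β 0 := by linarith
    positivity
  refine ⟨?_, ?_⟩
  · have h := (hL.const_mul (gaussianPDFReal 0 1 u ^ 2)).add hR
    have e : gaussianPDFReal 0 1 u ^ 2 *
        (4 * Real.pi * (2 * multipoleCov Γ 0 0 / ((1 - β 0) * (2 - β 0)))) + 0 =
        4 * Real.pi * (2 * gaussianPDFReal 0 1 u ^ 2 * multipoleCov Γ 0 0 /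
          ((1 - β 0) * (2 - β 0))) := by ring
    rw [e] at h
    refine h.congr fun T => ?_
    rw [hZ.variance_areaFunctional u T]
    ring
  · have hpos : ∀ᶠ T in atTop, 0 < ∫ ω, linearPart Z T ω ^ 2 ∂P := by
      filter_upwards [hL.eventually (lt_mem_nhds hlimpos), eventually_gt_atTop 0] with T h hT
      exact (div_pos_iff_of_pos_right (Real.rpow_pos_of_pos hT _)).1 h
    have hratio : Tendsto (fun T => (∫ ω, residualPart Z u T ω ^ 2 ∂P) /
        ∫ ω, linearPart Z T ω ^ 2 ∂P) atTop (𝓝 0) := by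
      have h := hR.div hL hlimpos.ne'
      rw [zero_div] at h
      refine h.congr' ?_
      filter_upwards [eventually_gt_atTop 0] with T hT
      exact div_div_div_cancel_right₀ (Real.rpow_pos_of_pos hT _).ne' _ _
    have h := tendstoInDistribution_of_orthogonal_remainder
      (gaussianPDFReal_pos 0 1 u one_ne_zero)
      (fun T => (hZ.measurable_areaFunctional u T).aemeasurable)
      (fun T => hZ.areaFunctional_ae_eq u T) hZ.memLp_linearPart
      (fun T => hZ.memLp_residualPart u T) (fun T => hZ.integral_residualPart_mul_linearPart u T)
      hZ.map_linearPart hpos hratio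
    simp_rw [← hZ.variance_areaFunctional u] at h
    exact h

end IsSphereTimeGaussianField

/-- The covariance function extended from `[-1, 1] × ℝ` to be constant in `θ` outside. -/
def clampCov (Γ : ℝ → ℝ → ℝ) (θ τ : ℝ) : ℝ := Γ (max (-1) (min 1 θ)) τ

theorem clampCov_of_mem {Γ : ℝ → ℝ → ℝ} {θ : ℝ} (hθ : θ ∈ Set.Icc (-1 : ℝ) 1) (τ : ℝ) :
    clampCov Γ θ τ = Γ θ τ := by
  rw [clampCov, min_eq_right hθ.2, max_eq_right hθ.1]

theorem multipoleCov_clampCov (Γ : ℝ → ℝ → ℝ) : multipoleCov (clampCov Γ) = multipoleCov Γ := by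
  funext l τ
  unfold multipoleCov
  congr 1
  refine intervalIntegral.integral_congr fun θ hθ => ?_
  rw [Set.uIcc_of_le (by norm_num)] at hθ
  simp only [clampCov_of_mem hθ]

theorem activeMultipoles_clampCov (Γ : ℝ → ℝ → ℝ) :
    activeMultipoles (clampCov Γ) = activeMultipoles Γ := by
  simp only [activeMultipoles, multipoleCov_clampCov]

theorem HasMemoryExponents.clampCov {α : ℝ} {β : ℕ → ℝ} (h : HasMemoryExponents Γ α β) :
    HasMemoryExponents (clampCov Γ) α β := by
  obtain ⟨h1, h2, h3, h4, h5⟩ := h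
  constructor <;> simpa only [activeMultipoles_clampCov, multipoleCov_clampCov]

theorem IsSphereTimeGaussianField.continuous_clampCov {P : Measure Ω}
    (hZ : IsSphereTimeGaussianField P Z Γ) : Continuous (Function.uncurry (clampCov Γ)) := by
  have h : Continuous fun p : ℝ × ℝ => (max (-1) (min 1 p.1), p.2) := by fun_prop
  exact hZ.continuousOn.comp_continuous h fun p =>
    ⟨⟨le_max_left _ _, max_le (by norm_num) (min_le_left _ _)⟩, Set.mem_univ _⟩

theorem IsSphereTimeGaussianField.clampCov {P : Measure Ω}
    (hZ : IsSphereTimeGaussianField P Z Γ) : IsSphereTimeGaussianField P Z (clampCov Γ) where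
  measurable := hZ.measurable
  gaussian := hZ.gaussian
  centered := hZ.centered
  covariance x y t s := by
    rw [hZ.covariance, clampCov_of_mem (inner_mem_Icc x y)]
  continuousOn := hZ.continuous_clampCov.continuousOn
  unit_variance := hZ.unit_variance

end MainTheorem

theorem theorem1 {Ω : Type*} [MeasurableSpace Ω] (P : Measure Ω) [IsProbabilityMeasure P]
    (Z : S2 → ℝ → Ω → ℝ) (Γ : ℝ → ℝ → ℝ) (hZ : IsSphereTimeGaussianField P Z Γ)
    (α : ℝ) (β : ℕ → ℝ) (hβ : HasMemoryExponents Γ α β)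
    (βstar : ℝ) (hstar : IsLeast (β '' {l | l ∈ activeMultipoles Γ ∧ 1 ≤ l}) βstar)
    (u : ℝ)
    (hu : (u ≠ 0 ∧ β 0 < min (2 * βstar) 1) ∨ (u = 0 ∧ β 0 < min (3 * βstar) 1)) :
    Tendsto (fun T : ℝ => variance (areaFunctional P Z u T) P / T ^ (2 - β 0)) atTop
      (𝓝 (4 * Real.pi * (2 * gaussianPDFReal 0 1 u ^ 2 * multipoleCov Γ 0 0 /
        ((1 - β 0) * (2 - β 0))))) ∧
    TendstoInDistribution (fun (T : ℝ) (ω : Ω) => normalizedAreaFunctional P Z u T ω) atTop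
      (id : ℝ → ℝ) (fun _ => P) (gaussianReal 0 1) := by
  have h01 := hβ.mem_Ioc 0 hβ.zero_mem
  obtain ⟨⟨lstar, ⟨hl, -⟩, hlβ⟩, hmin⟩ := hstar
  have hs := hβ.mem_Ioc lstar hl
  rw [hlβ] at hs
  -- Clamping makes the covariance function continuous on the whole plane without changing any
  -- multipole. The decay rate has to take `β 0` into account, since the monopole may decay slowest.
  have h := hZ.clampCov.limit_areaFunctional_of_continuous (b := min (β 0) βstar) (u := u)
    hZ.continuous_clampCov hβ.clampCov ?_ (le_min h01.1.le hs.1.le)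
    ((min_le_left _ _).trans h01.2) ?_ ?_ ?_
  · rwa [multipoleCov_clampCov] at h
  · rcases hu with ⟨-, h⟩ | ⟨-, h⟩ <;> exact (lt_min_iff.1 h).2
  · intro l hlact
    rw [activeMultipoles_clampCov] at hlact
    rcases Nat.eq_zero_or_pos l with rfl | hpos
    · exact min_le_left _ _
    · exact (min_le_right _ _).trans (hmin ⟨l, ⟨hlact, hpos⟩, rfl⟩)
  -- If the minimum is `β 0`, positivity gives `β 0 < 3 β 0`, and likewise with the factor `2`
  -- below; otherwise the hypothesis on `β 0` and `βstar > 0` suffice.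
  · have := h01.1
    have := hs.1
    rcases min_choice (β 0) βstar with e | e <;> rw [e] <;>
      rcases hu with ⟨-, h⟩ | ⟨-, h⟩ <;> linarith [(lt_min_iff.1 h).1]
  · rcases hu with ⟨-, h⟩ | ⟨h0, -⟩
    · right
      have := h01.1
      rcases min_choice (β 0) βstar with e | e <;> rw [e] <;> linarith [(lt_min_iff.1 h).1]
    · exact Or.inl h0
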